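/- Fix $q\ge 1$ and numbers of groups $G_1,\dots,G_q$. For each $n=1,2,\dots$ let the following be given (the index $n$ is suppressed): networks on the node sets $[N_l]$ with non-random $0/1$ adjacency matrices $(a^{(l)}_{ij})$ with zero diagonal and row-normalizations $w^{(l)}_{ij}=a^{(l)}_{ij}/\sum_k a^{(l)}_{ik}$ ($1\le l\le q$); non-random true memberships $\mathcal G_l^0=(g^{(l)0}_i)_{i\in[N_l]}\in[G_l]^{N_l}$; true parameters $\xi^0$ consisting of $\theta^{(l)0}_g=(\lambda^{(l)0}_g,\zeta^{(l)0}_g)\in\mathbb R^{1+p_l}$ ($g\in[G_l]$) and $\alpha^0=(\alpha^0_{g_1\cdots g_q})$; and random variables with $$Y_{i_1\cdots i_q,t}=\sum_{l=1}^q\lambda^{(l)0}_{g^{(l)0}_{i_l}}\sum_{k=1}^{N_l}w^{(l)}_{i_lk}Y_{i_1\cdots i_{l-1}k\,i_{l+1}\cdots i_q,t-1}+\alpha^0_{g^{(1)0}_{i_1}\cdots g^{(q)0}_{i_q}}Y_{i_1\cdots i_q,t-1}+\sum_{l=1}^q x^{(l)\top}_{i_lt}\zeta^{(l)0}_{g^{(l)0}_{i_l}}+\varepsilon_{i_1\cdots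 i_q,t},\qquad 1\le t\le T,$$ where $x^{(l)}_{it}\in\mathbb R^{p_l}$. Let $Q(\xi,\mathcal G)$ be the sum of squared residuals over all $(i_1,\dots,i_q)$ and $1\le t\le T$ when $\xi^0,\mathcal G^0$ are replaced by $\xi,\mathcal G$; let $m=\sum_l(p_l+1)+1$, and let $\mathcal X_{i_1\cdots i_q,t}\in\mathbb R^m$ be the regressor vector formed by the $q$ network averages, the covariates $x^{(l)}_{i_lt}$ and $Y_{i_1\cdots i_q,t-1}$. Suppose that, with constants $B,C,\tau,\sigma,K,c_\pi\in(0,\infty)$ and $\kappa_{\max}<1$ not depending on $n$: 1. $|\lambda^{(l)0}_g|,\ \|\zeta^{(l)0}_g\|,\ |\alpha^0_{g_1\cdots g_q}|\le B$. 2. For all sufficiently large $n$ and every $(i_1,\dots,i_q)$, the smallest eigenvalue of $T^{-1}\sum_{t=1}^T E(\mathcal X_{i_1\cdots i_q,t}\mathcal X_{i_1\cdots i_q,t}^\top)$ is at least $\tau$. 3. The $\varepsilon_{i_1\cdots i_q,t}$ are i.i.d. over $(i_1,\dots,i_q)$ and $1\le t\le T$, $E\varepsilon=0$, $E e^{u\varepsilon}\le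 e^{\sigma^2u^2/2}$ for all $u\in\mathbb R$, and the family of all $\varepsilon_{i_1\cdots i_q,t}$ is independent of the family of all covariates $x^{(l)}_{it}$, $1\le t\le T$. 4. $E x^{(l)}_{it}=0$, and for all non-random $\eta^{(l)}_{it}\in\mathbb R^{p_l}$ with $\|\eta^{(l)}_{it}\|\le1$ the vector $v=(x^{(l)\top}_{it}\eta^{(l)}_{it})_{l\le q,\,1\le t\le T,\,i\le N_l}$ has the $K$-convex concentration property: for every convex $1$-Lipschitz $\varphi$ (Euclidean norm), $E|\varphi(v)|<\infty$ and $P(|\varphi(v)-E\varphi(v)|\ge s)\le2e^{-s^2/K^2}$ for all $s>0$. 5. $Y_{\cdot,0}=0$ almost surely, and $\sum_l|\lambda^{(l)0}_{g_l}|+|\alpha^0_{g_1\cdots g_q}|\le\kappa_{\max}$ for all $(g_1,\dots,g_q)$. 6. For each $l$ and all $g\ne g'$ in $[G_l]$, $\|\theta^{(l)0}_g-\theta^{(l)0}_{g'}\|^2+\max|\alpha^0_{\cdots g\cdots}-\alpha^0_{\cdots g'\cdots}|^2\ge c_{gap}$, the maximum being over the group indices of the other $q-1$ networks; here $c_{gap}=c_{gap,n}\in(0,C]$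 may tend to $0$. 7. For all sufficiently large $n$, $|\{i\in[N_l]:g^{(l)0}_i=g\}|\ge c_\pi N_l$ for all $l$ and $g\in[G_l]$. Let $(\widehat\xi,\widehat{\mathcal G})$ be a global minimizer of $Q$ over all parameters and all memberships with the correct group numbers $G_1,\dots,G_q$, and let $\widehat\xi^{\rm or}$ be a minimizer of $Q(\cdot,\mathcal G^0)$. If $N_1,\dots,N_q,T\to\infty$ and $T^{1/2}c_{gap}\big/\big(\sum_l\log N_l+m\big)\to\infty$ as $n\to\infty$, then with probability tending to $1$ there are permutations $\pi_l$ of $[G_l]$ with $\widehat g^{(l)}_i=\pi_l(g^{(l)0}_i)$ for all $l$ and $i$; and with probability tending to $1$ there are such permutations for which, moreover, $\widehat\xi$ with its group labels permuted accordingly equals $\widehat\xi^{\rm or}$, that is, $\widehat\theta^{(l)}_{\pi_l(g)}=\widehat\theta^{(l),\rm or}_g$ and $\widehat\alpha_{\pi_1(g_1)\cdots\pi_q(g_q)}=\widehat\alpha^{\rm or}_{g_1\cdots g_q}$ for all groups. -/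

import Mathlib

open MeasureTheory ProbabilityTheory Filter Topology
open scoped NNReal ENNReal

noncomputable section

namespace GTNAR

/-- The `K`-convex concentration property of a random vector `X` in Euclidean space. -/
def ConvexConcentration {Ω ι : Type*} [MeasurableSpace Ω] [Fintype ι] (K : ℝ)
    (X : Ω → EuclideanSpace ℝ ι) (μ : Measure Ω) : Prop :=
  ∀ φ : EuclideanSpace ℝ ι → ℝ, LipschitzWith 1 φ → ConvexOn ℝ Set.univ φ →
    Integrable (fun ω => φ (X ω)) μ ∧
    ∀ t : ℝ, 0 < t →
      μ.real {ω | t ≤ |φ (X ω) - ∫ ω', φ (X ω') ∂μ|} ≤ 2 * Real.exp (-t ^ 2 / K ^ 2)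

/-- The group-level parameters `ξ`: for every network `l` and every group `g` of it the vector
`θ = (λ, ζ)`, and the tensor `α` indexed by tuples of groups. `G l` is the number of groups and
`p l` the number of covariates of network `l`. -/
@[ext]
structure Param {q : ℕ} (G p : Fin q → ℕ) where
  lam : ∀ l, Fin (G l) → ℝ
  zeta : ∀ l, Fin (G l) → EuclideanSpace ℝ (Fin (p l))
  alpha : (∀ l, Fin (G l)) → ℝ

/-- Relabelling the groups: the new group `g` of network `l` is the old group `π l g`. -/
def Param.relabel {q : ℕ} {G p : Fin q → ℕ} (π : ∀ l, Equiv.Perm (Fin (G l)))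
    (ξ : Param G p) : Param G p where
  lam l g := ξ.lam l (π l g)
  zeta l g := ξ.zeta l (π l g)
  alpha g := ξ.alpha (fun l => π l (g l))

/-- Group memberships of the nodes of all networks. -/
abbrev Membership {q : ℕ} (N G : Fin q → ℕ) : Type := ∀ l, Fin (N l) → Fin (G l)

/-- Row-normalized adjacency matrix. -/
def rowNormalize {N : ℕ} (A : Matrix (Fin N) (Fin N) ℝ) : Matrix (Fin N) (Fin N) ℝ :=
  fun i j => A i j / ∑ k, A i k

/-- The regression function
`∑ₗ λ_{g(iₗ)} (Y ×ₗ W)_i + α_{g(i₁) … g(i_q)} Y_i + ∑ₗ xᵀ ζ_{g(iₗ)}`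
at the tensor entry `i`, where `y` is the previous value of the response tensor and `x` holds the
present covariates. -/
def regression {q : ℕ} {N G p : Fin q → ℕ} (W : ∀ l, Matrix (Fin (N l)) (Fin (N l)) ℝ)
    (ξ : Param G p) (g : Membership N G) (y : (∀ l, Fin (N l)) → ℝ)
    (x : ∀ l, Fin (N l) → EuclideanSpace ℝ (Fin (p l))) (i : ∀ l, Fin (N l)) : ℝ :=
  (∑ l, ξ.lam l (g l (i l)) * ∑ k, W l (i l) k * y (Function.update i l k))
    + ξ.alpha (fun l => g l (i l)) * y i
    + ∑ l, inner ℝ (x l (i l)) (ξ.zeta l (g l (i l)))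

/-- A group tensor network autoregression with `q` networks, having `G l` groups in network `l`,
observed at the times `0, …, T`. -/
structure Model {q : ℕ} (G : Fin q → ℕ) where
  /-- numbers of nodes -/
  N : Fin q → ℕ
  /-- number of time points -/
  T : ℕ
  /-- numbers of covariates -/
  p : Fin q → ℕ
  /-- adjacency matrices -/
  A : ∀ l, Matrix (Fin (N l)) (Fin (N l)) ℝ
  A_zero_or_one : ∀ l i j, A l i j = 0 ∨ A l i j = 1
  A_diag : ∀ l i, A l i i = 0
  /-- true parameters -/
  ξ₀ : Param G p
  /-- true, non-random memberships -/
  g₀ : Membership N G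
  /-- probability space -/
  Ω : Type*
  [mΩ : MeasurableSpace Ω]
  μ : Measure Ω
  [prob : IsProbabilityMeasure μ]
  /-- responses -/
  Y : ℕ → (∀ l, Fin (N l)) → Ω → ℝ
  /-- covariates -/
  x : ∀ l, ℕ → Fin (N l) → Ω → EuclideanSpace ℝ (Fin (p l))
  /-- noise -/
  ε : ℕ → (∀ l, Fin (N l)) → Ω → ℝ
  measurable_Y : ∀ t i, Measurable (Y t i)
  measurable_x : ∀ l t i, Measurable (x l t i)
  measurable_ε : ∀ t i, Measurable (ε t i)
  /-- the autoregression -/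
  equation : ∀ᵐ ω ∂μ, ∀ t ∈ Finset.Icc 1 T, ∀ i,
    Y t i ω = regression (fun l => rowNormalize (A l)) ξ₀ g₀ (fun j => Y (t - 1) j ω)
      (fun l j => x l t j ω) i + ε t i ω

attribute [instance] Model.mΩ Model.prob

namespace Model

variable {q : ℕ} {G : Fin q → ℕ} (S : Model G)

/-- The index set of the tensor entries. -/
abbrev Node : Type := ∀ l, Fin (S.N l)

/-- The times `1, …, T`. -/
abbrev Time : Type := {t : ℕ // t ∈ Finset.Icc 1 S.T}

/-- Row-normalized adjacency matrices. -/
def W (l : Fin q) : Matrix (Fin (S.N l)) (Fin (S.N l)) ℝ := rowNormalize (S.A l)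

/-- The length `m = ∑ₗ (pₗ + 1) + 1` of the regressor of a tensor entry. -/
def m : ℕ := ∑ l, (S.p l + 1) + 1

/-- Coordinates of the regressor of a tensor entry: for every network the network effect (`none`)
and the covariates (`some k`), and the self-momentum. -/
abbrev RegIdx : Type := ((l : Fin q) × Option (Fin (S.p l))) ⊕ Unit

/-- The regressor of the tensor entry `i` at time `t`. -/
def regressor (t : ℕ) (i : S.Node) (ω : S.Ω) : S.RegIdx → ℝ
  | .inl ⟨l, none⟩ => ∑ k, S.W l (i l) k * S.Y (t - 1) (Function.update i l k) ω
  | .inl ⟨l, some k⟩ => S.x l t (i l) ω k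
  | .inr () => S.Y (t - 1) i ω

/-- The second moment matrix of the regressor of the tensor entry `i` at time `t`. -/
def secondMoment (t : ℕ) (i : S.Node) : Matrix S.RegIdx S.RegIdx ℝ :=
  fun a b => ∫ ω, S.regressor t i ω a * S.regressor t i ω b ∂S.μ

/-- The least squares objective function `Q(ξ, 𝒢)`. -/
def loss (ξ : Param G S.p) (g : Membership S.N G) (ω : S.Ω) : ℝ :=
  ∑ i : S.Node, ∑ t ∈ Finset.Icc 1 S.T,
    (S.Y t i ω - regression S.W ξ g (fun j => S.Y (t - 1) j ω) (fun l j => S.x l t j ω) i) ^ 2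

/-- `(ξ, g)` is a global minimizer of the least squares objective. -/
def IsEstimate (ω : S.Ω) (ξ : Param G S.p) (g : Membership S.N G) : Prop :=
  ∀ (ξ' : Param G S.p) (g' : Membership S.N G), S.loss ξ g ω ≤ S.loss ξ' g' ω

/-- `ξ` is a least squares estimate for the true memberships. -/
def IsOracleEstimate (ω : S.Ω) (ξ : Param G S.p) : Prop :=
  ∀ ξ' : Param G S.p, S.loss ξ S.g₀ ω ≤ S.loss ξ' S.g₀ ω

/-- Parameter space: the true parameters are bounded by `B`. -/
def BoundedParam (B : ℝ) : Prop :=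
  (∀ l g, |S.ξ₀.lam l g| ≤ B) ∧ (∀ l g, ‖S.ξ₀.zeta l g‖ ≤ B) ∧ ∀ g, |S.ξ₀.alpha g| ≤ B

/-- Convexity: for every tensor entry the smallest eigenvalue of the second moment matrix of its
regressor, averaged over the times `1, …, T`, is at least `τ`. (At time `1` alone the matrix is
singular because the series starts at zero.) -/
def Convexity (τ : ℝ) : Prop :=
  ∀ (i : S.Node) (v : S.RegIdx → ℝ),
    τ * (v ⬝ᵥ v) ≤
      v ⬝ᵥ (((S.T : ℝ)⁻¹ • ∑ t ∈ Finset.Icc 1 S.T, S.secondMoment t i).mulVec v)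

/-- Noise: i.i.d. over the tensor entries and the times, centred, sub-Gaussian with scale `σ`, and
independent of the covariates. -/
structure SubGaussianNoise (σ : ℝ≥0) : Prop where
  indep : iIndepFun (fun (a : S.Time × S.Node) => S.ε a.1 a.2) S.μ
  ident : ∀ a b : S.Time × S.Node, IdentDistrib (S.ε a.1 a.2) (S.ε b.1 b.2) S.μ S.μ
  mean : ∀ a : S.Time × S.Node, ∫ ω, S.ε a.1 a.2 ω ∂S.μ = 0
  subGaussian : ∀ a : S.Time × S.Node, HasSubgaussianMGF (S.ε a.1 a.2) (σ ^ 2) S.μ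
  exogenous : IndepFun (fun ω (a : S.Time × S.Node) => S.ε a.1 a.2 ω)
    (fun ω (l : Fin q) (a : S.Time × Fin (S.N l)) => S.x l a.1 a.2 ω) S.μ

/-- Covariates: centred, and for all non-random vectors `η` in the unit balls the vector of all the
scalar products `xᵀ η` has the `K`-convex concentration property. -/
structure ConcentratedCovariates (K : ℝ) : Prop where
  mean : ∀ l, ∀ t ∈ Finset.Icc 1 S.T, ∀ i, ∫ ω, S.x l t i ω ∂S.μ = 0
  concentration : ∀ η : ∀ l, S.Time → Fin (S.N l) → EuclideanSpace ℝ (Fin (S.p l)),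
    (∀ l t i, ‖η l t i‖ ≤ 1) →
    ConvexConcentration K
      (fun ω => WithLp.toLp 2 (fun a : (l : Fin q) × (S.Time × Fin (S.N l)) =>
        inner ℝ (S.x a.1 a.2.1 a.2.2 ω) (η a.1 a.2.1 a.2.2))) S.μ

/-- Stability: the series starts at zero and the sums of the absolute values of its autoregressive
coefficients are at most `κ`. -/
def Stability (κ : ℝ) : Prop :=
  (∀ i, ∀ᵐ ω ∂S.μ, S.Y 0 i ω = 0) ∧
  ∀ g : ∀ l, Fin (G l), (∑ l, |S.ξ₀.lam l (g l)|) + |S.ξ₀.alpha g| ≤ κ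

/-- Group difference: a gap of at least `c` between any two groups of the same network. -/
def GroupGap (c : ℝ) : Prop :=
  ∀ (l : Fin q) (g₁ g₂ : Fin (G l)), g₁ ≠ g₂ →
    c ≤ (S.ξ₀.lam l g₁ - S.ξ₀.lam l g₂) ^ 2 + ‖S.ξ₀.zeta l g₁ - S.ξ₀.zeta l g₂‖ ^ 2
      + ⨆ g : ∀ l, Fin (G l),
          |S.ξ₀.alpha (Function.update g l g₁) - S.ξ₀.alpha (Function.update g l g₂)| ^ 2

/-- Group proportion: every group makes up at least a fraction `c` of the nodes of its network. -/
def GroupProportion (c : ℝ) : Prop :=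
  ∀ (l : Fin q) (g : Fin (G l)),
    c ≤ ((Finset.univ.filter (fun i => S.g₀ l i = g)).card : ℝ) / (S.N l : ℝ)

end Model

/-- The events `E n` have probability tending to one. The formulation by complements needs no
measurability of `E n`. -/
def WithProbTendsToOne {Ω : ℕ → Type*} [∀ n, MeasurableSpace (Ω n)] (μ : ∀ n, Measure (Ω n))
    (E : ∀ n, Set (Ω n)) : Prop :=
  Tendsto (fun n => μ n (E n)ᶜ) atTop (𝓝 0)

theorem withProbTendsToOne_iff {Ω : ℕ → Type*} [∀ n, MeasurableSpace (Ω n)]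
    (μ : ∀ n, Measure (Ω n)) [∀ n, IsProbabilityMeasure (μ n)] (E : ∀ n, Set (Ω n))
    (hE : ∀ n, NullMeasurableSet (E n) (μ n)) :
    WithProbTendsToOne μ E ↔ Tendsto (fun n => μ n (E n)) atTop (𝓝 1) := by
  have h1 : ∀ n, μ n (E n)ᶜ = 1 - μ n (E n) := fun n => prob_compl_eq_one_sub₀ (hE n)
  have h2 : ∀ n, μ n (E n) = 1 - μ n (E n)ᶜ := fun n => by
    rw [h1, ENNReal.sub_sub_cancel ENNReal.one_ne_top prob_le_one]
  unfold WithProbTendsToOne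
  constructor
  · intro h
    have := ENNReal.Tendsto.sub (tendsto_const_nhds (x := (1 : ℝ≥0∞)) (f := atTop (α := ℕ))) h
      (Or.inl ENNReal.one_ne_top)
    simpa [← h2] using this
  · intro h
    have := ENNReal.Tendsto.sub (tendsto_const_nhds (x := (1 : ℝ≥0∞)) (f := atTop (α := ℕ))) h
      (Or.inl ENNReal.one_ne_top)
    simpa [← h1] using this

end GTNAR

end

/-!
Recovery of the groups in a group tensor network autoregression.

Every least squares fit is a fit, at each tensor entry separately, of one coefficient vector that
depends on the groups of the entry. Hence the loss, compared with its value at the truth, is a sum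
over the entries of functions `f i v` of the deviation `v` of the coefficients at the entry `i`. The
function `f i` consists of the empirical second moment of the regressors, a quadratic form in `v`,
and of the empirical covariance of regressors and noise, a linear form in `v`.

*Recovery.* Suppose that all the quadratic forms have their eigenvalues in a fixed interval
`[a, M]`, and that all the linear forms have norms of at most `ρ`, where `ρ ^ 2` is small compared
with the gap between the groups. A minimizer then has a mean square deviation of order `ρ ^ 2`.
Since every group has a positive proportion of the nodes, for each true group the most frequent
estimated group inside it has almost its coefficients, and by the gap different true groups lead to
different estimated groups. If a node were put into a wrong group, then moving it to the right group
would change the loss on its slice of the tensor only; on that slice the fit was worse by the order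
of the gap and becomes as good as on typical slices. So a minimizer makes no mistake
(`exists_perm_of_minimizer`), and since the loss for the true memberships is strictly convex, it
agrees with the oracle estimate (`Model.oracle_unique`, `Model.recovery_of_mem_goodEvent`).

*Concentration.* It remains to show that the above holds with high probability at all the entries
with `ρ` proportional to the gap. For a fixed unit vector `v` the two forms deviate from their means
on the scale `√T` with exponential tails (`Model.exists_concentration`). Such tails are expressed by
exponential moments (`SubExp` and, for squares, `SubG`), which are convex in the random variable and
thus bound averages without any independence. Substituting the recursion of the series into its
second moments, or into its products with a later input, gives quantities of the same kind at the
previous times, multiplied by a factor `κ < 1`, and sums over time of products of two inputs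
(`IsAutoregression.subExp_auto`, `IsAutoregression.subExp_cross`); the inputs are the noise and the
scalar products of the covariates with fixed vectors. Products with noise are handled by exponential
supermartingales (`subExp_sum_mul`, `subExp_sum_sq`). Products of covariates are handled by the
convex concentration property, first for squared norms and then by polarization
(`ConvexConcentration.subExp_norm_sq`, `ConvexConcentration.subExp_sum_mul`).

A net of `5 ^ m` points of the unit ball extends the bounds to all `v`, and a union bound over the
net and all the tensor entries costs a factor `exp (∑ log N + 4 m)`
(`Model.measure_compl_goodEvent_le`, `union_bound_le`). This is what the assumption on the growth of
`√T` times the gap pays for.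
-/

namespace GTNAR

/-! ### Exponential moments -/

section Orlicz

variable {Ω : Type*} [MeasurableSpace Ω] {μ : Measure Ω}

/-- The exponential moment of `f` is at most two. Both Orlicz norms `ψ₁` and `ψ₂` are expressed by
this condition. -/
def ExpBound (μ : Measure Ω) (f : Ω → ℝ) : Prop :=
  Measurable f ∧ ∫⁻ ω, ENNReal.ofReal (Real.exp (f ω)) ∂μ ≤ 2

/-- `X` is sub-exponential with scale `L` around some centre. Leaving the centre free makes the
property stable under linear combinations without any integrability side conditions. -/
def SubExp (μ : Measure Ω) (L : ℝ) (X : Ω → ℝ) : Prop :=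
  Measurable X ∧ ∃ c : ℝ, ExpBound μ (fun ω => |X ω - c| / L)

/-- `X` is sub-Gaussian with scale `L` around zero. -/
def SubG (μ : Measure Ω) (L : ℝ) (X : Ω → ℝ) : Prop :=
  Measurable X ∧ ExpBound μ (fun ω => (X ω / L) ^ 2)

theorem ExpBound.mono {f g : Ω → ℝ} (hf : ExpBound μ f) (hg : Measurable g) (h : ∀ ω, g ω ≤ f ω) :
    ExpBound μ g :=
  ⟨hg, (lintegral_mono fun ω => ENNReal.ofReal_le_ofReal (Real.exp_le_exp.2 (h ω))).trans hf.2⟩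

theorem ExpBound.convex [IsProbabilityMeasure μ] {ι : Type*} (s : Finset ι) {w : ι → ℝ}
    (hw : ∀ k ∈ s, 0 ≤ w k) (hw1 : ∑ k ∈ s, w k ≤ 1) {f : ι → Ω → ℝ}
    (hf : ∀ k ∈ s, ExpBound μ (f k)) {g : Ω → ℝ} (hg : Measurable g)
    (h : ∀ ω, g ω ≤ ∑ k ∈ s, w k * f k ω) : ExpBound μ g := by
  refine ⟨hg, ?_⟩
  have key : ∀ ω, Real.exp (g ω) ≤ ∑ k ∈ s, w k * Real.exp (f k ω) + (1 - ∑ k ∈ s, w k) := by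
    intro ω
    have hc := convexOn_exp.map_sum_le (t := Finset.insertNone s)
      (w := fun o => o.elim (1 - ∑ k ∈ s, w k) w) (p := fun o => o.elim 0 (fun k => f k ω))
      (by
        intro o ho
        cases o with
        | none => simpa using hw1
        | some k => exact hw k (by simpa using ho))
      (by simp [Finset.sum_insertNone]) (by simp)
    simp only [Finset.sum_insertNone, Option.elim, smul_eq_mul, mul_zero, zero_add, Real.exp_zero,
      mul_one] at hc
    have := Real.exp_le_exp.2 (h ω)
    linarith
  calc ∫⁻ ω, ENNReal.ofReal (Real.exp (g ω)) ∂μ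
      ≤ ∫⁻ ω, (∑ k ∈ s, ENNReal.ofReal (w k) * ENNReal.ofReal (Real.exp (f k ω))
          + ENNReal.ofReal (1 - ∑ k ∈ s, w k)) ∂μ := by
        refine lintegral_mono fun ω => ?_
        refine (ENNReal.ofReal_le_ofReal (key ω)).trans ?_
        rw [ENNReal.ofReal_add (Finset.sum_nonneg fun k hk =>
          mul_nonneg (hw k hk) (Real.exp_pos _).le) (by linarith),
          ENNReal.ofReal_sum_of_nonneg fun k hk => mul_nonneg (hw k hk) (Real.exp_pos _).le]
        gcongr with k hk
        rw [ENNReal.ofReal_mul (hw k hk)]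
    _ = ∑ k ∈ s, ENNReal.ofReal (w k) * ∫⁻ ω, ENNReal.ofReal (Real.exp (f k ω)) ∂μ
          + ENNReal.ofReal (1 - ∑ k ∈ s, w k) := by
        rw [lintegral_add_right _ measurable_const, lintegral_finsetSum']
        · congr 1
          · refine Finset.sum_congr rfl fun k hk => ?_
            rw [lintegral_const_mul' _ _ ENNReal.ofReal_ne_top]
          · simp
        · intro k hk
          exact ((hf k hk).1.exp.ennreal_ofReal.const_mul _).aemeasurable
    _ ≤ ∑ k ∈ s, ENNReal.ofReal (w k) * 2 + ENNReal.ofReal (1 - ∑ k ∈ s, w k) := by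
        gcongr with k hk
        exact (hf k hk).2
    _ = ENNReal.ofReal (∑ k ∈ s, w k) * 2 + ENNReal.ofReal (1 - ∑ k ∈ s, w k) := by
        rw [ENNReal.ofReal_sum_of_nonneg hw, Finset.sum_mul]
    _ ≤ 2 := by
        have h0 : 0 ≤ ∑ k ∈ s, w k := Finset.sum_nonneg hw
        have : (2 : ℝ≥0∞) = ENNReal.ofReal 2 := by norm_num
        rw [this, ← ENNReal.ofReal_mul h0, ← ENNReal.ofReal_add (by positivity) (by linarith)]
        exact ENNReal.ofReal_le_ofReal (by linarith)

theorem ExpBound.convex_two [IsProbabilityMeasure μ] {a b : ℝ} (ha : 0 ≤ a) (hb : 0 ≤ b)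
    (hab : a + b ≤ 1) {f₁ f₂ g : Ω → ℝ} (h₁ : ExpBound μ f₁) (h₂ : ExpBound μ f₂)
    (hg : Measurable g) (h : ∀ ω, g ω ≤ a * f₁ ω + b * f₂ ω) : ExpBound μ g := by
  refine ExpBound.convex (Finset.univ : Finset (Fin 2)) (w := ![a, b]) (f := ![f₁, f₂]) ?_ ?_ ?_
    hg ?_
  · intro k _; fin_cases k <;> simpa
  · simpa using hab
  · intro k _; fin_cases k <;> simpa
  · intro ω; simpa using h ω

theorem ExpBound.zero [IsProbabilityMeasure μ] : ExpBound μ (fun _ => 0) := by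
  refine ⟨measurable_const, ?_⟩
  simp

/-- An exponential moment of at most `2 ^ k` becomes at most `2` after division by `k`. -/
theorem expBound_div [IsProbabilityMeasure μ] {k : ℕ} (hk : 0 < k) {f : Ω → ℝ} (hm : Measurable f)
    (h : ∫⁻ ω, ENNReal.ofReal (Real.exp (f ω)) ∂μ ≤ 2 ^ k) :
    ExpBound μ (fun ω => f ω / k) := by
  refine ⟨hm.div_const _, ?_⟩
  have hk' : (0 : ℝ) < k := by exact_mod_cast hk
  have hk1 : (1 : ℝ) ≤ k := by exact_mod_cast hk
  have hk2 : (1 : ℝ) / k ≤ 1 := by rw [div_le_one hk']; exact hk1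
  -- the weighted inequality of arithmetic and geometric means for `exp f / 2 ^ k` and `1`
  have key : ∀ ω, Real.exp (f ω / k) ≤ 2 / k / 2 ^ k * Real.exp (f ω) + 2 * (1 - 1 / k) := by
    intro ω
    have hc := convexOn_exp.2 (Set.mem_univ (f ω - k * Real.log 2)) (Set.mem_univ 0)
      (by positivity : (0 : ℝ) ≤ 1 / k) (by linarith : (0 : ℝ) ≤ 1 - 1 / k) (by ring)
    simp only [smul_eq_mul, mul_zero, add_zero, Real.exp_zero, mul_one] at hc
    rw [show 1 / (k : ℝ) * (f ω - k * Real.log 2) = f ω / k - Real.log 2 by field_simp,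
      Real.exp_sub, Real.exp_log two_pos, Real.exp_sub, mul_comm (k : ℝ), Real.exp_mul,
      Real.exp_log two_pos, Real.rpow_natCast] at hc
    have e : 2 / k / 2 ^ k * Real.exp (f ω) + 2 * (1 - 1 / k)
        = 2 * (1 / k * (Real.exp (f ω) / 2 ^ k) + (1 - 1 / k)) := by ring
    rw [e]
    linarith
  calc ∫⁻ ω, ENNReal.ofReal (Real.exp (f ω / k)) ∂μ
      ≤ ∫⁻ ω, (ENNReal.ofReal (2 / k / 2 ^ k) * ENNReal.ofReal (Real.exp (f ω))
          + ENNReal.ofReal (2 * (1 - 1 / k))) ∂μ := by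
        refine lintegral_mono fun ω => (ENNReal.ofReal_le_ofReal (key ω)).trans ?_
        rw [ENNReal.ofReal_add (by positivity) (by linarith), ENNReal.ofReal_mul (by positivity)]
    _ = ENNReal.ofReal (2 / k / 2 ^ k) * ∫⁻ ω, ENNReal.ofReal (Real.exp (f ω)) ∂μ
          + ENNReal.ofReal (2 * (1 - 1 / k)) := by
        rw [lintegral_add_right _ measurable_const, lintegral_const_mul' _ _ ENNReal.ofReal_ne_top]
        simp
    _ ≤ ENNReal.ofReal (2 / k / 2 ^ k) * ENNReal.ofReal (2 ^ k)
          + ENNReal.ofReal (2 * (1 - 1 / k)) := by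
        gcongr
        refine h.trans (le_of_eq ?_)
        rw [ENNReal.ofReal_pow (by norm_num)]; norm_num
    _ = 2 := by
        rw [← ENNReal.ofReal_mul (by positivity),
          ← ENNReal.ofReal_add (by positivity) (by linarith)]
        rw [div_mul_cancel₀ _ (by positivity), show (2:ℝ) / k + 2 * (1 - 1 / k) = 2 by ring]
        norm_num

theorem ExpBound.integrable_exp {f : Ω → ℝ} (hf : ExpBound μ f) :
    Integrable (fun ω => Real.exp (f ω)) μ := by
  refine ⟨hf.1.exp.aestronglyMeasurable, ?_⟩
  rw [hasFiniteIntegral_iff_ofReal (ae_of_all _ fun ω => (Real.exp_pos _).le)]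
  exact hf.2.trans_lt (by norm_num)

theorem ExpBound.integral_exp_le {f : Ω → ℝ} (hf : ExpBound μ f) :
    ∫ ω, Real.exp (f ω) ∂μ ≤ 2 := by
  rw [integral_eq_lintegral_of_nonneg_ae (ae_of_all _ fun ω => (Real.exp_pos _).le)
    hf.1.exp.aestronglyMeasurable]
  exact ENNReal.toReal_le_of_le_ofReal (by norm_num) (hf.2.trans (by norm_num))

theorem ExpBound.integrable {f : Ω → ℝ} (hf : ExpBound μ f) (h0 : ∀ ω, 0 ≤ f ω) :
    Integrable f μ :=
  hf.integrable_exp.mono' hf.1.aestronglyMeasurable (ae_of_all _ fun ω => by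
    rw [Real.norm_of_nonneg (h0 ω)]; linarith [Real.add_one_le_exp (f ω)])

theorem ExpBound.integral_le {f : Ω → ℝ} [IsProbabilityMeasure μ]
    (hf : ExpBound μ f) (h0 : ∀ ω, 0 ≤ f ω) :
    ∫ ω, f ω ∂μ ≤ 1 := by
  have h := integral_mono ((hf.integrable h0).add (integrable_const (1 : ℝ))) hf.integrable_exp
    (fun ω => Real.add_one_le_exp (f ω))
  simp only [Pi.add_apply] at h
  rw [integral_add (hf.integrable h0) (integrable_const _)] at h
  have := hf.integral_exp_le
  simp at h
  linarith

/-- Markov's inequality for the exponential moment. -/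
theorem ExpBound.measure_le {f : Ω → ℝ} (hf : ExpBound μ f) (s : ℝ) :
    μ {ω | s ≤ f ω} ≤ ENNReal.ofReal (2 * Real.exp (-s)) := by
  have h1 := mul_meas_ge_le_lintegral (μ := μ) hf.1.exp.ennreal_ofReal (ENNReal.ofReal (Real.exp s))
  have h2 : {ω | s ≤ f ω} ⊆ {ω | ENNReal.ofReal (Real.exp s) ≤ ENNReal.ofReal (Real.exp (f ω))} :=
    fun ω hω => ENNReal.ofReal_le_ofReal (Real.exp_le_exp.2 hω)
  have h3 : ENNReal.ofReal (Real.exp s) * μ {ω | s ≤ f ω} ≤ 2 :=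
    (mul_le_mul_right (measure_mono h2) _).trans (h1.trans hf.2)
  calc μ {ω | s ≤ f ω}
      = ENNReal.ofReal (Real.exp (-s)) * (ENNReal.ofReal (Real.exp s) * μ {ω | s ≤ f ω}) := by
        rw [← mul_assoc, ← ENNReal.ofReal_mul (Real.exp_pos _).le, ← Real.exp_add]
        simp
    _ ≤ ENNReal.ofReal (Real.exp (-s)) * 2 := by gcongr
    _ = _ := by
        rw [ENNReal.ofReal_mul (by norm_num), mul_comm]; norm_num

theorem SubExp.mono {L L' : ℝ} {X : Ω → ℝ} (h : SubExp μ L X) (hL : 0 < L) (hLL : L ≤ L') :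
    SubExp μ L' X := by
  obtain ⟨hX, c, hc⟩ := h
  exact ⟨hX, c, hc.mono (by fun_prop) fun ω => by gcongr⟩

theorem SubExp.zero [IsProbabilityMeasure μ] (L : ℝ) : SubExp μ L (fun _ => 0) :=
  ⟨measurable_const, 0, by simpa using ExpBound.zero⟩

theorem SubExp.sum [IsProbabilityMeasure μ] {ι : Type*} (s : Finset ι) (w : ι → ℝ) {L b : ℝ}
    (hL : 0 < L) (hb : 0 < b) (hw : ∑ k ∈ s, |w k| ≤ b) {X : ι → Ω → ℝ}
    (hX : ∀ k ∈ s, SubExp μ L (X k)) :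
    SubExp μ (b * L) (fun ω => ∑ k ∈ s, w k * X k ω) := by
  have hm : Measurable (fun ω => ∑ k ∈ s, w k * X k ω) :=
    Finset.measurable_sum _ fun k hk => (hX k hk).1.const_mul _
  have : ∀ k, ∃ c : ℝ, k ∈ s → ExpBound μ (fun ω => |X k ω - c| / L) := fun k => by
    by_cases hk : k ∈ s
    · obtain ⟨c, hc⟩ := (hX k hk).2
      exact ⟨c, fun _ => hc⟩
    · exact ⟨0, fun h => absurd h hk⟩
  choose c hc using this
  refine ⟨hm, ∑ k ∈ s, w k * c k, ?_⟩
  refine ExpBound.convex s (w := fun k => |w k| / b) (fun k _ => by positivity) ?_ hc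
    (by fun_prop) ?_
  · rw [← Finset.sum_div, div_le_one hb]; exact hw
  · intro ω
    have h1 : |∑ k ∈ s, w k * X k ω - ∑ k ∈ s, w k * c k| ≤ ∑ k ∈ s, |w k| * |X k ω - c k| := by
      rw [← Finset.sum_sub_distrib]
      refine (Finset.abs_sum_le_sum_abs _ _).trans (le_of_eq ?_)
      refine Finset.sum_congr rfl fun k _ => ?_
      rw [← mul_sub, abs_mul]
    calc _ ≤ (∑ k ∈ s, |w k| * |X k ω - c k|) / (b * L) := by gcongr
      _ = _ := by
        rw [Finset.sum_div]
        refine Finset.sum_congr rfl fun k _ => ?_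
        field_simp

theorem SubExp.add [IsProbabilityMeasure μ] {L₁ L₂ : ℝ} {X₁ X₂ : Ω → ℝ} (h₁ : SubExp μ L₁ X₁)
    (h₂ : SubExp μ L₂ X₂) (hL₁ : 0 < L₁) (hL₂ : 0 < L₂) :
    SubExp μ (L₁ + L₂) (fun ω => X₁ ω + X₂ ω) := by
  obtain ⟨hX₁, c₁, hc₁⟩ := h₁
  obtain ⟨hX₂, c₂, hc₂⟩ := h₂
  refine ⟨hX₁.add hX₂, c₁ + c₂, ?_⟩
  refine ExpBound.convex_two (a := L₁ / (L₁ + L₂)) (b := L₂ / (L₁ + L₂)) (by positivity)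
    (by positivity) (by rw [← add_div, div_self (by positivity)]) hc₁ hc₂ (by fun_prop) ?_
  intro ω
  have h1 : |X₁ ω + X₂ ω - (c₁ + c₂)| ≤ |X₁ ω - c₁| + |X₂ ω - c₂| := by
    rw [show X₁ ω + X₂ ω - (c₁ + c₂) = (X₁ ω - c₁) + (X₂ ω - c₂) by ring]
    exact abs_add_le _ _
  calc _ ≤ (|X₁ ω - c₁| + |X₂ ω - c₂|) / (L₁ + L₂) := by gcongr
    _ = _ := by field_simp

theorem SubExp.const_mul [IsProbabilityMeasure μ] {L a b : ℝ} {X : Ω → ℝ} (h : SubExp μ L X)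
    (hL : 0 < L) (hb : 0 < b) (hab : |a| ≤ b) : SubExp μ (b * L) (fun ω => a * X ω) := by
  have := SubExp.sum (μ := μ) ({()} : Finset Unit) (fun _ => a) hL hb (by simpa using hab)
    (X := fun _ => X) (fun _ _ => h)
  simpa using this

/-- Replacing the unspecified centre by the expectation costs at most the scale. -/
theorem SubExp.expBound_mean [IsProbabilityMeasure μ] {L : ℝ} {X : Ω → ℝ} (h : SubExp μ L X)
    (hL : 0 < L) : Integrable X μ ∧ ∃ c, |c - ∫ ω, X ω ∂μ| ≤ L ∧
      ExpBound μ (fun ω => |X ω - c| / L) := by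
  obtain ⟨hX, c, hc⟩ := h
  have h0 : ∀ ω, 0 ≤ |X ω - c| / L := fun ω => by positivity
  have hi : Integrable (fun ω => |X ω - c|) μ := by
    have := (hc.integrable h0).mul_const L
    refine this.congr (ae_of_all _ fun ω => ?_)
    field_simp
  have hi2 : Integrable (fun ω => X ω - c) μ :=
    (integrable_norm_iff (hX.sub_const c).aestronglyMeasurable).1 hi
  have hi3 : Integrable X μ := by
    refine (hi2.add (integrable_const c)).congr (ae_of_all _ fun ω => ?_)
    simp
  refine ⟨hi3, c, ?_, hc⟩
  have h1 := hc.integral_le h0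
  rw [integral_div, div_le_one hL] at h1
  have h2 : ∫ ω, X ω ∂μ - c = ∫ ω, (X ω - c) ∂μ := by
    rw [integral_sub hi3 (integrable_const _)]; simp
  rw [abs_sub_comm, h2]
  exact (abs_integral_le_integral_abs).trans h1

theorem SubExp.measure_le [IsProbabilityMeasure μ] {L : ℝ} {X : Ω → ℝ} (h : SubExp μ L X)
    (hL : 0 < L) (s : ℝ) :
    μ {ω | s ≤ |X ω - ∫ ω', X ω' ∂μ|} ≤ ENNReal.ofReal (6 * Real.exp (-(s / L))) := by
  obtain ⟨-, c, hc1, hc2⟩ := h.expBound_mean hL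
  have hsub : {ω | s ≤ |X ω - ∫ ω', X ω' ∂μ|} ⊆ {ω | s / L - 1 ≤ |X ω - c| / L} := by
    intro ω hω
    simp only [Set.mem_ofPred_eq] at hω ⊢
    have := abs_sub_le (X ω) c (∫ ω', X ω' ∂μ)
    rw [div_sub_one hL.ne']
    gcongr
    linarith
  refine (measure_mono hsub).trans ((hc2.measure_le _).trans (ENNReal.ofReal_le_ofReal ?_))
  rw [show -(s / L - 1) = 1 + -(s / L) by ring, Real.exp_add]
  have := Real.exp_one_lt_d9
  nlinarith [Real.exp_pos (-(s / L))]

theorem SubG.mono {L L' : ℝ} {X : Ω → ℝ} (h : SubG μ L X) (hL : 0 < L) (hLL : L ≤ L') :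
    SubG μ L' X := by
  refine ⟨h.1, h.2.mono (by have := h.1; fun_prop) fun ω => ?_⟩
  rw [div_pow, div_pow]
  gcongr

theorem SubG.zero [IsProbabilityMeasure μ] (L : ℝ) : SubG μ L (fun _ => 0) :=
  ⟨measurable_const, by simpa using ExpBound.zero⟩

theorem SubG.sum [IsProbabilityMeasure μ] {ι : Type*} (s : Finset ι) (w : ι → ℝ) {L b : ℝ}
    (hL : 0 < L) (hb : 0 < b) (hw : ∑ k ∈ s, |w k| ≤ b) {X : ι → Ω → ℝ}
    (hX : ∀ k ∈ s, SubG μ L (X k)) :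
    SubG μ (b * L) (fun ω => ∑ k ∈ s, w k * X k ω) := by
  have hm : Measurable (fun ω => ∑ k ∈ s, w k * X k ω) :=
    Finset.measurable_sum _ fun k hk => (hX k hk).1.const_mul _
  refine ⟨hm, ExpBound.convex s (w := fun k => |w k| / b) (fun k _ => by positivity) ?_
    (fun k hk => (hX k hk).2) (by fun_prop) ?_⟩
  · rw [← Finset.sum_div, div_le_one hb]; exact hw
  · intro ω
    have h1 : (∑ k ∈ s, w k * X k ω) ^ 2 ≤ (∑ k ∈ s, |w k|) * ∑ k ∈ s, |w k| * X k ω ^ 2 := by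
      refine Finset.sum_sq_le_sum_mul_sum_of_sq_le_mul s (fun k _ => abs_nonneg _)
        (fun k _ => by positivity) fun k _ => ?_
      rw [mul_pow, ← mul_assoc, ← sq, sq_abs]
    have h2 : 0 ≤ ∑ k ∈ s, |w k| * X k ω ^ 2 := Finset.sum_nonneg fun k _ => by positivity
    calc ((∑ k ∈ s, w k * X k ω) / (b * L)) ^ 2
        ≤ (b * ∑ k ∈ s, |w k| * X k ω ^ 2) / (b * L) ^ 2 := by
          rw [div_pow]; gcongr; exact h1.trans (by gcongr)
      _ = _ := by
        rw [Finset.mul_sum, Finset.sum_div]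
        refine Finset.sum_congr rfl fun k _ => ?_
        field_simp

theorem SubG.add [IsProbabilityMeasure μ] {L₁ L₂ : ℝ} {X₁ X₂ : Ω → ℝ} (h₁ : SubG μ L₁ X₁)
    (h₂ : SubG μ L₂ X₂) (hL₁ : 0 < L₁) (hL₂ : 0 < L₂) :
    SubG μ (L₁ + L₂) (fun ω => X₁ ω + X₂ ω) := by
  have hm₁ := h₁.1
  have hm₂ := h₂.1
  refine ⟨hm₁.add hm₂, ?_⟩
  refine ExpBound.convex_two (a := L₁ / (L₁ + L₂)) (b := L₂ / (L₁ + L₂)) (by positivity)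
    (by positivity) (by rw [← add_div, div_self (by positivity)]) h₁.2 h₂.2 (by fun_prop) ?_
  intro ω
  rw [div_pow, div_le_iff₀ (by positivity)]
  have : L₁ / (L₁ + L₂) * (X₁ ω / L₁) ^ 2 + L₂ / (L₁ + L₂) * (X₂ ω / L₂) ^ 2
      = (X₁ ω ^ 2 / L₁ + X₂ ω ^ 2 / L₂) / (L₁ + L₂) := by field_simp
  rw [this, sq (L₁ + L₂), ← mul_assoc, div_mul_cancel₀ _ (by positivity)]
  have h3 : (X₁ ω ^ 2 / L₁ + X₂ ω ^ 2 / L₂) * (L₁ + L₂) - (X₁ ω + X₂ ω) ^ 2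
      = (L₂ * X₁ ω - L₁ * X₂ ω) ^ 2 / (L₁ * L₂) := by
    field_simp
    ring
  have h4 : 0 ≤ (L₂ * X₁ ω - L₁ * X₂ ω) ^ 2 / (L₁ * L₂) := by positivity
  linarith

theorem SubG.const_mul [IsProbabilityMeasure μ] {L a b : ℝ} {X : Ω → ℝ} (h : SubG μ L X)
    (hL : 0 < L) (hb : 0 < b) (hab : |a| ≤ b) : SubG μ (b * L) (fun ω => a * X ω) := by
  have := SubG.sum (μ := μ) ({()} : Finset Unit) (fun _ => a) hL hb (by simpa using hab)
    (X := fun _ => X) (fun _ _ => h)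
  simpa using this

theorem SubG.integrable_sq {L : ℝ} {X : Ω → ℝ} (h : SubG μ L X) (hL : 0 < L) :
    Integrable (fun ω => X ω ^ 2) μ := by
  refine ((h.2.integrable fun ω => sq_nonneg _).mul_const (L ^ 2)).congr (ae_of_all _ fun ω => ?_)
  field_simp

theorem SubG.memLp_two {L : ℝ} {X : Ω → ℝ} (h : SubG μ L X) (hL : 0 < L) : MemLp X 2 μ :=
  (memLp_two_iff_integrable_sq h.1.aestronglyMeasurable).2 (h.integrable_sq hL)

theorem SubG.integral_sq_le [IsProbabilityMeasure μ] {L : ℝ} {X : Ω → ℝ} (h : SubG μ L X)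
    (hL : 0 < L) : ∫ ω, X ω ^ 2 ∂μ ≤ L ^ 2 := by
  have := h.2.integral_le fun ω => sq_nonneg _
  simp_rw [div_pow] at this
  rwa [integral_div, div_le_one (by positivity)] at this

/-- Gaussian tails give a bounded `ψ₂` norm. -/
theorem subG_of_tail [IsProbabilityMeasure μ] {K : ℝ} (hK : 0 < K) {X : Ω → ℝ} (hX : Measurable X)
    (h : ∀ s : ℝ, 0 < s → μ.real {ω | s ≤ |X ω|} ≤ 2 * Real.exp (-s ^ 2 / K ^ 2)) :
    SubG μ (2 * K) X := by
  refine ⟨hX, by fun_prop, ?_⟩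
  have hm : Measurable fun ω => Real.exp ((X ω / (2 * K)) ^ 2) := by fun_prop
  rw [lintegral_eq_lintegral_meas_le μ (ae_of_all _ fun ω => (Real.exp_pos _).le) hm.aemeasurable]
  have hb1 : ∀ t ∈ Set.Ioi (1 : ℝ), μ {ω | t ≤ Real.exp ((X ω / (2 * K)) ^ 2)}
      ≤ ENNReal.ofReal (2 * t ^ (-4 : ℝ)) := by
    intro t ht
    have ht : 1 < t := ht
    have hl : 0 < Real.log t := Real.log_pos ht
    have h1 := h (2 * K * √(Real.log t)) (by positivity)
    have h2 : {ω | t ≤ Real.exp ((X ω / (2 * K)) ^ 2)}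
        ⊆ {ω | 2 * K * √(Real.log t) ≤ |X ω|} := by
      intro ω hω
      simp only [Set.mem_ofPred_eq] at hω ⊢
      have h3 := Real.log_le_log (by linarith) hω
      rw [Real.log_exp] at h3
      have h4 := Real.sqrt_le_sqrt h3
      rw [Real.sqrt_sq_eq_abs, abs_div, abs_of_pos (by positivity : 0 < 2 * K),
        le_div_iff₀ (by positivity)] at h4
      linarith
    refine (measure_mono h2).trans ?_
    rw [← ofReal_measureReal]
    refine ENNReal.ofReal_le_ofReal (h1.trans (le_of_eq ?_))
    rw [Real.rpow_def_of_pos (by linarith), mul_pow, mul_pow, Real.sq_sqrt hl.le]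
    congr 2
    field_simp
    norm_num
  calc ∫⁻ t in Set.Ioi 0, μ {ω | t ≤ Real.exp ((X ω / (2 * K)) ^ 2)}
      ≤ (∫⁻ t in Set.Ioc (0:ℝ) 1, μ {ω | t ≤ Real.exp ((X ω / (2 * K)) ^ 2)})
        + ∫⁻ t in Set.Ioi (1:ℝ), μ {ω | t ≤ Real.exp ((X ω / (2 * K)) ^ 2)} := by
        rw [← Set.Ioc_union_Ioi_eq_Ioi (zero_le_one' ℝ)]
        exact lintegral_union_le _ _ _
    _ ≤ (∫⁻ t in Set.Ioc (0:ℝ) 1, 1)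
        + ∫⁻ t in Set.Ioi (1:ℝ), ENNReal.ofReal (2 * t ^ (-4 : ℝ)) := by
        refine add_le_add (lintegral_mono fun _ => prob_le_one) ?_
        exact setLIntegral_mono' measurableSet_Ioi hb1
    _ ≤ 2 := by
        rw [← ofReal_integral_eq_lintegral_ofReal]
        · rw [integral_const_mul, integral_Ioi_rpow_of_lt (by norm_num) zero_lt_one]
          have : (2:ℝ≥0∞) = 1 + ENNReal.ofReal 1 := by norm_num
          rw [this]
          gcongr
          · simp
          · norm_num
        · exact (integrableOn_Ioi_rpow_of_lt (by norm_num) zero_lt_one).const_mul _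
        · filter_upwards [ae_restrict_mem measurableSet_Ioi] with t ht
          have : (0:ℝ) < t := lt_trans one_pos ht
          positivity

end Orlicz

end GTNAR

namespace GTNAR

/-! ### Exponential supermartingales -/

section Martingale

variable {Ω : Type*} [mΩ : MeasurableSpace Ω] {μ : Measure Ω} [IsProbabilityMeasure μ]

/-- One step of the exponential supermartingale: `ξ` is independent of the past `m'`, on which `G`
and `Z` depend. -/
theorem lintegral_mul_exp_le_of_indep {Ω : Type*} {m' mΩ : MeasurableSpace Ω} {μ : Measure Ω}
    [IsProbabilityMeasure μ] (hm' : m' ≤ mΩ) {ξ Z : Ω → ℝ}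
    (hξ : Measurable ξ) (hind : Indep (MeasurableSpace.comap ξ inferInstance) m' μ)
    {G : Ω → ℝ≥0∞} (hG : Measurable[m'] G) (hZ : Measurable[m'] Z) {s : ℝ}
    (hmgf : ∀ ω, ∫⁻ ω', ENNReal.ofReal (Real.exp (Z ω * ξ ω')) ∂μ
      ≤ ENNReal.ofReal (Real.exp (s * Z ω ^ 2))) :
    ∫⁻ ω, G ω * ENNReal.ofReal (Real.exp (Z ω * ξ ω - s * Z ω ^ 2)) ∂μ ≤ ∫⁻ ω, G ω ∂μ := by
  have hG' : Measurable G := hG.mono hm' le_rfl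
  have hZ' : Measurable Z := hZ.mono hm' le_rfl
  have hGZ : Measurable fun ω => (G ω, Z ω) := hG'.prodMk hZ'
  have hI : IndepFun ξ (fun ω => (G ω, Z ω)) μ := by
    rw [IndepFun_iff_Indep]
    exact indep_of_indep_of_le_right hind (Measurable.comap_le (hG.prodMk hZ))
  have hmap := (indepFun_iff_map_prod_eq_prod_map_map hξ.aemeasurable hGZ.aemeasurable).1 hI
  have hF : Measurable fun p : ℝ × (ℝ≥0∞ × ℝ) =>
      p.2.1 * ENNReal.ofReal (Real.exp (p.2.2 * p.1 - s * p.2.2 ^ 2)) := by fun_prop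
  calc ∫⁻ ω, G ω * ENNReal.ofReal (Real.exp (Z ω * ξ ω - s * Z ω ^ 2)) ∂μ
      = ∫⁻ p, p.2.1 * ENNReal.ofReal (Real.exp (p.2.2 * p.1 - s * p.2.2 ^ 2))
          ∂(μ.map fun ω => (ξ ω, (G ω, Z ω))) := by
        rw [lintegral_map hF (hξ.prodMk hGZ)]
    _ = ∫⁻ ω, ∫⁻ ω', G ω * ENNReal.ofReal (Real.exp (Z ω * ξ ω' - s * Z ω ^ 2)) ∂μ ∂μ := by
        have : IsProbabilityMeasure (μ.map ξ) := Measure.isProbabilityMeasure_map hξ.aemeasurable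
        have : IsProbabilityMeasure (μ.map fun ω => (G ω, Z ω)) :=
          Measure.isProbabilityMeasure_map hGZ.aemeasurable
        rw [hmap, lintegral_prod_symm' _ hF, lintegral_map _ hGZ]
        · refine lintegral_congr fun ω => ?_
          rw [lintegral_map _ hξ]
          fun_prop
        · exact Measurable.lintegral_prod_left' hF
    _ ≤ ∫⁻ ω, G ω ∂μ := by
        refine lintegral_mono fun ω => ?_
        have h1 : ∀ ω', G ω * ENNReal.ofReal (Real.exp (Z ω * ξ ω' - s * Z ω ^ 2))
            = (G ω * ENNReal.ofReal (Real.exp (-(s * Z ω ^ 2))))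
              * ENNReal.ofReal (Real.exp (Z ω * ξ ω')) := fun ω' => by
          rw [mul_assoc, ← ENNReal.ofReal_mul (Real.exp_pos _).le, ← Real.exp_add]
          congr 3
          ring
        simp_rw [h1]
        rw [lintegral_const_mul _ (by fun_prop)]
        refine (mul_le_mul_right (hmgf ω) _).trans (le_of_eq ?_)
        rw [mul_assoc, ← ENNReal.ofReal_mul (Real.exp_pos _).le, ← Real.exp_add]
        simp

/-- The exponential supermartingale of the sums `∑ Z ξ` of innovations `ξ` with predictable
weights `Z`. -/
theorem lintegral_exp_sum_le_one {ℱ : ℕ → MeasurableSpace Ω} (hℱ : ∀ t, ℱ t ≤ mΩ)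
    {ξ Z : ℕ → Ω → ℝ} (hξ : ∀ t, Measurable (ξ t))
    (hind : ∀ t, Indep (MeasurableSpace.comap (ξ t) inferInstance) (ℱ t) μ)
    (hξℱ : ∀ r t, r < t → Measurable[ℱ t] (ξ r)) (hZℱ : ∀ r t, r ≤ t → Measurable[ℱ t] (Z r))
    {s : ℝ} (hmgf : ∀ t ω, ∫⁻ ω', ENNReal.ofReal (Real.exp (Z t ω * ξ t ω')) ∂μ
      ≤ ENNReal.ofReal (Real.exp (s * Z t ω ^ 2))) (n : ℕ) :
    ∫⁻ ω, ENNReal.ofReal (Real.exp (∑ t ∈ Finset.range n, (Z t ω * ξ t ω - s * Z t ω ^ 2))) ∂μ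
      ≤ 1 := by
  induction n with
  | zero => simp
  | succ n ih =>
    refine le_trans ?_ ih
    have hG : Measurable[ℱ n] fun ω => ENNReal.ofReal (Real.exp
        (∑ t ∈ Finset.range n, (Z t ω * ξ t ω - s * Z t ω ^ 2))) := by
      refine ENNReal.measurable_ofReal.comp (Real.measurable_exp.comp ?_)
      refine Finset.measurable_sum _ fun t ht => ?_
      have ht' := Finset.mem_range.1 ht
      have h1 := hξℱ t n ht'
      have h2 := hZℱ t n ht'.le
      exact (h2.mul h1).sub ((h2.pow_const 2).const_mul s)
    refine le_trans (le_of_eq ?_) (lintegral_mul_exp_le_of_indep (hℱ n) (hξ n) (hind n) hG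
      (hZℱ n n le_rfl) (hmgf n))
    refine lintegral_congr fun ω => ?_
    rw [Finset.sum_range_succ, Real.exp_add, ENNReal.ofReal_mul (Real.exp_pos _).le]

theorem lintegral_exp_abs_le {Ω : Type*} [MeasurableSpace Ω] {μ : Measure Ω} {f : Ω → ℝ}
    (hf : Measurable f) :
    ∫⁻ ω, ENNReal.ofReal (Real.exp |f ω|) ∂μ ≤ ∫⁻ ω, ENNReal.ofReal (Real.exp (f ω)) ∂μ
      + ∫⁻ ω, ENNReal.ofReal (Real.exp (-f ω)) ∂μ := by
  rw [← lintegral_add_left hf.exp.ennreal_ofReal]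
  refine lintegral_mono fun ω => ?_
  rcases abs_cases (f ω) with ⟨h, -⟩ | ⟨h, -⟩ <;> rw [h] <;> simp

/-- A martingale transform of sub-Gaussian innovations by sub-Gaussian predictable weights over at
most `T` times is sub-exponential with scale of the order `√T`. -/
theorem subExp_sum_mul {ℱ : ℕ → MeasurableSpace Ω} (hℱ : ∀ t, ℱ t ≤ mΩ)
    {ξ Z : ℕ → Ω → ℝ} (hξ : ∀ t, Measurable (ξ t))
    (hind : ∀ t, Indep (MeasurableSpace.comap (ξ t) inferInstance) (ℱ t) μ)
    (hξℱ : ∀ r t, r < t → Measurable[ℱ t] (ξ r)) (hZℱ : ∀ r t, r ≤ t → Measurable[ℱ t] (Z r))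
    {σ L : ℝ} (hσ : 0 < σ) (hL : 0 < L)
    (hmgf : ∀ t (x : ℝ), ∫⁻ ω', ENNReal.ofReal (Real.exp (x * ξ t ω')) ∂μ
      ≤ ENNReal.ofReal (Real.exp (σ ^ 2 / 2 * x ^ 2)))
    (hZ : ∀ t, SubG μ L (Z t)) {S T : ℕ} (hST : S ≤ T) (hT : 0 < T) :
    SubExp μ (4 * σ * L * √T) (fun ω => ∑ t ∈ Finset.range S, Z t ω * ξ t ω) := by
  have hT' : (0 : ℝ) < T := by exact_mod_cast hT
  have hsT : 0 < √(T : ℝ) := Real.sqrt_pos.2 hT'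
  have hm : Measurable fun ω => ∑ t ∈ Finset.range S, Z t ω * ξ t ω :=
    Finset.measurable_sum _ fun t _ => (hZ t).1.mul (hξ t)
  refine ⟨hm, 0, ?_⟩
  -- the exponential moment of the quadratic variation
  have hq : ExpBound μ (fun ω => ∑ t ∈ Finset.range S, 1 / (T : ℝ) * (Z t ω / L) ^ 2) := by
    refine ExpBound.convex (Finset.range S) (w := fun _ => 1 / (T : ℝ)) (fun _ _ => by positivity)
      ?_ (fun t _ => (hZ t).2) ?_ (fun ω => le_rfl)
    · rw [Finset.sum_const, Finset.card_range, nsmul_eq_mul, mul_one_div, div_le_one hT']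
      exact_mod_cast hST
    · exact Finset.measurable_sum _ fun t _ => (hZ t).2.1.const_mul _
  have half : ∀ r : ℝ, r ^ 2 = 1 → ∫⁻ ω, ENNReal.ofReal (Real.exp
      (r * ((∑ t ∈ Finset.range S, Z t ω * ξ t ω) / (2 * σ * L * √T)))) ∂μ ≤ 2 := by
    intro r hr
    set c : ℝ := r / (σ * L * √T) with hc
    have hc2 : σ ^ 2 / 2 * c ^ 2 = 1 / 2 * (1 / T) * (1 / L ^ 2) := by
      rw [hc, div_pow, hr, mul_pow, mul_pow, Real.sq_sqrt hT'.le]; field_simp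
    have h1 := lintegral_exp_sum_le_one hℱ hξ hind hξℱ (Z := fun t ω => c * Z t ω)
      (fun r t h => (hZℱ r t h).const_mul c) (s := σ ^ 2 / 2) (fun t ω => hmgf t _) S
    calc _ ≤ ∫⁻ ω, (ENNReal.ofReal (Real.exp (∑ t ∈ Finset.range S,
              (c * Z t ω * ξ t ω - σ ^ 2 / 2 * (c * Z t ω) ^ 2)))
            + ENNReal.ofReal (Real.exp (∑ t ∈ Finset.range S, 1 / (T : ℝ) * (Z t ω / L) ^ 2)))
              * ENNReal.ofReal (1 / 2) ∂μ := by
          refine lintegral_mono fun ω => ?_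
          rw [← ENNReal.ofReal_add (Real.exp_pos _).le (Real.exp_pos _).le,
            ← ENNReal.ofReal_mul (by positivity)]
          refine ENNReal.ofReal_le_ofReal ?_
          set a := ∑ t ∈ Finset.range S, (c * Z t ω * ξ t ω - σ ^ 2 / 2 * (c * Z t ω) ^ 2) with ha
          set b := ∑ t ∈ Finset.range S, 1 / (T : ℝ) * (Z t ω / L) ^ 2 with hb
          have hb' : ∑ t ∈ Finset.range S, σ ^ 2 / 2 * (c * Z t ω) ^ 2 = b / 2 := by
            rw [hb, Finset.sum_div]
            refine Finset.sum_congr rfl fun t _ => ?_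
            rw [mul_pow, ← mul_assoc, hc2]
            field_simp
          have e : r * ((∑ t ∈ Finset.range S, Z t ω * ξ t ω) / (2 * σ * L * √T))
              = a / 2 + b / 4 := by
            have : a = (∑ t ∈ Finset.range S, c * Z t ω * ξ t ω) - b / 2 := by
              rw [ha, Finset.sum_sub_distrib, hb']
            rw [this]
            simp_rw [mul_assoc c]
            rw [← Finset.mul_sum, hc]
            field_simp
            ring
          have hb0 : 0 ≤ b := Finset.sum_nonneg fun t _ => by positivity
          rw [e]
          -- the arithmetic mean of `exp a` and `exp b` bounds their geometric mean
          have h2 : Real.exp (a / 2 + b / 4) ≤ Real.exp (a / 2) * Real.exp (b / 2) := by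
            rw [← Real.exp_add]; exact Real.exp_le_exp.2 (by linarith)
          have hexp : ∀ y : ℝ, Real.exp y = Real.exp (y / 2) ^ 2 := fun y => by
            rw [← Real.exp_nat_mul]; congr 1; push_cast; ring
          have h3 := hexp a
          have h4 := hexp b
          rw [h3, h4]
          nlinarith [sq_nonneg (Real.exp (a / 2) - Real.exp (b / 2))]
      _ ≤ (1 + 2) * ENNReal.ofReal (1 / 2) := by
          rw [lintegral_mul_const' _ _ ENNReal.ofReal_ne_top,
            lintegral_add_right _ hq.1.exp.ennreal_ofReal]
          gcongr
          exact hq.2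
      _ ≤ 2 := by
          have : (1 + 2 : ℝ≥0∞) = ENNReal.ofReal 3 := by norm_num
          rw [this, ← ENNReal.ofReal_mul (by norm_num)]
          have : (2 : ℝ≥0∞) = ENNReal.ofReal 2 := by norm_num
          rw [this]
          exact ENNReal.ofReal_le_ofReal (by norm_num)
  have hmain := lintegral_exp_abs_le (μ := μ) (hm.div_const (2 * σ * L * √T))
  have h1 := half 1 (by norm_num)
  have h2 := half (-1) (by norm_num)
  simp only [one_mul, neg_mul] at h1 h2
  have h3 := expBound_div (μ := μ) (k := 2) two_pos (hm.div_const (2 * σ * L * √T)).abs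
    (hmain.trans ((add_le_add h1 h2).trans (by norm_num)))
  refine h3.mono (by fun_prop) fun ω => le_of_eq ?_
  rw [sub_zero, abs_div, abs_of_pos (by positivity : 0 < 2 * σ * L * √T)]
  push_cast
  field_simp
  norm_num

/-- The moment generating function of a centred square near zero. -/
theorem lintegral_exp_sq_sub_le {X : Ω → ℝ} {L : ℝ} (hL : 0 < L) (hX : SubG μ L X) {x : ℝ}
    (hx : |x| * L ^ 2 ≤ 1 / 2) :
    ∫⁻ ω, ENNReal.ofReal (Real.exp (x * (X ω ^ 2 - ∫ ω', X ω' ^ 2 ∂μ))) ∂μ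
      ≤ ENNReal.ofReal (Real.exp (48 * L ^ 4 * x ^ 2)) := by
  set v := ∫ ω', X ω' ^ 2 ∂μ with hv
  have hv0 : 0 ≤ v := integral_nonneg fun ω => sq_nonneg _
  have hvL : v ≤ L ^ 2 := hX.integral_sq_le hL
  have hi := hX.integrable_sq hL
  have hie := hX.2.integrable_exp
  have hXm := hX.1
  have key : ∀ ω, Real.exp (x * (X ω ^ 2 - v)) ≤ 1 + x * (X ω ^ 2 - v)
      + 8 * Real.exp 1 * L ^ 4 * x ^ 2 * Real.exp ((X ω / L) ^ 2) := by
    intro ω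
    set w := x * (X ω ^ 2 - v) with hw
    set u := (X ω / L) ^ 2 + 1 with hu
    have hu0 : 0 ≤ u := by positivity
    have h1 : |Real.exp w - (1 + w)| ≤ |w| ^ 2 * Real.exp |w| := by
      have h := Complex.norm_exp_sub_sum_le_norm_mul_exp (w : ℂ) 2
      simp only [Finset.sum_range_succ, Finset.sum_range_zero, zero_add, pow_zero, Nat.factorial,
        pow_one, Nat.cast_one, div_one, Complex.norm_real, Real.norm_eq_abs, mul_one] at h
      rw [← Complex.ofReal_exp, ← Complex.ofReal_one, ← Complex.ofReal_add, ← Complex.ofReal_sub,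
        Complex.norm_real, Real.norm_eq_abs] at h
      exact h
    have h2 : |X ω ^ 2 - v| ≤ L ^ 2 * u := by
      have : L ^ 2 * u = X ω ^ 2 + L ^ 2 := by rw [hu]; field_simp
      rw [this, abs_le]
      constructor <;> nlinarith [sq_nonneg (X ω)]
    have h3 : |w| ≤ |x| * L ^ 2 * u := by
      rw [hw, abs_mul, mul_assoc]; gcongr
    have h4 : |w| ≤ u / 2 := h3.trans (by nlinarith)
    have h5 : u ^ 2 ≤ 8 * Real.exp (u / 2) := by
      have := Real.quadratic_le_exp_of_nonneg (x := u / 2) (by positivity)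
      nlinarith
    have h6 : |w| ^ 2 * Real.exp |w| ≤ (|x| * L ^ 2 * u) ^ 2 * Real.exp (u / 2) := by gcongr
    have h7 : (|x| * L ^ 2 * u) ^ 2 * Real.exp (u / 2)
        = x ^ 2 * L ^ 4 * (u ^ 2 * Real.exp (u / 2)) := by
      rw [mul_pow, mul_pow, sq_abs]; ring
    have h8 : u ^ 2 * Real.exp (u / 2) ≤ 8 * (Real.exp 1 * Real.exp ((X ω / L) ^ 2)) := by
      have : Real.exp 1 * Real.exp ((X ω / L) ^ 2) = Real.exp (u / 2) * Real.exp (u / 2) := by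
        rw [← Real.exp_add, ← Real.exp_add]; congr 1; rw [hu]; ring
      rw [this]
      nlinarith [Real.exp_pos (u / 2)]
    have h9 : x ^ 2 * L ^ 4 * (u ^ 2 * Real.exp (u / 2))
        ≤ x ^ 2 * L ^ 4 * (8 * (Real.exp 1 * Real.exp ((X ω / L) ^ 2))) := by gcongr
    have := (abs_le.1 h1).2
    nlinarith
  have hI : Integrable (fun ω => 1 + x * (X ω ^ 2 - v)
      + 8 * Real.exp 1 * L ^ 4 * x ^ 2 * Real.exp ((X ω / L) ^ 2)) μ :=
    ((integrable_const _).add ((hi.sub (integrable_const _)).const_mul x)).add (hie.const_mul _)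
  calc _ ≤ ∫⁻ ω, ENNReal.ofReal (1 + x * (X ω ^ 2 - v)
      + 8 * Real.exp 1 * L ^ 4 * x ^ 2 * Real.exp ((X ω / L) ^ 2)) ∂μ :=
        lintegral_mono fun ω => ENNReal.ofReal_le_ofReal (key ω)
    _ = ENNReal.ofReal (∫ ω, (1 + x * (X ω ^ 2 - v)
      + 8 * Real.exp 1 * L ^ 4 * x ^ 2 * Real.exp ((X ω / L) ^ 2)) ∂μ) := by
        rw [ofReal_integral_eq_lintegral_ofReal hI
          (ae_of_all _ fun ω => (Real.exp_pos _).le.trans (key ω))]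
    _ ≤ _ := by
        refine ENNReal.ofReal_le_ofReal ?_
        have hI₁ : Integrable (fun ω => x * (X ω ^ 2 - v)) μ :=
          (hi.sub (integrable_const _)).const_mul x
        rw [integral_add (f := fun ω => 1 + x * (X ω ^ 2 - v))
          (g := fun ω => 8 * Real.exp 1 * L ^ 4 * x ^ 2 * Real.exp ((X ω / L) ^ 2))
          ((integrable_const _).add hI₁) (hie.const_mul _),
          integral_add (f := fun _ => (1 : ℝ)) (g := fun ω => x * (X ω ^ 2 - v))
            (integrable_const _) hI₁, integral_const_mul, integral_const_mul,
          integral_sub hi (integrable_const _)]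
        have h10 := hX.2.integral_exp_le
        have h11 := Real.exp_one_lt_d9
        have h12 := Real.add_one_le_exp (48 * L ^ 4 * x ^ 2)
        have h13 : 8 * Real.exp 1 * L ^ 4 * x ^ 2 * ∫ ω, Real.exp ((X ω / L) ^ 2) ∂μ
            ≤ 8 * 3 * L ^ 4 * x ^ 2 * 2 := by
          gcongr
          linarith
        simp only [integral_const, probReal_univ, smul_eq_mul, one_mul, ← hv, sub_self, mul_zero,
          add_zero]
        nlinarith

/-- Sums of squares of independent sub-Gaussian variables over at most `T` times are
sub-exponential with scale of the order `√T`. -/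
theorem subExp_sum_sq {ℱ : ℕ → MeasurableSpace Ω} (hℱ : ∀ t, ℱ t ≤ mΩ)
    {X : ℕ → Ω → ℝ} (hind : ∀ t, Indep (MeasurableSpace.comap (X t) inferInstance) (ℱ t) μ)
    (hXℱ : ∀ r t, r < t → Measurable[ℱ t] (X r)) {L : ℝ} (hL : 0 < L)
    (hX : ∀ t, SubG μ L (X t)) {S T : ℕ} (hST : S ≤ T) (hT : 0 < T) :
    SubExp μ (20 * L ^ 2 * √T) (fun ω => ∑ t ∈ Finset.range S, X t ω ^ 2) := by
  have hT' : (0 : ℝ) < T := by exact_mod_cast hT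
  have hsT : 0 < √(T : ℝ) := Real.sqrt_pos.2 hT'
  have hsT1 : 1 ≤ √(T : ℝ) := Real.one_le_sqrt.2 (by exact_mod_cast hT)
  have hm : Measurable fun ω => ∑ t ∈ Finset.range S, X t ω ^ 2 :=
    Finset.measurable_sum _ fun t _ => (hX t).1.pow_const 2
  set v : ℕ → ℝ := fun t => ∫ ω', X t ω' ^ 2 ∂μ with hv
  refine ⟨hm, ∑ t ∈ Finset.range S, v t, ?_⟩
  set f : Ω → ℝ := fun ω => ∑ t ∈ Finset.range S, (X t ω ^ 2 - v t) with hf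
  have hfm : Measurable f := Finset.measurable_sum _ fun t _ => ((hX t).1.pow_const 2).sub_const _
  have half : ∀ r : ℝ, r ^ 2 = 1 → ∫⁻ ω, ENNReal.ofReal (Real.exp
      (r * (f ω / (10 * L ^ 2 * √T)))) ∂μ ≤ 2 := by
    intro r hr
    set c : ℝ := r / (10 * L ^ 2 * √T) with hc
    have hr1 : |r| = 1 := by rwa [← pow_eq_one_iff_of_nonneg (abs_nonneg r) two_ne_zero, sq_abs]
    have hcL : |c| * L ^ 2 ≤ 1 / 2 := by
      rw [hc, abs_div, hr1, abs_of_pos (by positivity), div_mul_eq_mul_div,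
        div_le_iff₀ (by positivity)]
      nlinarith [sq_pos_of_pos hL]
    have hc2 : 48 * L ^ 4 * c ^ 2 * S ≤ 48 / 100 := by
      have hsq : √(T:ℝ) ^ 2 = T := Real.sq_sqrt hT'.le
      have : 48 * L ^ 4 * c ^ 2 = 48 / 100 / T := by
        rw [hc, div_pow, hr, mul_pow, mul_pow, hsq]; field_simp; norm_num
      rw [this, div_mul_eq_mul_div, div_le_iff₀ hT']
      have : (S : ℝ) ≤ T := by exact_mod_cast hST
      nlinarith
    have h1 := lintegral_exp_sum_le_one (μ := μ) hℱ (ξ := fun t ω => X t ω ^ 2 - v t)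
      (Z := fun _ _ => c) (fun t => ((hX t).1.pow_const 2).sub_const _)
      (fun t => indep_of_indep_of_le_left (hind t) (by
        have : Measurable[MeasurableSpace.comap (X t) inferInstance] (X t) :=
          comap_measurable _
        exact Measurable.comap_le ((this.pow_const 2).sub_const _)))
      (fun r t h => ((hXℱ r t h).pow_const 2).sub_const _)
      (fun _ _ _ => measurable_const) (s := 48 * L ^ 4)
      (fun t ω => lintegral_exp_sq_sub_le hL (hX t) hcL) S
    have e : ∀ ω, Real.exp (r * (f ω / (10 * L ^ 2 * √T)))
        = Real.exp (48 * L ^ 4 * c ^ 2 * S) * Real.exp (∑ t ∈ Finset.range S,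
          (c * (X t ω ^ 2 - v t) - 48 * L ^ 4 * c ^ 2)) := by
      intro ω
      rw [← Real.exp_add, Finset.sum_sub_distrib, ← Finset.mul_sum]
      congr 1
      simp only [Finset.sum_const, Finset.card_range, nsmul_eq_mul, hc, hf]
      ring
    simp_rw [e, ENNReal.ofReal_mul (Real.exp_pos _).le]
    rw [lintegral_const_mul' _ _ ENNReal.ofReal_ne_top]
    calc _ ≤ ENNReal.ofReal (Real.exp (48 * L ^ 4 * c ^ 2 * S)) * 1 := by gcongr
      _ ≤ 2 := by
        have : (2 : ℝ≥0∞) = ENNReal.ofReal 2 := by norm_num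
        rw [mul_one, this]
        refine ENNReal.ofReal_le_ofReal ?_
        rw [← Real.le_log_iff_exp_le two_pos]
        linarith [Real.log_two_gt_d9]
  have hmain := lintegral_exp_abs_le (μ := μ) (hfm.div_const (10 * L ^ 2 * √T))
  have h1 := half 1 (by norm_num)
  have h2 := half (-1) (by norm_num)
  simp only [one_mul, neg_mul] at h1 h2
  have h3 := expBound_div (μ := μ) (k := 2) two_pos (hfm.div_const (10 * L ^ 2 * √T)).abs
    (hmain.trans ((add_le_add h1 h2).trans (by norm_num)))
  refine h3.mono (by fun_prop) fun ω => le_of_eq ?_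
  rw [abs_div, abs_of_pos (by positivity : 0 < 10 * L ^ 2 * √T), ← Finset.sum_sub_distrib,
    div_div]
  congr 1
  push_cast
  ring

theorem lintegral_exp_le_of_hasSubgaussianMGF {Ω : Type*} [MeasurableSpace Ω]
    {μ : Measure Ω} {X : Ω → ℝ} {c : ℝ≥0} (h : HasSubgaussianMGF X c μ)
    (x : ℝ) : ∫⁻ ω, ENNReal.ofReal (Real.exp (x * X ω)) ∂μ
      ≤ ENNReal.ofReal (Real.exp (c / 2 * x ^ 2)) := by
  rw [← ofReal_integral_eq_lintegral_ofReal (h.integrable_exp_mul x)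
    (ae_of_all _ fun ω => (Real.exp_pos _).le)]
  refine ENNReal.ofReal_le_ofReal ((h.mgf_le x).trans (le_of_eq ?_))
  congr 1
  ring

theorem subG_of_hasSubgaussianMGF {X : Ω → ℝ} {σ : ℝ≥0} (hσ : 0 < σ)
    (h : HasSubgaussianMGF X (σ ^ 2) μ) (hX : Measurable X) : SubG μ (4 * σ) X := by
  have hσ' : (0 : ℝ) < σ := by exact_mod_cast hσ
  have := subG_of_tail (μ := μ) (K := 2 * σ) (by positivity) hX (fun s hs => ?_)
  · convert this using 1; ring
  · have h1 := h.measure_ge_le hs.le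
    have h2 := h.neg.measure_ge_le hs.le
    have h3 : {ω | s ≤ |X ω|} ⊆ {ω | s ≤ X ω} ∪ {ω | s ≤ (-X) ω} := by
      intro ω hω
      simp only [Set.mem_ofPred_eq, Set.mem_union, Pi.neg_apply] at hω ⊢
      exact le_abs.1 hω
    have h4 : Real.exp (-s ^ 2 / (2 * (σ ^ 2 : ℝ≥0))) ≤ Real.exp (-s ^ 2 / (2 * σ) ^ 2) := by
      refine Real.exp_le_exp.2 ?_
      push_cast
      rw [neg_div, neg_div, neg_le_neg_iff]
      gcongr
      nlinarith
    have h5 := (measureReal_mono (μ := μ) h3).trans (measureReal_union_le _ _)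
    linarith

end Martingale

/-! ### Quadratic forms of convexly concentrated vectors -/

section Concentration

variable {Ω : Type*} [mΩ : MeasurableSpace Ω] {μ : Measure Ω} [IsProbabilityMeasure μ]
  {ι κ : Type*} [Fintype ι] [Fintype κ]

/-- The coordinates of a centred convexly concentrated vector are sub-Gaussian. -/
theorem ConvexConcentration.subG_coord {K : ℝ} (hK : 0 < K) {V : Ω → EuclideanSpace ℝ ι}
    (hV : ConvexConcentration K V μ) (i : ι) (hm : Measurable fun ω => V ω i)
    (h0 : ∫ ω, V ω i ∂μ = 0) : SubG μ (2 * K) (fun ω => V ω i) := by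
  refine subG_of_tail hK hm fun s hs => ?_
  have h := (hV (fun v => v i) ?_ ?_).2 s hs
  · simpa [h0] using h
  · refine LipschitzWith.of_dist_le_mul fun v w => ?_
    rw [NNReal.coe_one, one_mul, dist_eq_norm, dist_eq_norm]
    simpa using PiLp.norm_apply_le (v - w) i
  · exact ⟨convex_univ, fun v _ w _ a b _ _ _ => le_of_eq (by simp)⟩

/-- The squared norm of a linear image with at most `T` sub-Gaussian coordinates of a convexly
concentrated vector is sub-exponential with scale of the order `√T`: the norm itself is a convex
Lipschitz function, and its mean has at most the order `√T`. -/
theorem ConvexConcentration.subExp_norm_sq {K : ℝ} (hK : 0 < K) {V : Ω → EuclideanSpace ℝ ι}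
    (hV : ConvexConcentration K V μ) (hVm : Measurable V)
    (f : EuclideanSpace ℝ ι →ₗ[ℝ] EuclideanSpace ℝ κ) (hf : ∀ v, ‖f v‖ ≤ 2 * ‖v‖)
    (hc : ∀ k, SubG μ (4 * K) (fun ω => f (V ω) k)) {T : ℕ} (hT : 0 < T)
    (hκ : Fintype.card κ ≤ T) :
    SubExp μ (64 * K ^ 2 * √T) (fun ω => ‖f (V ω)‖ ^ 2) := by
  have hT' : (0 : ℝ) < T := by exact_mod_cast hT
  have hsT : 0 < √(T : ℝ) := Real.sqrt_pos.2 hT'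
  have hsT1 : 1 ≤ √(T : ℝ) := Real.one_le_sqrt.2 (by exact_mod_cast hT)
  have hfc : Continuous f := f.continuous_of_finiteDimensional
  set F : Ω → ℝ := fun ω => ‖f (V ω)‖ with hF
  have hFm : Measurable F := (hfc.measurable.comp hVm).norm
  have hF0 : ∀ ω, 0 ≤ F ω := fun ω => norm_nonneg _
  set R : ℝ := 4 * K with hR
  have hR0 : 0 < R := by positivity
  have hFG : SubG μ (R * √T) F := by
    refine ⟨hFm, ExpBound.convex Finset.univ (w := fun _ : κ => 1 / (T : ℝ))
      (fun _ _ => by positivity) ?_ (fun k _ => (hc k).2) (by fun_prop) fun ω => le_of_eq ?_⟩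
    · rw [Finset.sum_const, nsmul_eq_mul, mul_one_div, div_le_one hT']
      exact_mod_cast hκ
    · simp only [hF]
      rw [div_pow, EuclideanSpace.norm_sq_eq, mul_pow, Real.sq_sqrt hT'.le, Finset.sum_div]
      refine Finset.sum_congr rfl fun k _ => ?_
      rw [Real.norm_eq_abs, sq_abs]
      field_simp
  set m := ∫ ω, F ω ∂μ with hm
  have hm0 : 0 ≤ m := integral_nonneg hF0
  have hFi : Integrable F μ := (hFG.memLp_two (by positivity)).integrable (by norm_num)
  have hmT : m ≤ R * √T := by
    have h1 : ∀ ω, F ω / (R * √T) ≤ (1 + (F ω / (R * √T)) ^ 2) / 2 := fun ω => by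
      nlinarith [sq_nonneg (F ω / (R * √T) - 1)]
    have hi2 := hFG.2.integrable fun ω => sq_nonneg _
    have h2 := integral_mono (hFi.div_const (R * √T))
      (((integrable_const (1:ℝ)).add hi2).div_const 2) h1
    have h3 := hFG.2.integral_le fun ω => sq_nonneg _
    simp only [Pi.add_apply] at h2
    rw [integral_div, integral_div, integral_add (integrable_const _) hi2] at h2
    simp only [integral_const, probReal_univ, smul_eq_mul, one_mul] at h2
    rw [← div_le_one (by positivity)]
    linarith
  have hD : SubG μ R (fun ω => F ω - m) := by
    have h1 := hV (fun v => ‖f v‖ / 2) ?_ ?_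
    · have := subG_of_tail (μ := μ) (K := 2 * K) (by positivity) (hFm.sub_const m) fun s hs => ?_
      · convert this using 1; rw [hR]; ring
      · have h2 := h1.2 (s / 2) (by positivity)
        rw [integral_div] at h2
        have e1 : {ω | s ≤ |F ω - m|} ⊆ {ω | s / 2 ≤ |‖f (V ω)‖ / 2 - m / 2|} := by
          intro ω hω
          simp only [Set.mem_ofPred_eq] at hω ⊢
          rw [← sub_div, abs_div, abs_of_pos (two_pos : (0:ℝ) < 2)]
          exact div_le_div_of_nonneg_right hω two_pos.le
        refine (measureReal_mono e1).trans (h2.trans (le_of_eq ?_))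
        congr 2
        field_simp
    · refine LipschitzWith.of_dist_le_mul fun v w => ?_
      rw [NNReal.coe_one, one_mul, dist_eq_norm, dist_eq_norm, Real.norm_eq_abs, ← sub_div, abs_div,
        abs_of_pos (two_pos : (0:ℝ) < 2), div_le_iff₀ two_pos]
      have h1 := abs_norm_sub_norm_le (f v) (f w)
      have h2 := hf (v - w)
      rw [map_sub] at h2
      linarith
    · have h1 : ConvexOn ℝ Set.univ fun v => ‖f v‖ :=
        (convexOn_univ_norm (E := EuclideanSpace ℝ κ)).comp_linearMap f
      have := h1.smul (c := (1/2 : ℝ)) (by norm_num)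
      refine this.congr fun v _ => ?_
      simp only [smul_eq_mul]; ring
  refine ⟨hFm.pow_const 2, m ^ 2, ?_⟩
  have hFm' : Measurable fun ω => |F ω ^ 2 - m ^ 2| / (2 * R ^ 2 * √T) := by fun_prop
  have h3 := expBound_div (μ := μ) (k := 2) two_pos hFm' ?_
  · refine h3.mono (by fun_prop) fun ω => le_of_eq ?_
    rw [hR, div_div]
    congr 1
    push_cast
    ring
  · have key : ∀ ω, |F ω ^ 2 - m ^ 2| / (2 * R ^ 2 * √T) ≤ 1 / 2 + ((F ω - m) / R) ^ 2 := by
      intro ω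
      rw [div_le_iff₀ (by positivity)]
      have e : (1 / 2 + ((F ω - m) / R) ^ 2) * (2 * R ^ 2 * √T)
          = √T * (R ^ 2 + 2 * (F ω - m) ^ 2) := by field_simp
      rw [e, show F ω ^ 2 - m ^ 2 = (F ω - m) * (F ω + m) by ring, abs_mul,
        abs_of_nonneg (add_nonneg (hF0 ω) hm0)]
      set d := F ω - m with hd
      have h4 : F ω + m ≤ |d| + 2 * (R * √T) := by
        have := le_abs_self d
        rw [hd] at this ⊢
        linarith
      have h5 : |d| * (F ω + m) ≤ |d| * (|d| + 2 * (R * √T)) := by gcongr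
      have h6 : |d| ^ 2 = d ^ 2 := sq_abs d
      have h7 : 0 ≤ √T * (|d| - R) ^ 2 := by positivity
      have h8 : d ^ 2 ≤ √T * d ^ 2 := le_mul_of_one_le_left (sq_nonneg _) hsT1
      nlinarith
    calc _ ≤ ∫⁻ ω, ENNReal.ofReal (Real.exp (1 / 2))
            * ENNReal.ofReal (Real.exp (((F ω - m) / R) ^ 2)) ∂μ := by
          refine lintegral_mono fun ω => ?_
          rw [← ENNReal.ofReal_mul (Real.exp_pos _).le, ← Real.exp_add]
          exact ENNReal.ofReal_le_ofReal (Real.exp_le_exp.2 (key ω))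
      _ ≤ ENNReal.ofReal 2 * 2 := by
          rw [lintegral_const_mul' _ _ ENNReal.ofReal_ne_top]
          gcongr
          · rw [← Real.le_log_iff_exp_le two_pos]
            linarith [Real.log_two_gt_d9]
          · exact hD.2.2
      _ ≤ 2 ^ 2 := by norm_num

/-- Sums of products of pairs of coordinates of a convexly concentrated vector, by polarization. -/
theorem ConvexConcentration.subExp_sum_mul {K : ℝ} (hK : 0 < K) {V : Ω → EuclideanSpace ℝ ι}
    (hV : ConvexConcentration K V μ) (hVm : Measurable V) (h0 : ∀ i, ∫ ω, V ω i ∂μ = 0)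
    {p p' : κ → ι} (hp : p.Injective) (hp' : p'.Injective) {T : ℕ} (hT : 0 < T)
    (hκ : Fintype.card κ ≤ T) :
    SubExp μ (32 * K ^ 2 * √T) (fun ω => ∑ k, V ω (p k) * V ω (p' k)) := by
  have hT' : (0 : ℝ) < T := by exact_mod_cast hT
  have hsT : 0 < √(T : ℝ) := Real.sqrt_pos.2 hT'
  have hVi : ∀ i, Measurable fun ω => V ω i := fun i =>
    (EuclideanSpace.proj (𝕜 := ℝ) i).continuous.measurable.comp hVm
  have hG : ∀ i, SubG μ (2 * K) (fun ω => V ω i) := fun i => hV.subG_coord hK i (hVi i) (h0 i)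
  have hsel : ∀ (r : κ → ι), r.Injective → ∀ v : EuclideanSpace ℝ ι,
      ‖(WithLp.toLp 2 fun k => v (r k) : EuclideanSpace ℝ κ)‖ ≤ ‖v‖ := by
    intro r hr v
    rw [EuclideanSpace.norm_eq, EuclideanSpace.norm_eq]
    refine Real.sqrt_le_sqrt ?_
    have := Finset.sum_le_sum_of_subset_of_nonneg (Finset.subset_univ (Finset.univ.map ⟨r, hr⟩))
      (f := fun i => ‖v i‖ ^ 2) (fun i _ _ => by positivity)
    simpa using this
  have hsq : ∀ s : ℝ, |s| = 1 → SubExp μ (64 * K ^ 2 * √T)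
      (fun ω => ∑ k, (V ω (p k) + s * V ω (p' k)) ^ 2) := by
    intro s hs
    let f : EuclideanSpace ℝ ι →ₗ[ℝ] EuclideanSpace ℝ κ :=
      { toFun := fun v => WithLp.toLp 2 (fun k => v (p k)) + s • WithLp.toLp 2 (fun k => v (p' k))
        map_add' := fun v w => by ext k; simp; ring
        map_smul' := fun c v => by ext k; simp; ring }
    have hfk : ∀ v k, f v k = v (p k) + s * v (p' k) := fun v k => by simp [f]
    have := hV.subExp_norm_sq hK hVm f (fun v => ?_) (fun k => ?_) hT hκ
    · convert this using 2 with ω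
      rw [EuclideanSpace.norm_sq_eq]
      refine Finset.sum_congr rfl fun k _ => ?_
      rw [hfk, Real.norm_eq_abs, sq_abs]
    · refine (norm_add_le _ _).trans ?_
      rw [norm_smul, Real.norm_eq_abs, hs]
      have h1 := hsel p hp v
      have h2 := hsel p' hp' v
      linarith
    · simp_rw [hfk]
      have := (hG (p k)).add ((hG (p' k)).const_mul (by positivity) one_pos hs.le)
        (by positivity) (by positivity)
      convert this using 1
      ring
  have := ((hsq 1 (by simp)).const_mul (a := 1 / 4) (b := 1 / 4) (by positivity) (by norm_num)
    (by norm_num)).add ((hsq (-1) (by simp)).const_mul (a := -(1 / 4)) (b := 1 / 4) (by positivity)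
      (by norm_num) (by norm_num)) (by positivity) (by positivity)
  convert this using 1
  · ring
  · ext ω
    rw [Finset.mul_sum, Finset.mul_sum, ← Finset.sum_add_distrib]
    refine Finset.sum_congr rfl fun k _ => ?_
    ring

end Concentration

end GTNAR

namespace GTNAR

/-! ### Stable autoregressions -/

section Autoregression

variable {Ω : Type*} [mΩ : MeasurableSpace Ω] {μ : Measure Ω} [IsProbabilityMeasure μ]

theorem SubExp.sum_bilinear {J K : Type*} [Fintype J] [Fintype K] {a : ℕ → J → Ω → ℝ}
    {b : ℕ → K → Ω → ℝ} (v : J → ℝ) (w : K → ℝ) {p r h : ℝ} (hp : 0 < p) (hr : 0 < r) (hh : 0 < h)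
    (hv : ∑ j, |v j| ≤ p) (hw : ∑ k, |w k| ≤ r) (S : ℕ)
    (H : ∀ j k, SubExp μ h (fun ω => ∑ t ∈ Finset.range S, a t j ω * b t k ω)) :
    SubExp μ (p * (r * h)) (fun ω => ∑ t ∈ Finset.range S,
      (∑ j, v j * a t j ω) * ∑ k, w k * b t k ω) := by
  have := SubExp.sum Finset.univ v (mul_pos hr hh) hp hv
    (X := fun j ω => ∑ k, w k * ∑ t ∈ Finset.range S, a t j ω * b t k ω)
    (fun j _ => SubExp.sum Finset.univ w hh hr hw (fun k _ => H j k))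
  convert this using 2 with ω
  simp_rw [Finset.sum_mul_sum]
  rw [Finset.sum_comm]
  refine Finset.sum_congr rfl fun j _ => ?_
  rw [Finset.sum_comm, Finset.mul_sum]
  refine Finset.sum_congr rfl fun k _ => ?_
  rw [Finset.mul_sum, Finset.mul_sum]
  refine Finset.sum_congr rfl fun t _ => ?_
  ring

/-- Noise `ε` adapted to the filtration `ℱ`, the values at time `t + 1` being sub-Gaussian and
independent of `ℱ t`. -/
structure Innovations {I : Type*} (μ : Measure Ω) (ℱ : ℕ → MeasurableSpace Ω) (σ : ℝ)
    (ε : ℕ → I → Ω → ℝ) : Prop where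
  le : ∀ t, ℱ t ≤ mΩ
  mono : Monotone ℱ
  adapted : ∀ t i, Measurable[ℱ t] (ε t i)
  indep : ∀ t, Indep (MeasurableSpace.comap (fun ω i => ε (t + 1) i ω) inferInstance) (ℱ t) μ
  mgf : ∀ t i (x : ℝ), ∫⁻ ω, ENNReal.ofReal (Real.exp (x * ε t i ω)) ∂μ
    ≤ ENNReal.ofReal (Real.exp (σ ^ 2 / 2 * x ^ 2))
  subG : ∀ t i, SubG μ (4 * σ) (ε t i)

theorem Innovations.subExp_sum_mul {I : Type*} {ℱ : ℕ → MeasurableSpace Ω} {σ : ℝ}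
    {ε : ℕ → I → Ω → ℝ} (h : Innovations μ ℱ σ ε) (hσ : 0 < σ) {Z : ℕ → Ω → ℝ} {L : ℝ} (hL : 0 < L)
    (hZ : ∀ t, SubG μ L (Z t)) (hZℱ : ∀ t, Measurable[ℱ t] (Z t)) {S T : ℕ} (hST : S ≤ T)
    (hT : 0 < T) (i : I) :
    SubExp μ (4 * σ * L * √T) (fun ω => ∑ t ∈ Finset.range S, Z t ω * ε (t + 1) i ω) :=
  GTNAR.subExp_sum_mul h.le (ξ := fun t => ε (t + 1) i) (fun _ => (h.subG _ i).1)
    (fun t => indep_of_indep_of_le_left (h.indep t)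
      (Measurable.comap_le ((measurable_pi_apply i).comp
        (comap_measurable (m := MeasurableSpace.pi) (fun ω i => ε (t + 1) i ω)))))
    (fun r _ hrt => (h.adapted (r + 1) i).mono (h.mono hrt) le_rfl)
    (fun r _ hrt => (hZℱ r).mono (h.mono hrt) le_rfl) hσ hL (fun _ x => h.mgf _ i x) hZ hST hT

theorem Innovations.subExp_sum_self {I : Type*} {ℱ : ℕ → MeasurableSpace Ω} {σ : ℝ}
    {ε : ℕ → I → Ω → ℝ} (h : Innovations μ ℱ σ ε) (hσ : 0 < σ) {S T : ℕ} (hST : S ≤ T)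
    (hT : 0 < T) (i j : I) :
    SubExp μ (640 * σ ^ 2 * √T)
      (fun ω => ∑ t ∈ Finset.range S, ε (t + 1) i ω * ε (t + 1) j ω) := by
  have hT' : (0 : ℝ) < T := by exact_mod_cast hT
  have hsT : 0 < √(T : ℝ) := Real.sqrt_pos.2 hT'
  have hsq : ∀ s : ℝ, |s| = 1 → SubExp μ (20 * (8 * σ) ^ 2 * √T)
      (fun ω => ∑ t ∈ Finset.range S, (ε (t + 1) i ω + s * ε (t + 1) j ω) ^ 2) := by
    intro s hs
    refine subExp_sum_sq h.le (X := fun t ω => ε (t + 1) i ω + s * ε (t + 1) j ω) (fun t => ?_)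
      (fun r t hrt => ?_) (by positivity) (fun t => ?_) hST hT
    · refine indep_of_indep_of_le_left (h.indep t) (Measurable.comap_le ?_)
      have h1 := comap_measurable (m := MeasurableSpace.pi) (fun ω i => ε (t + 1) i ω)
      exact ((measurable_pi_apply i).comp h1).add (((measurable_pi_apply j).comp h1).const_mul s)
    · have h1 : ∀ i, Measurable[ℱ t] (ε (r + 1) i) :=
        fun i => (h.adapted (r + 1) i).mono (h.mono hrt) le_rfl
      exact (h1 i).add ((h1 j).const_mul s)
    · have := (h.subG (t + 1) i).add ((h.subG (t + 1) j).const_mul (by positivity) one_pos hs.le)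
        (by positivity) (by positivity)
      convert this using 1
      ring
  have := ((hsq 1 (by simp)).const_mul (a := 1 / 4) (b := 1 / 4) (by positivity) (by norm_num)
    (by norm_num)).add ((hsq (-1) (by simp)).const_mul (a := -(1 / 4)) (b := 1 / 4) (by positivity)
      (by norm_num) (by norm_num)) (by positivity) (by positivity)
  convert this using 1
  · ring
  · ext ω
    rw [Finset.mul_sum, Finset.mul_sum, ← Finset.sum_add_distrib]
    refine Finset.sum_congr rfl fun k _ => ?_
    ring

variable {I E : Type*} [Fintype I] [Fintype E]

/-- The autoregression `Y (t + 1) = Φ Y t + P e (t + 1)` started at zero, with absolute row sums of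
`Φ` and `P` at most `κ` and `b`. -/
structure IsAutoregression (Φ : I → I → ℝ) (P : I → E → ℝ) (κ b : ℝ) (e : ℕ → E → Ω → ℝ)
    (Y : ℕ → I → Ω → ℝ) : Prop where
  zero : ∀ i ω, Y 0 i ω = 0
  succ : ∀ t i ω, Y (t + 1) i ω = ∑ j, Φ i j * Y t j ω + ∑ c, P i c * e (t + 1) c ω
  sum_le : ∀ i, ∑ j, |Φ i j| ≤ κ
  sum_input_le : ∀ i, ∑ c, |P i c| ≤ b
  κ_pos : 0 < κ
  κ_lt : κ < 1
  b_pos : 0 < b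

namespace IsAutoregression

variable {Φ : I → I → ℝ} {P : I → E → ℝ} {κ b : ℝ} {e : ℕ → E → Ω → ℝ} {Y : ℕ → I → Ω → ℝ}

theorem subG (h : IsAutoregression Φ P κ b e Y) {R : ℝ} (hR : 0 < R)
    (he : ∀ t c, SubG μ R (e t c)) (t : ℕ) (i : I) : SubG μ (b * R / (1 - κ)) (Y t i) := by
  have hκ := h.κ_lt
  have hκ0 := h.κ_pos
  have hb := h.b_pos
  have h1κ : 0 < 1 - κ := by linarith
  induction t generalizing i with
  | zero =>
    have : Y 0 i = fun _ => 0 := funext (h.zero i)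
    rw [this]; exact SubG.zero _
  | succ t ih =>
    have h1 := (SubG.sum Finset.univ (Φ i) (by positivity) hκ0 (h.sum_le i) (fun j _ => ih j)).add
      (SubG.sum Finset.univ (P i) hR hb (h.sum_input_le i) (fun c _ => he (t + 1) c))
      (by positivity) (by positivity)
    have e1 : κ * (b * R / (1 - κ)) + b * R = b * R / (1 - κ) := by field_simp; ring
    rw [e1] at h1
    have : Y (t + 1) i = fun ω => ∑ j, Φ i j * Y t j ω + ∑ c, P i c * e (t + 1) c ω :=
      funext (h.succ t i)
    rwa [this]

/-- Cross moments of the autoregression with a series `w` at positive lags, from those of its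
inputs. By the recursion the cross moment at lag `d` is, up to moments of inputs, a combination with
coefficients of total size at most `κ` of cross moments at lag `d + 1` over one time less. -/
theorem subExp_cross (h : IsAutoregression Φ P κ b e Y) {w : ℕ → Ω → ℝ} {H : ℝ} (hH : 0 < H) {T : ℕ}
    (hew : ∀ S d c, 1 ≤ d → S + d ≤ T →
      SubExp μ H (fun ω => ∑ t ∈ Finset.range S, e (t + 1) c ω * w (t + 1 + d) ω))
    (S d : ℕ) (hd : 1 ≤ d) (hS : S + d ≤ T + 1) (i : I) :
    SubExp μ (b * H / (1 - κ)) (fun ω => ∑ t ∈ Finset.range S, Y t i ω * w (t + d) ω) := by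
  have hκ := h.κ_lt
  have hκ0 := h.κ_pos
  have hb := h.b_pos
  have h1κ : 0 < 1 - κ := by linarith
  induction S generalizing d i with
  | zero => simpa using SubExp.zero _
  | succ S ih =>
    have h1 := (SubExp.sum Finset.univ (Φ i) (by positivity) hκ0 (h.sum_le i)
        (fun j _ => ih (d + 1) (by omega) (by omega) j)).add
      (SubExp.sum Finset.univ (P i) hH hb (h.sum_input_le i)
        (fun c _ => hew S d c hd (by omega))) (by positivity) (by positivity)
    have e1 : κ * (b * H / (1 - κ)) + b * H = b * H / (1 - κ) := by field_simp; ring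
    rw [e1] at h1
    convert h1 using 2 with ω
    rw [Finset.sum_range_succ', h.zero, zero_mul, add_zero]
    simp_rw [Finset.mul_sum]
    rw [Finset.sum_comm, Finset.sum_comm (s := Finset.univ (α := E)), ← Finset.sum_add_distrib]
    refine Finset.sum_congr rfl fun t _ => ?_
    rw [h.succ, add_mul, Finset.sum_mul, Finset.sum_mul]
    congr 1
    · refine Finset.sum_congr rfl fun j _ => ?_
      rw [show t + 1 + d = t + (d + 1) by ring]; ring
    · refine Finset.sum_congr rfl fun j _ => ?_
      ring

/-- Second moments of the autoregression, from those of its inputs and the cross moments of the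
autoregression with the next input. -/
theorem subExp_auto (h : IsAutoregression Φ P κ b e Y) {H : ℝ} (hH : 0 < H) {T : ℕ}
    (hYe : ∀ S i c, S ≤ T →
      SubExp μ H (fun ω => ∑ t ∈ Finset.range S, Y t i ω * e (t + 1) c ω))
    (hee : ∀ S c c', S ≤ T →
      SubExp μ H (fun ω => ∑ t ∈ Finset.range S, e (t + 1) c ω * e (t + 1) c' ω))
    (S : ℕ) (hS : S ≤ T) (i j : I) :
    SubExp μ ((2 * b + b ^ 2) * H / (1 - κ))
      (fun ω => ∑ t ∈ Finset.range S, Y t i ω * Y t j ω) := by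
  have hκ := h.κ_lt
  have hκ0 := h.κ_pos
  have hb := h.b_pos
  have h1κ : 0 < 1 - κ := by linarith
  induction S generalizing i j with
  | zero => simpa using SubExp.zero _
  | succ S ih =>
    have hS' : S ≤ T := by omega
    have h1 := SubExp.sum_bilinear (a := Y) (b := Y) (Φ i) (Φ j) hκ0 hκ0 (by positivity)
      (h.sum_le i) (h.sum_le j) S (ih hS')
    have h2 := SubExp.sum_bilinear (a := Y) (b := fun t => e (t + 1)) (Φ i) (P j) hκ0 hb hH
      (h.sum_le i) (h.sum_input_le j) S (fun i c => hYe S i c hS')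
    have h3 := SubExp.sum_bilinear (a := Y) (b := fun t => e (t + 1)) (Φ j) (P i) hκ0 hb hH
      (h.sum_le j) (h.sum_input_le i) S (fun i c => hYe S i c hS')
    have h4 := SubExp.sum_bilinear (a := fun t => e (t + 1)) (b := fun t => e (t + 1)) (P i) (P j)
      hb hb hH (h.sum_input_le i) (h.sum_input_le j) S (fun i c => hee S i c hS')
    have h5 := ((h1.add h2 (by positivity) (by positivity)).add h3 (by positivity)
      (by positivity)).add h4 (by positivity) (by positivity)
    have h6 := h5.mono (L' := (2 * b + b ^ 2) * H / (1 - κ)) (by positivity) (by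
      set L := (2 * b + b ^ 2) * H / (1 - κ) with hL
      have hL0 : 0 < L := by positivity
      have e1 : (2 * b + b ^ 2) * H = L * (1 - κ) := by rw [hL]; field_simp
      have h7 : κ * (κ * L) ≤ κ * L := mul_le_of_le_one_left (by positivity) hκ.le
      have h8 : κ * (b * H) ≤ b * H := mul_le_of_le_one_left (by positivity) hκ.le
      nlinarith)
    convert h6 using 2 with ω
    rw [Finset.sum_range_succ', h.zero, zero_mul, add_zero, ← Finset.sum_add_distrib,
      ← Finset.sum_add_distrib, ← Finset.sum_add_distrib]
    refine Finset.sum_congr rfl fun t _ => ?_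
    rw [h.succ, h.succ]
    ring

end IsAutoregression

end Autoregression

end GTNAR

namespace GTNAR

/-! ### The regression as a linear function of the regressors -/

theorem sum_abs_rowNormalize_le {N : ℕ} (A : Matrix (Fin N) (Fin N) ℝ)
    (hA : ∀ i j, A i j = 0 ∨ A i j = 1) (i : Fin N) : ∑ k, |rowNormalize A i k| ≤ 1 := by
  have h0 : ∀ k, 0 ≤ A i k := fun k => by rcases hA i k with h | h <;> simp [h]
  have hs : 0 ≤ ∑ k, A i k := Finset.sum_nonneg fun k _ => h0 k
  simp only [rowNormalize]
  rw [Finset.sum_congr rfl fun k _ => abs_of_nonneg (div_nonneg (h0 k) hs), ← Finset.sum_div]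
  exact div_self_le_one _

/-- An independent pair of variables that is jointly independent of a third one. -/
theorem indepFun_prodMk_right {Ω α β γ : Type*} [MeasurableSpace Ω] [MeasurableSpace α]
    [MeasurableSpace β] [MeasurableSpace γ] {μ : Measure Ω} [IsProbabilityMeasure μ] {U : Ω → α}
    {V : Ω → β} {X : Ω → γ} (hU : Measurable U) (hV : Measurable V) (hX : Measurable X)
    (hUV : IndepFun U V μ) (hUVX : IndepFun (fun ω => (U ω, V ω)) X μ) :
    IndepFun U (fun ω => (V ω, X ω)) μ := by
  have hVX : IndepFun V X μ := hUVX.comp measurable_snd measurable_id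
  have : IsProbabilityMeasure (μ.map U) := Measure.isProbabilityMeasure_map hU.aemeasurable
  have : IsProbabilityMeasure (μ.map V) := Measure.isProbabilityMeasure_map hV.aemeasurable
  have : IsProbabilityMeasure (μ.map X) := Measure.isProbabilityMeasure_map hX.aemeasurable
  rw [indepFun_iff_map_prod_eq_prod_map_map hU.aemeasurable (hV.prodMk hX).aemeasurable]
  rw [indepFun_iff_map_prod_eq_prod_map_map (hU.prodMk hV).aemeasurable hX.aemeasurable,
    (indepFun_iff_map_prod_eq_prod_map_map hU.aemeasurable hV.aemeasurable).1 hUV] at hUVX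
  rw [(indepFun_iff_map_prod_eq_prod_map_map hV.aemeasurable hX.aemeasurable).1 hVX,
    ← Measure.prodAssoc_prod, ← hUVX, Measure.map_map MeasurableEquiv.prodAssoc.measurable
      ((hU.prodMk hV).prodMk hX)]
  rfl

namespace Model

universe u

variable {q : ℕ} {G : Fin q → ℕ} (S : Model.{u} G)

/-- The Euclidean space of the coefficient vectors of a tensor entry. -/
abbrev Coef : Type := EuclideanSpace ℝ S.RegIdx

/-- The coefficients of the covariates of network `l`. -/
def covCoef (v : S.Coef) (l : Fin q) : EuclideanSpace ℝ (Fin (S.p l)) :=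
  WithLp.toLp 2 fun k => v (.inl ⟨l, some k⟩)

/-- The linear predictor with coefficients `v` at the tensor entry `i`. -/
noncomputable def linPred (v : S.Coef) (y : S.Node → ℝ)
    (x : ∀ l, Fin (S.N l) → EuclideanSpace ℝ (Fin (S.p l))) (i : S.Node) : ℝ :=
  (∑ l, v (.inl ⟨l, none⟩) * ∑ k, S.W l (i l) k * y (Function.update i l k))
    + v (.inr ()) * y i + ∑ l, inner ℝ (x l (i l)) (S.covCoef v l)

/-- The coefficient vector of the tensor entries in the groups `h`. -/
noncomputable def coef (ξ : Param G S.p) (h : ∀ l, Fin (G l)) : S.Coef :=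
  WithLp.toLp 2 fun a => match a with
    | .inl ⟨l, none⟩ => ξ.lam l (h l)
    | .inl ⟨l, some k⟩ => ξ.zeta l (h l) k
    | .inr () => ξ.alpha h

theorem regression_eq (ξ : Param G S.p) (g : Membership S.N G) (y : S.Node → ℝ)
    (x : ∀ l, Fin (S.N l) → EuclideanSpace ℝ (Fin (S.p l))) (i : S.Node) :
    regression S.W ξ g y x i = S.linPred (S.coef ξ fun l => g l (i l)) y x i := rfl

theorem linPred_add (v w : S.Coef) (y : S.Node → ℝ)
    (x : ∀ l, Fin (S.N l) → EuclideanSpace ℝ (Fin (S.p l))) (i : S.Node) :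
    S.linPred (v + w) y x i = S.linPred v y x i + S.linPred w y x i := by
  have : ∀ l, S.covCoef (v + w) l = S.covCoef v l + S.covCoef w l := fun l => by
    ext k; simp [covCoef]
  simp only [linPred, this, inner_add_right, Finset.sum_add_distrib, PiLp.add_apply, add_mul]
  ring

theorem linPred_smul (c : ℝ) (v : S.Coef) (y : S.Node → ℝ)
    (x : ∀ l, Fin (S.N l) → EuclideanSpace ℝ (Fin (S.p l))) (i : S.Node) :
    S.linPred (c • v) y x i = c * S.linPred v y x i := by
  have : ∀ l, S.covCoef (c • v) l = c • S.covCoef v l := fun l => by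
    ext k; simp [covCoef]
  simp only [linPred, this, inner_smul_right, PiLp.smul_apply, smul_eq_mul, mul_add,
    Finset.mul_sum, mul_assoc]

theorem linPred_eq_sum_regressor (v : S.Coef) (t : ℕ) (i : S.Node) (ω : S.Ω) :
    S.linPred v (fun j => S.Y (t - 1) j ω) (fun l j => S.x l t j ω) i
      = ∑ a, S.regressor t i ω a * v a := by
  rw [Fintype.sum_sum_type, Fintype.sum_sigma]
  simp only [linPred, Fintype.sum_option, regressor, Finset.sum_add_distrib, Finset.univ_unique,
    Finset.sum_singleton, PiLp.inner_apply, covCoef]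
  rw [add_right_comm]
  congr 1
  · congr 1
    · exact Finset.sum_congr rfl fun l _ => mul_comm _ _
    · exact Finset.sum_congr rfl fun l _ => Finset.sum_congr rfl fun k _ => by
        simp [mul_comm]
  · exact mul_comm _ _

/-- The weights of the entries of `y` in a linear predictor. -/
noncomputable def lagWeight (v : S.Coef) (i j : S.Node) : ℝ :=
  (∑ l, v (.inl ⟨l, none⟩) * ∑ k, S.W l (i l) k * if Function.update i l k = j then 1 else 0)
    + v (.inr ()) * if i = j then 1 else 0

theorem sum_lagWeight_mul (v : S.Coef) (i : S.Node) (y : S.Node → ℝ) :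
    ∑ j, S.lagWeight v i j * y j
      = (∑ l, v (.inl ⟨l, none⟩) * ∑ k, S.W l (i l) k * y (Function.update i l k))
        + v (.inr ()) * y i := by
  simp only [lagWeight, add_mul, Finset.sum_add_distrib, Finset.sum_mul]
  congr 1
  · rw [Finset.sum_comm]
    refine Finset.sum_congr rfl fun l _ => ?_
    simp_rw [Finset.mul_sum, Finset.sum_mul]
    rw [Finset.sum_comm]
    refine Finset.sum_congr rfl fun k _ => ?_
    rw [Finset.sum_eq_single (Function.update i l k)]
    · simp; ring
    · intro j _ hj; simp [hj.symm]
    · simp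
  · simp

theorem sum_abs_lagWeight_le (v : S.Coef) (i : S.Node) :
    ∑ j, |S.lagWeight v i j| ≤ (∑ l, |v (.inl ⟨l, none⟩)|) + |v (.inr ())| := by
  calc ∑ j, |S.lagWeight v i j|
      ≤ ∑ j, ((∑ l, |v (.inl ⟨l, none⟩)| * ∑ k, |S.W l (i l) k| *
          if Function.update i l k = j then 1 else 0) + |v (.inr ())| * if i = j then 1 else 0) := by
        refine Finset.sum_le_sum fun j _ => ?_
        refine (abs_add_le _ _).trans (add_le_add ?_ (le_of_eq ?_))
        · refine (Finset.abs_sum_le_sum_abs _ _).trans (Finset.sum_le_sum fun l _ => ?_)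
          rw [abs_mul]
          gcongr
          refine (Finset.abs_sum_le_sum_abs _ _).trans (le_of_eq ?_)
          refine Finset.sum_congr rfl fun k _ => ?_
          rw [abs_mul]; split_ifs <;> simp
        · rw [abs_mul]; split_ifs <;> simp
    _ = (∑ l, |v (.inl ⟨l, none⟩)| * ∑ k, |S.W l (i l) k|) + |v (.inr ())| := by
        rw [Finset.sum_add_distrib]
        congr 1
        · rw [Finset.sum_comm]
          refine Finset.sum_congr rfl fun l _ => ?_
          rw [← Finset.mul_sum, Finset.sum_comm]
          simp
        · simp
    _ ≤ _ := by
        gcongr with l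
        exact mul_le_of_le_one_right (abs_nonneg _)
          (sum_abs_rowNormalize_le _ (S.A_zero_or_one l) _)

/-- The nodes of all networks, which index the covariate vectors of one time. -/
abbrev Atom : Type := (l : Fin q) × Fin (S.N l)

theorem sum_inner_eq (i : S.Node) (f : S.Atom → ℝ) :
    ∑ l, f ⟨l, i l⟩ = ∑ c : S.Atom, (if i c.1 = c.2 then 1 else 0) * f c := by
  rw [Fintype.sum_sigma]
  simp

theorem sum_ite_atom (i : S.Node) :
    ∑ c : S.Atom, (if i c.1 = c.2 then (1 : ℝ) else 0) = q := by
  rw [Fintype.sum_sigma]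
  simp

/-! ### A version of the series as a function of covariates and noise -/

/-- The covariates, put to zero outside the times of observation. -/
noncomputable def xZ (l : Fin q) (t : ℕ) (i : Fin (S.N l)) (ω : S.Ω) :
    EuclideanSpace ℝ (Fin (S.p l)) :=
  if t ∈ Finset.Icc 1 S.T then S.x l t i ω else 0

/-- The noise, put to zero outside the times of observation. -/
noncomputable def εZ (t : ℕ) (i : S.Node) (ω : S.Ω) : ℝ :=
  if t ∈ Finset.Icc 1 S.T then S.ε t i ω else 0

/-- The solution of the autoregression that starts at zero everywhere, not only almost surely. -/
noncomputable def YZ : ℕ → S.Node → S.Ω → ℝ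
  | 0, _, _ => 0
  | t + 1, i, ω => S.linPred (S.coef S.ξ₀ fun l => S.g₀ l (i l)) (fun j => YZ t j ω)
      (fun l j => S.xZ l (t + 1) j ω) i + S.εZ (t + 1) i ω

/-- The scalar products of the covariate vectors with fixed vectors `η`. -/
noncomputable def atomSeries (η : ∀ l, Fin (S.N l) → EuclideanSpace ℝ (Fin (S.p l))) (t : ℕ)
    (c : S.Atom) (ω : S.Ω) : ℝ := inner ℝ (S.xZ c.1 t c.2 ω) (η c.1 c.2)

/-- The linear predictor for time `t + 1`, built from the versions of the series. -/
noncomputable def predZ (v : S.Coef) (t : ℕ) (i : S.Node) (ω : S.Ω) : ℝ :=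
  S.linPred v (fun j => S.YZ t j ω) (fun l j => S.xZ l (t + 1) j ω) i

theorem ae_YZ {κ : ℝ} (hs : S.Stability κ) :
    ∀ᵐ ω ∂S.μ, ∀ t ≤ S.T, ∀ i, S.Y t i ω = S.YZ t i ω := by
  filter_upwards [S.equation, ae_all_iff.2 hs.1] with ω h1 h2 t
  induction t with
  | zero => intro _ i; rw [h2 i]; rfl
  | succ t ih =>
    intro ht i
    have hmem : t + 1 ∈ Finset.Icc 1 S.T := Finset.mem_Icc.2 ⟨by omega, ht⟩
    rw [h1 (t + 1) hmem i]
    have e1 : (fun j => S.Y (t + 1 - 1) j ω) = fun j => S.YZ t j ω :=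
      funext fun j => ih (by omega) j
    have e2 : (fun l j => S.x l (t + 1) j ω) = fun l j => S.xZ l (t + 1) j ω := by
      funext l j; simp only [xZ, if_pos hmem]
    have e3 : S.ε (t + 1) i ω = S.εZ (t + 1) i ω := by simp only [εZ, if_pos hmem]
    rw [e1, e2, e3]
    exact congrArg (· + S.εZ (t + 1) i ω) (S.regression_eq S.ξ₀ S.g₀ _ _ i)

theorem ae_predZ {κ : ℝ} (hs : S.Stability κ) : ∀ᵐ ω ∂S.μ, ∀ t < S.T, ∀ i v,
    S.linPred v (fun j => S.Y (t + 1 - 1) j ω) (fun l j => S.x l (t + 1) j ω) i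
      = S.predZ v t i ω := by
  filter_upwards [S.ae_YZ hs] with ω h t ht i v
  have hmem : t + 1 ∈ Finset.Icc 1 S.T := Finset.mem_Icc.2 ⟨by omega, ht⟩
  have e1 : (fun j => S.Y (t + 1 - 1) j ω) = fun j => S.YZ t j ω :=
    funext fun j => h t ht.le j
  have e2 : (fun l j => S.x l (t + 1) j ω) = fun l j => S.xZ l (t + 1) j ω := by
    funext l j; simp only [xZ, if_pos hmem]
  rw [e1, e2]; rfl

theorem predZ_eq_sum (v : S.Coef) (t : ℕ) (i : S.Node) (ω : S.Ω) :
    S.predZ v t i ω = ∑ j, S.lagWeight v i j * S.YZ t j ω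
      + ∑ c : S.Atom, (if i c.1 = c.2 then 1 else 0)
        * S.atomSeries (fun l _ => S.covCoef v l) (t + 1) c ω := by
  rw [sum_lagWeight_mul, ← S.sum_inner_eq i fun c =>
    S.atomSeries (fun l _ => S.covCoef v l) (t + 1) c ω]
  rfl

theorem measurable_εZ (t : ℕ) (i : S.Node) : Measurable (S.εZ t i) := by
  unfold εZ
  split_ifs
  · exact S.measurable_ε t i
  · exact measurable_const

/-! ### The filtration of covariates and past noise -/

/-- The noise up to time `t` and all covariates. -/
def pastFun (t : ℕ) (ω : S.Ω) : (S.Time × S.Node → ℝ)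
    × (∀ l, S.Time × Fin (S.N l) → EuclideanSpace ℝ (Fin (S.p l))) :=
  (fun a => if a.1.1 ≤ t then S.ε a.1 a.2 ω else 0, fun l a => S.x l a.1 a.2 ω)

/-- The σ-algebra generated by the noise up to time `t` and the covariates of all times. -/
abbrev past (t : ℕ) : MeasurableSpace S.Ω := MeasurableSpace.comap (S.pastFun t) inferInstance

theorem measurable_pastFun (t : ℕ) : Measurable (S.pastFun t) := by
  refine Measurable.prodMk (measurable_pi_iff.2 fun a => ?_)
    (measurable_pi_iff.2 fun l => measurable_pi_iff.2 fun a => S.measurable_x l _ _)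
  split_ifs
  · exact S.measurable_ε _ _
  · exact measurable_const

theorem past_le (t : ℕ) : S.past t ≤ S.mΩ := (S.measurable_pastFun t).comap_le

theorem past_mono : Monotone S.past := by
  intro s t hst
  refine Measurable.comap_le ?_
  have h : Measurable[S.past t] (S.pastFun t) := comap_measurable _
  have e : S.pastFun s = (fun z => (fun a : S.Time × S.Node => if a.1.1 ≤ s then z.1 a else 0, z.2))
      ∘ S.pastFun t := by
    funext ω
    refine Prod.ext (funext fun a => ?_) rfl
    simp only [pastFun, Function.comp]
    by_cases h : a.1.1 ≤ s
    · simp [h, h.trans hst]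
    · simp [h]
  rw [e]
  refine Measurable.comp ?_ h
  refine Measurable.prodMk (measurable_pi_iff.2 fun a => ?_) measurable_snd
  split_ifs
  · exact (measurable_pi_apply a).comp measurable_fst
  · exact measurable_const

theorem measurable_past_xZ (s t : ℕ) (l : Fin q) (i : Fin (S.N l)) :
    Measurable[S.past s] (S.xZ l t i) := by
  unfold xZ
  by_cases h : t ∈ Finset.Icc 1 S.T
  · simp only [h, if_true]
    have h1 : Measurable[S.past s] (S.pastFun s) := comap_measurable _
    exact ((measurable_pi_apply (⟨t, h⟩, i)).comp
      ((measurable_pi_apply l).comp measurable_snd)).comp h1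
  · simp only [h, if_false]
    exact measurable_const

theorem measurable_past_εZ (t : ℕ) (i : S.Node) : Measurable[S.past t] (S.εZ t i) := by
  unfold εZ
  by_cases h : t ∈ Finset.Icc 1 S.T
  · simp only [h, if_true]
    have h1 : Measurable[S.past t] (S.pastFun t) := comap_measurable _
    have h2 := ((measurable_pi_apply (X := fun _ : S.Time × S.Node => ℝ) (⟨t, h⟩, i)).comp
      measurable_fst).comp h1
    convert h2 using 1
    funext ω
    simp [pastFun]
  · simp only [h, if_false]
    exact measurable_const

theorem measurable_past_atomSeries (s t : ℕ)
    (η : ∀ l, Fin (S.N l) → EuclideanSpace ℝ (Fin (S.p l))) (c : S.Atom) :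
    Measurable[S.past s] (S.atomSeries η t c) := by
  unfold atomSeries
  exact (continuous_id.inner continuous_const).measurable.comp (S.measurable_past_xZ s t c.1 c.2)

theorem indep_past {σ : ℝ≥0} (hn : S.SubGaussianNoise σ) (t : ℕ) :
    Indep (MeasurableSpace.comap (fun ω i => S.εZ (t + 1) i ω) inferInstance) (S.past t) S.μ := by
  classical
  set s₁ : Finset (S.Time × S.Node) := Finset.univ.filter fun a => a.1.1 = t + 1
  set s₂ : Finset (S.Time × S.Node) := Finset.univ.filter fun a => a.1.1 ≤ t
  have hd : Disjoint s₁ s₂ := by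
    rw [Finset.disjoint_left]
    intro a h1 h2
    simp only [s₁, s₂, Finset.mem_filter] at h1 h2
    omega
  have hεm : ∀ a : S.Time × S.Node, Measurable (S.ε a.1 a.2) := fun a => S.measurable_ε _ _
  have hI := hn.indep.indepFun_finset s₁ s₂ hd hεm
  let φ₁ : (s₁ → ℝ) → S.Node → ℝ := fun e i =>
    if h : t + 1 ∈ Finset.Icc 1 S.T then e ⟨(⟨t + 1, h⟩, i), by simp [s₁]⟩ else 0
  have hφ₁ : Measurable φ₁ := measurable_pi_iff.2 fun i => by
    by_cases h : t + 1 ∈ Finset.Icc 1 S.T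
    · simp only [φ₁, h, dite_true]; exact measurable_pi_apply _
    · simp only [φ₁, h, dite_false]; exact measurable_const
  let φ₂ : (s₂ → ℝ) → S.Time × S.Node → ℝ := fun e a =>
    if h : a ∈ s₂ then e ⟨a, h⟩ else 0
  have hφ₂ : Measurable φ₂ := measurable_pi_iff.2 fun a => by
    by_cases h : a ∈ s₂
    · simp only [φ₂, h, dite_true]; exact measurable_pi_apply _
    · simp only [φ₂, h, dite_false]; exact measurable_const
  have hUV := hI.comp hφ₁ hφ₂
  -- both parts of the noise are functions of the whole noise, which is independent of covariates
  let ψ : (S.Time × S.Node → ℝ) → (S.Node → ℝ) × (S.Time × S.Node → ℝ) := fun e =>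
    (φ₁ fun a => e a, φ₂ fun a => e a)
  have hr : ∀ s : Finset (S.Time × S.Node),
      Measurable fun (e : S.Time × S.Node → ℝ) (a : s) => e a := fun s =>
    measurable_pi_iff.2 fun a => measurable_pi_apply _
  have hψ : Measurable ψ := (hφ₁.comp (hr s₁)).prodMk (hφ₂.comp (hr s₂))
  have hX := hn.exogenous.comp hψ measurable_id
  have hmain := indepFun_prodMk_right (hφ₁.comp ?_) (hφ₂.comp ?_) ?_ hUV hX
  · rw [IndepFun_iff_Indep] at hmain
    convert hmain using 1
    · congr 1
    · unfold past
      congr 1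
      funext ω
      refine Prod.ext (funext fun a => ?_) rfl
      simp only [pastFun, φ₂, Function.comp, s₂, Finset.mem_filter, Finset.mem_univ, true_and]
      split_ifs <;> rfl
  · exact measurable_pi_iff.2 fun a => hεm _
  · exact measurable_pi_iff.2 fun a => hεm _
  · exact measurable_pi_iff.2 fun l => measurable_pi_iff.2 fun a => S.measurable_x _ _ _

theorem innovations {σ : ℝ≥0} (hσ : 0 < σ) (hn : S.SubGaussianNoise σ) :
    Innovations S.μ S.past σ S.εZ where
  le := S.past_le
  mono := S.past_mono
  adapted := S.measurable_past_εZ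
  indep := S.indep_past hn
  mgf t i x := by
    unfold εZ
    by_cases h : t ∈ Finset.Icc 1 S.T
    · simp only [h, if_true]
      exact lintegral_exp_le_of_hasSubgaussianMGF (hn.subGaussian (⟨t, h⟩, i)) x
    · simp only [h, if_false, mul_zero, Real.exp_zero, lintegral_const, measure_univ, mul_one]
      exact ENNReal.ofReal_le_ofReal (Real.one_le_exp (by positivity))
  subG t i := by
    unfold εZ
    by_cases h : t ∈ Finset.Icc 1 S.T
    · simp only [h, if_true]
      exact subG_of_hasSubgaussianMGF hσ (hn.subGaussian (⟨t, h⟩, i)) (S.measurable_ε t i)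
    · simp only [h, if_false]
      exact SubG.zero _

theorem measurable_past_YZ (t : ℕ) (i : S.Node) : Measurable[S.past t] (S.YZ t i) := by
  induction t generalizing i with
  | zero => exact measurable_const
  | succ t ih =>
    have hY : ∀ j, Measurable[S.past (t + 1)] (S.YZ t j) := fun j =>
      (ih j).mono (S.past_mono (Nat.le_succ t)) le_rfl
    have e : S.YZ (t + 1) i = fun ω => S.predZ (S.coef S.ξ₀ fun l => S.g₀ l (i l)) t i ω
      + S.εZ (t + 1) i ω := rfl
    rw [e]
    refine Measurable.add ?_ (S.measurable_past_εZ (t + 1) i)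
    rw [funext (S.predZ_eq_sum _ t i)]
    exact (Finset.measurable_sum _ fun j _ => (hY j).const_mul _).add
      (Finset.measurable_sum _ fun c _ => (S.measurable_past_atomSeries _ _ _ c).const_mul _)

theorem measurable_past_predZ (v : S.Coef) (t : ℕ) (i : S.Node) :
    Measurable[S.past t] (S.predZ v t i) := by
  rw [funext (S.predZ_eq_sum v t i)]
  exact (Finset.measurable_sum _ fun j _ => (S.measurable_past_YZ t j).const_mul _).add
    (Finset.measurable_sum _ fun c _ => (S.measurable_past_atomSeries _ _ _ c).const_mul _)

end Model

end GTNAR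

namespace GTNAR
namespace Model

/-! ### Concentration of the second moments of the regressors -/

universe u

variable {q : ℕ} {G : Fin q → ℕ} (S : Model.{u} G)

/-- The index set of the concentrated covariate vector. -/
abbrev CovIdx : Type := (l : Fin q) × (S.Time × Fin (S.N l))

/-- The vector of scalar products of the covariates with `η` at the times in `J` and with `η'` at
the other times. -/
noncomputable def mixedVec (J : ℕ → Prop) [DecidablePred J]
    (η η' : ∀ l, Fin (S.N l) → EuclideanSpace ℝ (Fin (S.p l))) (ω : S.Ω) :
    EuclideanSpace ℝ S.CovIdx :=
  WithLp.toLp 2 fun a => inner ℝ (S.x a.1 a.2.1 a.2.2 ω)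
    (if J a.2.1 then η a.1 a.2.2 else η' a.1 a.2.2)

theorem measurable_mixedVec (J : ℕ → Prop) [DecidablePred J]
    (η η' : ∀ l, Fin (S.N l) → EuclideanSpace ℝ (Fin (S.p l))) :
    Measurable (S.mixedVec J η η') := by
  refine (PiLp.continuous_toLp 2 _).measurable.comp (measurable_pi_iff.2 fun a => ?_)
  exact (continuous_id.inner continuous_const).measurable.comp (S.measurable_x _ _ _)

variable {S} in
theorem ConcentratedCovariates.mixedVec {K : ℝ} (hc : S.ConcentratedCovariates K) (J : ℕ → Prop)
    [DecidablePred J] {η η' : ∀ l, Fin (S.N l) → EuclideanSpace ℝ (Fin (S.p l))}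
    (hη : ∀ l i, ‖η l i‖ ≤ 1) (hη' : ∀ l i, ‖η' l i‖ ≤ 1) :
    ConvexConcentration K (S.mixedVec J η η') S.μ :=
  hc.concentration (fun l t i => if J t then η l i else η' l i) fun l t i => by
    split_ifs
    · exact hη l i
    · exact hη' l i

variable {S} in
theorem ConcentratedCovariates.integral_inner_eq_zero {K : ℝ} (hc : S.ConcentratedCovariates K)
    {l : Fin q} {t : ℕ} (ht : t ∈ Finset.Icc 1 S.T) (i : Fin (S.N l))
    (v : EuclideanSpace ℝ (Fin (S.p l))) : ∫ ω, inner ℝ (S.x l t i ω) v ∂S.μ = 0 := by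
  classical
  -- integrability of the coordinates, from the concentration for the vectors of a basis
  have hi : Integrable (S.x l t i) S.μ := by
    refine Integrable.of_eval_piLp fun k => ?_
    have h := (hc.concentration (fun l' _ _ => if h : l = l' then h ▸ EuclideanSpace.single k 1
      else 0) (fun l' _ _ => by
        by_cases h : l = l'
        · subst h; simp
        · simp [h]) (fun v => v ⟨l, (⟨t, ht⟩, i)⟩) (by
        refine LipschitzWith.of_dist_le_mul fun v w => ?_
        rw [NNReal.coe_one, one_mul, dist_eq_norm, dist_eq_norm]
        simpa using PiLp.norm_apply_le (v - w) _)
      ⟨convex_univ, fun v _ w _ a b _ _ _ => le_of_eq (by simp)⟩).1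
    simpa [EuclideanSpace.inner_single_right] using h
  have h1 := (innerSL ℝ v).integral_comp_comm hi
  simp only [innerSL_apply_apply] at h1
  simp_rw [real_inner_comm v]
  rw [h1, hc.mean l t ht i, inner_zero_right]

variable {S} in
theorem ConcentratedCovariates.integral_mixedVec {K : ℝ} (hc : S.ConcentratedCovariates K)
    (J : ℕ → Prop) [DecidablePred J] (η η' : ∀ l, Fin (S.N l) → EuclideanSpace ℝ (Fin (S.p l)))
    (a : S.CovIdx) : ∫ ω, S.mixedVec J η η' ω a ∂S.μ = 0 :=
  hc.integral_inner_eq_zero a.2.1.2 a.2.2 _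

variable {S} in
theorem ConcentratedCovariates.subG_atomSeries {K : ℝ} (hK : 0 < K)
    (hc : S.ConcentratedCovariates K) {η : ∀ l, Fin (S.N l) → EuclideanSpace ℝ (Fin (S.p l))}
    (hη : ∀ l i, ‖η l i‖ ≤ 1) (t : ℕ) (c : S.Atom) : SubG S.μ (2 * K) (S.atomSeries η t c) := by
  unfold atomSeries xZ
  by_cases ht : t ∈ Finset.Icc 1 S.T
  · simp only [ht, if_true]
    have hm := S.measurable_mixedVec (fun _ => True) η η
    have := (hc.mixedVec (fun _ => True) hη hη).subG_coord hK ⟨c.1, (⟨t, ht⟩, c.2)⟩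
      ((EuclideanSpace.proj (𝕜 := ℝ) _).continuous.measurable.comp hm)
      (hc.integral_mixedVec _ _ _ _)
    simpa [Model.mixedVec] using this
  · simp only [ht, if_false, inner_zero_left]
    exact SubG.zero _

/-- Products of the covariates at two times, over a set `s` of times for which the vectors `η` and
`η'` can be prescribed simultaneously. -/
theorem subExp_atom_of_consistent {K : ℝ} (hK : 0 < K)
    (hc : S.ConcentratedCovariates K) {η η' : ∀ l, Fin (S.N l) → EuclideanSpace ℝ (Fin (S.p l))}
    (hη : ∀ l i, ‖η l i‖ ≤ 1) (hη' : ∀ l i, ‖η' l i‖ ≤ 1) (hT : 0 < S.T) (c c' : S.Atom)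
    (J : ℕ → Prop) [DecidablePred J] {n d : ℕ} (hn : n + d ≤ S.T) (s : Finset ℕ)
    (hs : ∀ t ∈ s, t < n ∧ J (t + 1) ∧ (η = η' ∨ ¬ J (t + 1 + d))) :
    SubExp S.μ (32 * K ^ 2 * √S.T) (fun ω => ∑ t ∈ s,
      S.atomSeries η (t + 1) c ω * S.atomSeries η' (t + 1 + d) c' ω) := by
  have hmem : ∀ t : s, t.1 + 1 ∈ Finset.Icc 1 S.T := fun t => by
    have := (hs t.1 t.2).1
    rw [Finset.mem_Icc]; omega
  have hmem' : ∀ t : s, t.1 + 1 + d ∈ Finset.Icc 1 S.T := fun t => by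
    have := (hs t.1 t.2).1
    rw [Finset.mem_Icc]; omega
  have := (hc.mixedVec J hη hη').subExp_sum_mul hK (S.measurable_mixedVec J η η')
    (hc.integral_mixedVec J η η')
    (p := fun t : s => ⟨c.1, (⟨t.1 + 1, hmem t⟩, c.2)⟩)
    (p' := fun t : s => ⟨c'.1, (⟨t.1 + 1 + d, hmem' t⟩, c'.2)⟩)
    (fun t t' h => Subtype.ext (Nat.succ_injective (congrArg (fun a : S.CovIdx => a.2.1.1) h)))
    (fun t t' h => Subtype.ext (by
      have := congrArg (fun a : S.CovIdx => a.2.1.1) h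
      simp only at this
      omega)) hT (by
      have h1 : s ⊆ Finset.range n := fun t ht => Finset.mem_range.2 (hs t ht).1
      have h2 := Finset.card_le_card h1
      rw [Finset.card_range] at h2
      rw [Fintype.card_coe]
      omega)
  convert this using 2 with ω
  rw [← Finset.sum_coe_sort s]
  refine Finset.sum_congr rfl fun t _ => ?_
  obtain ⟨-, h1, h2⟩ := hs t.1 t.2
  simp only [atomSeries, xZ, Model.mixedVec, hmem t, hmem' t, if_true, h1]
  congr 2
  rcases h2 with h2 | h2
  · subst h2; simp
  · simp [h2]

/-- At a positive lag the vectors `η` and `η'` may differ: the times are split into two classes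
such that a shift by the lag changes the class. -/
theorem subExp_atom {K : ℝ} (hK : 0 < K)
    (hc : S.ConcentratedCovariates K) {η η' : ∀ l, Fin (S.N l) → EuclideanSpace ℝ (Fin (S.p l))}
    (hη : ∀ l i, ‖η l i‖ ≤ 1) (hη' : ∀ l i, ‖η' l i‖ ≤ 1) (hT : 0 < S.T) (c c' : S.Atom)
    {n d : ℕ} (hn : n + d ≤ S.T) (hd : 1 ≤ d ∨ η = η') :
    SubExp S.μ (64 * K ^ 2 * √S.T) (fun ω => ∑ t ∈ Finset.range n,
      S.atomSeries η (t + 1) c ω * S.atomSeries η' (t + 1 + d) c' ω) := by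
  have hsT : 0 < √(S.T : ℝ) := Real.sqrt_pos.2 (by exact_mod_cast hT)
  rcases hd with hd | hd
  · have hshift : ∀ t : ℕ, ((t + 1 + d) / d) = (t + 1) / d + 1 := fun t =>
      Nat.add_div_right _ hd
    have h1 := S.subExp_atom_of_consistent hK hc hη hη' hT c c' (fun t => t / d % 2 = 0) hn
      ((Finset.range n).filter fun t => (t + 1) / d % 2 = 0) (fun t ht => by
        rw [Finset.mem_filter, Finset.mem_range] at ht
        refine ⟨ht.1, ht.2, Or.inr ?_⟩
        rw [hshift]; omega)
    have h2 := S.subExp_atom_of_consistent hK hc hη hη' hT c c' (fun t => ¬ t / d % 2 = 0) hn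
      ((Finset.range n).filter fun t => ¬ (t + 1) / d % 2 = 0) (fun t ht => by
        rw [Finset.mem_filter, Finset.mem_range] at ht
        refine ⟨ht.1, ht.2, Or.inr ?_⟩
        rw [hshift]; omega)
    have h3 := h1.add h2 (by positivity) (by positivity)
    convert h3 using 2 with ω
    · ring
    · rw [Finset.sum_filter_add_sum_filter_not]
  · refine (S.subExp_atom_of_consistent hK hc hη hη' hT c c' (fun _ => True) hn (Finset.range n)
      fun t ht => ⟨Finset.mem_range.1 ht, trivial, Or.inl hd⟩).mono (by positivity) ?_
    gcongr
    norm_num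

/-- The inputs of the autoregression: covariates and noise. -/
noncomputable def input (η : ∀ l, Fin (S.N l) → EuclideanSpace ℝ (Fin (S.p l))) (t : ℕ) :
    S.Atom ⊕ S.Node → S.Ω → ℝ :=
  Sum.elim (S.atomSeries η t) (S.εZ t)

/-- The weights of the inputs, where the covariate effects are normalized by `B`. -/
def inputWeight (B : ℝ) (i : S.Node) : S.Atom ⊕ S.Node → ℝ :=
  Sum.elim (fun c => B * if i c.1 = c.2 then 1 else 0) (fun j => if i = j then 1 else 0)

theorem isAutoregression {B κ : ℝ} (hB : 0 < B) (hκ0 : 0 < κ) (hκ : κ < 1) (hs : S.Stability κ) :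
    IsAutoregression (fun i => S.lagWeight (S.coef S.ξ₀ fun l => S.g₀ l (i l)) i)
      (S.inputWeight B) κ (q * B + 1)
      (S.input fun l i => B⁻¹ • S.ξ₀.zeta l (S.g₀ l i)) S.YZ where
  zero _ _ := rfl
  succ t i ω := by
    have e : S.YZ (t + 1) i ω = S.predZ (S.coef S.ξ₀ fun l => S.g₀ l (i l)) t i ω
      + S.εZ (t + 1) i ω := rfl
    rw [e, predZ_eq_sum, add_assoc]
    congr 1
    rw [Fintype.sum_sum_type]
    simp only [inputWeight, input, Sum.elim_inl, Sum.elim_inr, ite_mul, one_mul, zero_mul,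
      Finset.sum_ite_eq, Finset.mem_univ, if_true]
    congr 1
    refine Finset.sum_congr rfl fun c _ => ?_
    obtain ⟨l, k⟩ := c
    by_cases h : i l = k
    · subst h
      simp only [if_true, mul_one, atomSeries]
      rw [inner_smul_right, ← mul_assoc, mul_inv_cancel₀ hB.ne', one_mul]
      rfl
    · simp [h]
  sum_le i := (S.sum_abs_lagWeight_le _ i).trans (hs.2 _)
  sum_input_le i := by
    rw [Fintype.sum_sum_type]
    simp only [inputWeight, Sum.elim_inl, Sum.elim_inr, abs_mul, abs_of_pos hB]
    have e1 : ∀ c : S.Atom, |if i c.1 = c.2 then (1 : ℝ) else 0| = if i c.1 = c.2 then 1 else 0 :=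
      fun c => by split_ifs <;> simp
    have e2 : ∀ j : S.Node, |if i = j then (1 : ℝ) else 0| = if i = j then 1 else 0 :=
      fun c => by split_ifs <;> simp
    simp_rw [e1, e2]
    rw [← Finset.mul_sum, sum_ite_atom]
    simp [mul_comm]
  κ_pos := hκ0
  κ_lt := hκ
  b_pos := by positivity

/-- The linear predictors in all directions of the unit ball are sub-Gaussian, and their second
moments and their products with the noise concentrate, with constants depending only on the
constants of the model assumptions. -/
theorem exists_concentration (q : ℕ) (B K κ : ℝ) (σ : ℝ≥0) (hσ : 0 < σ) (hK : 0 < K) (hκ : κ < 1) :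
    ∃ C : ℝ, 0 < C ∧ ∀ {G : Fin q → ℕ} (S : Model.{u} G), S.BoundedParam B → S.SubGaussianNoise σ →
      S.ConcentratedCovariates K → S.Stability κ → 0 < S.T →
      ∀ (i : S.Node) (v : S.Coef), ‖v‖ ≤ 1 →
        (∀ t, SubG S.μ C (S.predZ v t i)) ∧
        SubExp S.μ (C * √S.T) (fun ω => ∑ t ∈ Finset.range S.T, S.predZ v t i ω ^ 2) ∧
        SubExp S.μ (C * √S.T)
          (fun ω => ∑ t ∈ Finset.range S.T, S.predZ v t i ω * S.εZ (t + 1) i ω) := by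
  obtain ⟨B', hB'⟩ : ∃ x : ℝ, x = max B 1 := ⟨_, rfl⟩
  have hB0 : 0 < B' := by rw [hB']; exact lt_of_lt_of_le one_pos (le_max_right _ _)
  obtain ⟨κ', hκ'⟩ : ∃ x : ℝ, x = max κ (1 / 2) := ⟨_, rfl⟩
  have hκ0 : 0 < κ' := by
    rw [hκ']; exact lt_of_lt_of_le (by norm_num) (le_max_right _ _)
  have hκ1 : κ' < 1 := by
    rw [hκ']; exact max_lt hκ (by norm_num)
  have h1κ : 0 < 1 - κ' := by linarith
  have hσ' : (0 : ℝ) < σ := by exact_mod_cast hσ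
  obtain ⟨b, hb⟩ : ∃ x : ℝ, x = q * B' + 1 := ⟨_, rfl⟩
  have hb0 : 0 < b := by rw [hb]; positivity
  -- scales of the inputs, of the series and of the predictors
  obtain ⟨R, hR⟩ : ∃ x : ℝ, x = 2 * K + 4 * σ := ⟨_, rfl⟩
  have hR0 : 0 < R := by rw [hR]; positivity
  obtain ⟨LY, hLY⟩ : ∃ x : ℝ, x = b * R / (1 - κ') := ⟨_, rfl⟩
  have hLY0 : 0 < LY := by rw [hLY]; positivity
  obtain ⟨r, hr⟩ : ∃ x : ℝ, x = q + 1 := ⟨_, rfl⟩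
  have hr0 : 0 < r := by rw [hr]; positivity
  obtain ⟨LZ, hLZ⟩ : ∃ x : ℝ, x = r * LY + r * R := ⟨_, rfl⟩
  have hLZ0 : 0 < LZ := by rw [hLZ]; positivity
  -- scales of the moments of the inputs, the cross moments, and the moments of the series
  obtain ⟨H₀, hH₀⟩ : ∃ x : ℝ, x = 64 * K ^ 2 + 4 * σ * R + 640 * σ ^ 2 := ⟨_, rfl⟩
  have hH₀0 : 0 < H₀ := by rw [hH₀]; positivity
  obtain ⟨H₁, hH₁⟩ : ∃ x : ℝ, x = b * H₀ / (1 - κ') := ⟨_, rfl⟩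
  have hH₁0 : 0 < H₁ := by rw [hH₁]; positivity
  obtain ⟨H₂, hH₂⟩ : ∃ x : ℝ, x = H₁ + 4 * σ * LY + H₀ := ⟨_, rfl⟩
  have hH₂0 : 0 < H₂ := by rw [hH₂]; positivity
  obtain ⟨H₃, hH₃⟩ : ∃ x : ℝ, x = (2 * b + b ^ 2) * H₂ / (1 - κ') := ⟨_, rfl⟩
  have hH₃0 : 0 < H₃ := by rw [hH₃]; positivity
  obtain ⟨C, hC⟩ : ∃ x : ℝ, x = LZ + (r * (r * H₃) + 2 * (r * (r * H₁)) + r * (r * H₀))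
    + 4 * σ * LZ := ⟨_, rfl⟩
  refine ⟨C, by rw [hC]; positivity, ?_⟩
  intro G S hpar hn hc hs hT i v hv
  have hsT : 0 < √(S.T : ℝ) := Real.sqrt_pos.2 (by exact_mod_cast hT)
  have hI := S.innovations hσ hn
  have hs' : S.Stability κ' := ⟨hs.1, fun g => (hs.2 g).trans (hκ' ▸ le_max_left _ _)⟩
  set ζ : ∀ l, Fin (S.N l) → EuclideanSpace ℝ (Fin (S.p l)) :=
    fun l i => B'⁻¹ • S.ξ₀.zeta l (S.g₀ l i) with hζ
  have hζ1 : ∀ l i, ‖ζ l i‖ ≤ 1 := fun l i => by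
    rw [hζ, norm_smul, Real.norm_eq_abs, abs_of_pos (inv_pos.2 hB0), inv_mul_le_iff₀ hB0, mul_one]
    exact (hpar.2.1 _ _).trans (hB' ▸ le_max_left _ _)
  have hA := S.isAutoregression hB0 hκ0 hκ1 hs'
  rw [← hb] at hA
  set η : ∀ l, Fin (S.N l) → EuclideanSpace ℝ (Fin (S.p l)) := fun l _ => S.covCoef v l with hη
  have hη1 : ∀ l i, ‖η l i‖ ≤ 1 := fun l i => by
    refine le_trans ?_ hv
    rw [EuclideanSpace.norm_eq, EuclideanSpace.norm_eq]
    refine Real.sqrt_le_sqrt ?_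
    rw [Fintype.sum_sum_type, Fintype.sum_sigma]
    have h1 : ∑ k, ‖(S.covCoef v l) k‖ ^ 2 ≤ ∑ o, ‖v (.inl ⟨l, o⟩)‖ ^ 2 := by
      rw [Fintype.sum_option]
      have : 0 ≤ ‖v (.inl ⟨l, none⟩)‖ ^ 2 := by positivity
      simp only [covCoef]
      linarith
    have h2 := Finset.single_le_sum (f := fun l => ∑ o, ‖v (.inl ⟨l, o⟩)‖ ^ 2)
      (fun l _ => Finset.sum_nonneg fun o _ => by positivity) (Finset.mem_univ l)
    have h3 : 0 ≤ ∑ x : Unit, ‖v (.inr x)‖ ^ 2 := Finset.sum_nonneg fun _ _ => by positivity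
    linarith
  have hvabs : ∀ a, |v a| ≤ 1 := fun a =>
    (by simpa using PiLp.norm_apply_le v a : |v a| ≤ ‖v‖).trans hv
  have hM : ∑ j, |S.lagWeight v i j| ≤ r := by
    refine (S.sum_abs_lagWeight_le v i).trans ?_
    rw [hr]
    refine add_le_add ((Finset.sum_le_sum fun l _ => hvabs (.inl ⟨l, none⟩)).trans ?_)
      (hvabs _)
    simp
  have hRw : ∑ c : S.Atom, |if i c.1 = c.2 then (1 : ℝ) else 0| ≤ r := by
    have e1 : ∀ c : S.Atom, |if i c.1 = c.2 then (1 : ℝ) else 0| = if i c.1 = c.2 then 1 else 0 :=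
      fun c => by split_ifs <;> simp
    simp_rw [e1]
    rw [sum_ite_atom, hr]
    linarith
  -- sub-Gaussian scales
  have hatom : ∀ η : ∀ l, Fin (S.N l) → EuclideanSpace ℝ (Fin (S.p l)), (∀ l i, ‖η l i‖ ≤ 1) →
      ∀ t c, SubG S.μ R (S.atomSeries η t c) := fun η h t c =>
    (hc.subG_atomSeries hK h t c).mono (by positivity) (by rw [hR]; linarith)
  have hinput : ∀ t c, SubG S.μ R (S.input ζ t c) := by
    intro t c
    rcases c with c | j
    · exact hatom ζ hζ1 t c
    · exact (hI.subG t j).mono (by positivity) (by rw [hR]; linarith)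
  have hY : ∀ t i, SubG S.μ LY (S.YZ t i) := hLY ▸ hA.subG hR0 hinput
  have hZ : ∀ t, SubG S.μ LZ (S.predZ v t i) := fun t => by
    rw [funext (S.predZ_eq_sum v t i), hLZ]
    exact (SubG.sum Finset.univ _ hLY0 hr0 hM fun j _ => hY t j).add
      (SubG.sum Finset.univ _ hR0 hr0 hRw fun c _ => hatom η hη1 (t + 1) c) (by positivity)
        (by positivity)
  -- moments of pairs of inputs
  have hεatom : ∀ η : ∀ l, Fin (S.N l) → EuclideanSpace ℝ (Fin (S.p l)), (∀ l i, ‖η l i‖ ≤ 1) →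
      ∀ n d c j, n + d ≤ S.T → SubExp S.μ (H₀ * √S.T) (fun ω => ∑ t ∈ Finset.range n,
        S.εZ (t + 1) j ω * S.atomSeries η (t + 1 + d) c ω) := by
    intro η h n d c j hn
    have := (hI.subExp_sum_mul hσ' hR0 (Z := fun t => S.atomSeries η (t + 1 + d) c)
      (fun t => hatom η h _ c) (fun t => S.measurable_past_atomSeries t _ η c) (S := n) (T := S.T)
      (by omega) hT j).mono (L' := H₀ * √S.T) (by positivity) (by
        gcongr; rw [hH₀]; nlinarith [sq_nonneg K, sq_nonneg (σ : ℝ)])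
    simpa only [mul_comm] using this
  have hinatom : ∀ η : ∀ l, Fin (S.N l) → EuclideanSpace ℝ (Fin (S.p l)), (∀ l i, ‖η l i‖ ≤ 1) →
      ∀ c' n d c, 1 ≤ d → n + d ≤ S.T → SubExp S.μ (H₀ * √S.T) (fun ω => ∑ t ∈ Finset.range n,
        S.input ζ (t + 1) c ω * S.atomSeries η (t + 1 + d) c' ω) := by
    intro η h c' n d c hd hn
    rcases c with c | j
    · refine (S.subExp_atom hK hc hζ1 h hT c c' hn (Or.inl hd)).mono (by positivity) ?_
      gcongr
      rw [hH₀]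
      have : 0 ≤ 4 * σ * R + 640 * (σ : ℝ) ^ 2 := by positivity
      linarith
    · exact hεatom η h n d c' j hn
  have hcross : ∀ η : ∀ l, Fin (S.N l) → EuclideanSpace ℝ (Fin (S.p l)), (∀ l i, ‖η l i‖ ≤ 1) →
      ∀ n i c, n ≤ S.T → SubExp S.μ (H₁ * √S.T) (fun ω => ∑ t ∈ Finset.range n,
        S.YZ t i ω * S.atomSeries η (t + 1) c ω) := by
    intro η h n i c hn
    have := hA.subExp_cross (w := fun t => S.atomSeries η t c) (by positivity : 0 < H₀ * √S.T)
      (T := S.T) (hinatom η h c) n 1 le_rfl (by omega) i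
    convert this using 1
    rw [hH₁]; ring
  have hYin : ∀ n i c, n ≤ S.T → SubExp S.μ (H₂ * √S.T) (fun ω => ∑ t ∈ Finset.range n,
        S.YZ t i ω * S.input ζ (t + 1) c ω) := by
    intro n i c hn
    rcases c with c | j
    · refine (hcross ζ hζ1 n i c hn).mono (by positivity) ?_
      gcongr
      rw [hH₂]
      have : 0 ≤ 4 * σ * LY := by positivity
      linarith
    · refine (hI.subExp_sum_mul hσ' hLY0 (fun t => hY t i) (fun t => S.measurable_past_YZ t i)
        hn hT j).mono (by positivity) ?_
      gcongr
      rw [hH₂]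
      linarith
  have hatat : ∀ η : ∀ l, Fin (S.N l) → EuclideanSpace ℝ (Fin (S.p l)), (∀ l i, ‖η l i‖ ≤ 1) →
      ∀ n c c', n ≤ S.T → SubExp S.μ (H₀ * √S.T) (fun ω => ∑ t ∈ Finset.range n,
        S.atomSeries η (t + 1) c ω * S.atomSeries η (t + 1) c' ω) := by
    intro η h n c c' hn
    refine (S.subExp_atom hK hc h h hT c c' (d := 0) (by omega) (Or.inr rfl)).mono
      (by positivity) ?_
    gcongr
    rw [hH₀]
    have : 0 ≤ 4 * σ * R + 640 * (σ : ℝ) ^ 2 := by positivity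
    linarith
  have hinin : ∀ n c c', n ≤ S.T → SubExp S.μ (H₂ * √S.T) (fun ω => ∑ t ∈ Finset.range n,
        S.input ζ (t + 1) c ω * S.input ζ (t + 1) c' ω) := by
    intro n c c' hn
    have hle : H₀ * √S.T ≤ H₂ * √S.T := by
      gcongr
      rw [hH₂]
      have : 0 ≤ H₁ + 4 * σ * LY := by positivity
      linarith
    refine SubExp.mono ?_ (by positivity) hle
    rcases c with c | j <;> rcases c' with c' | j'
    · exact hatat ζ hζ1 n c c' hn
    · have := hεatom ζ hζ1 n 0 c j' (by omega)
      convert this using 2 with ω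
      exact Finset.sum_congr rfl fun t _ => mul_comm _ _
    · exact hεatom ζ hζ1 n 0 c' j (by omega)
    · refine (hI.subExp_sum_self hσ' hn hT j j').mono (by positivity) ?_
      gcongr
      rw [hH₀]
      have : 0 ≤ 64 * K ^ 2 + 4 * σ * R := by positivity
      linarith
  have hYY : ∀ i j, SubExp S.μ (H₃ * √S.T) (fun ω => ∑ t ∈ Finset.range S.T,
        S.YZ t i ω * S.YZ t j ω) := by
    intro i j
    have := hA.subExp_auto (by positivity : 0 < H₂ * √S.T) hYin hinin S.T le_rfl i j
    convert this using 1
    rw [hH₃]; ring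
  refine ⟨fun t => (hZ t).mono hLZ0 ?_, ?_, ?_⟩
  · have : 0 ≤ (r * (r * H₃) + 2 * (r * (r * H₁)) + r * (r * H₀)) + 4 * σ * LZ := by positivity
    rw [hC]; linarith
  · have h1 := SubExp.sum_bilinear (a := S.YZ) (b := S.YZ) _ _ hr0 hr0
      (by positivity : 0 < H₃ * √S.T) hM hM S.T hYY
    have h2 := SubExp.sum_bilinear (a := S.YZ) (b := fun t => S.atomSeries η (t + 1)) _ _ hr0 hr0
      (by positivity : 0 < H₁ * √S.T) hM hRw S.T (fun i c => hcross η hη1 S.T i c le_rfl)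
    have h3 := SubExp.sum_bilinear (a := fun t => S.atomSeries η (t + 1))
      (b := fun t => S.atomSeries η (t + 1)) _ _ hr0 hr0
      (by positivity : 0 < H₀ * √S.T) hRw hRw S.T (fun i c => hatat η hη1 S.T i c le_rfl)
    have h4 := ((h1.add h2 (by positivity) (by positivity)).add h2 (by positivity)
      (by positivity)).add h3 (by positivity) (by positivity)
    have h5 := h4.mono (L' := C * √S.T) (by positivity) (by
      have : r * (r * (H₃ * √S.T)) + r * (r * (H₁ * √S.T)) + r * (r * (H₁ * √S.T))
          + r * (r * (H₀ * √S.T))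
        = (r * (r * H₃) + 2 * (r * (r * H₁)) + r * (r * H₀)) * √S.T := by ring
      rw [this]
      gcongr
      have : 0 ≤ 4 * σ * LZ := by positivity
      rw [hC]; linarith)
    convert h5 using 2 with ω
    rw [← Finset.sum_add_distrib, ← Finset.sum_add_distrib, ← Finset.sum_add_distrib]
    refine Finset.sum_congr rfl fun t _ => ?_
    rw [predZ_eq_sum]
    ring
  · refine (hI.subExp_sum_mul hσ' hLZ0 hZ (fun t => S.measurable_past_predZ v t i) le_rfl hT
      i).mono (by positivity) ?_
    refine mul_le_mul_of_nonneg_right ?_ hsT.le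
    have : 0 ≤ LZ + (r * (r * H₃) + 2 * (r * (r * H₁)) + r * (r * H₀)) := by positivity
    rw [hC]; linarith

end Model
end GTNAR

namespace GTNAR

/-! ### Recovery of the groups from approximate minimization -/

section Recovery

variable {q : ℕ} {N G : Fin q → ℕ}

/-- The groups of a tensor entry. -/
def label (g : Membership N G) (i : ∀ l, Fin (N l)) : ∀ l, Fin (G l) := fun l => g l (i l)

theorem label_update (g : Membership N G) (i : ∀ l, Fin (N l)) (l : Fin q) (k : Fin (N l)) :
    label g (Function.update i l k) = Function.update (label g i) l (g l k) := by
  funext l'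
  by_cases h : l' = l
  · subst h; simp [label]
  · simp [label, Function.update_of_ne h]

theorem label_update_update (g : Membership N G) (i : ∀ l, Fin (N l)) (l : Fin q) (k : Fin (N l))
    (a : Fin (G l)) :
    label (Function.update g l (Function.update (g l) k a)) (Function.update i l k)
      = Function.update (label g i) l a := by
  funext l'
  by_cases h : l' = l
  · subst h; simp [label]
  · simp [label, Function.update_of_ne h]

/-- Exchanging the coordinate `i l` with the extra index `k` is an involution. -/
theorem sum_update_swap (l : Fin q) (H : (∀ l, Fin (N l)) → Fin (N l) → ℝ) :
    ∑ i, ∑ k, H i k = ∑ i, ∑ k, H (Function.update i l k) (i l) := by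
  rw [← Fintype.sum_prod_type', ← Fintype.sum_prod_type']
  refine Fintype.sum_equiv
    { toFun := fun z => (Function.update z.1 l z.2, z.1 l)
      invFun := fun z => (Function.update z.1 l z.2, z.1 l)
      left_inv := fun z => by simp
      right_inv := fun z => by simp } _ _ fun z => by simp

theorem sum_sum_update (l : Fin q) (F : (∀ l, Fin (N l)) → ℝ) :
    ∑ k, ∑ i, F (Function.update i l k) = N l * ∑ i, F i := by
  rw [Finset.sum_comm, ← sum_update_swap l fun i _ => F i]
  simp [Finset.mul_sum]

theorem sum_update_eq (l : Fin q) (k : Fin (N l)) (F : (∀ l, Fin (N l)) → ℝ)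
    (hF : ∀ i, i l ≠ k → F i = 0) :
    ∑ i, F (Function.update i l k) = N l * ∑ i, F i := by
  have := sum_update_swap (N := N) l fun i _ => F i
  simp only [Finset.sum_const, Finset.card_univ, Fintype.card_fin, nsmul_eq_mul] at this
  rw [Finset.mul_sum, this]
  refine Finset.sum_congr rfl fun i _ => ?_
  rw [Finset.sum_eq_single k]
  · intro k' _ hk'; exact hF _ (by simpa using hk')
  · simp

/-- If every tensor entry is fitted by a function `f i` of the deviation of its estimated from its
true coefficients, with quadratic lower and upper bounds up to a linear error with factor `ρ`, then
a global minimizer `(β, g)` recovers the true groups `g₀` up to relabelling, provided that `ρ ^ 2`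
is small compared with the gap `c` between the groups. -/
theorem exists_perm_of_minimizer {V : Type*} [NormedAddCommGroup V] {β β₀ : (∀ l, Fin (G l)) → V}
    {f : (∀ l, Fin (N l)) → V → ℝ} {a M ρ c γ cπ : ℝ} (ha : 0 < a) (hM : 0 < M) (hγ : 0 < γ)
    (hlow : ∀ i v, a * ‖v‖ ^ 2 - 2 * ρ * ‖v‖ ≤ f i v)
    (hup : ∀ i v, f i v ≤ M * ‖v‖ ^ 2 + 2 * ρ * ‖v‖)
    {g g₀ : Membership N G} (hN : ∀ l, 0 < N l)
    (hmin₀ : ∑ i, f i (β (label g i) - β₀ (label g₀ i)) ≤ 0)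
    (hmin : ∀ g', ∑ i, f i (β (label g i) - β₀ (label g₀ i))
      ≤ ∑ i, f i (β (label g' i) - β₀ (label g₀ i)))
    (hgap : ∀ l (g₁ g₂ : Fin (G l)), g₁ ≠ g₂ → ∃ h : ∀ l, Fin (G l),
      c ≤ ‖β₀ (Function.update h l g₁) - β₀ (Function.update h l g₂)‖ ^ 2)
    (hprop : ∀ l k, cπ * N l ≤ ((Finset.univ.filter fun i => g₀ l i = k).card : ℝ))
    (hγπ : ∀ l, γ * G l ≤ cπ)
    (hc₁ : 4 * (4 * ρ ^ 2 / a ^ 2 / γ ^ q) < c)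
    (hc₂ : 2 * ρ ^ 2 / a + (M + 1) * (4 * ρ ^ 2 / a ^ 2 / γ) + ρ ^ 2
      < a / 2 * (γ ^ q * (c / 2 - 4 * ρ ^ 2 / a ^ 2 / γ ^ q))) :
    ∃ π : ∀ l, Equiv.Perm (Fin (G l)), ∀ l i, g l i = π l (g₀ l i) := by
  classical
  set n : ℝ := ∏ l, (N l : ℝ) with hn
  have hn0 : 0 < n := Finset.prod_pos fun l _ => by exact_mod_cast hN l
  have hcard : ((Finset.univ : Finset (∀ l, Fin (N l))).card : ℝ) = n := by
    simp [hn, Fintype.card_pi]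
  set D : (∀ l, Fin (N l)) → V := fun i => β (label g i) - β₀ (label g₀ i) with hD
  -- bounds of the mean square deviation and of the squared deviation of typical entries
  obtain ⟨E₁, hE₁⟩ : ∃ x, x = 4 * ρ ^ 2 / a ^ 2 := ⟨_, rfl⟩
  obtain ⟨E₂, hE₂⟩ : ∃ x, x = E₁ / γ ^ q := ⟨_, rfl⟩
  rw [← hE₁, ← hE₂] at hc₁ hc₂
  have hE₁0 : 0 ≤ E₁ := by rw [hE₁]; positivity
  have hlow' : ∀ i v, a / 2 * ‖v‖ ^ 2 - 2 * ρ ^ 2 / a ≤ f i v := fun i v => by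
    refine le_trans ?_ (hlow i v)
    have h1 : 0 ≤ (a * ‖v‖ - 2 * ρ) ^ 2 / (2 * a) := by positivity
    have h2 : (a * ‖v‖ - 2 * ρ) ^ 2 / (2 * a)
        = a / 2 * ‖v‖ ^ 2 - 2 * ρ * ‖v‖ + 2 * ρ ^ 2 / a := by field_simp; ring
    linarith
  have hup' : ∀ i v, f i v ≤ (M + 1) * ‖v‖ ^ 2 + ρ ^ 2 := fun i v => by
    refine (hup i v).trans ?_
    nlinarith [sq_nonneg (‖v‖ - ρ)]
  have hsq : ∑ i, ‖D i‖ ^ 2 ≤ n * E₁ := by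
    have h1 : ∑ i, (a / 2 * ‖D i‖ ^ 2 - 2 * ρ ^ 2 / a) ≤ 0 :=
      (Finset.sum_le_sum fun i _ => hlow' i (D i)).trans hmin₀
    rw [Finset.sum_sub_distrib, ← Finset.mul_sum, Finset.sum_const, nsmul_eq_mul, hcard] at h1
    have h2 : n * E₁ = (n * (2 * ρ ^ 2 / a)) * (2 / a) := by rw [hE₁]; field_simp; ring
    have h3 : ∑ i, ‖D i‖ ^ 2 = (a / 2 * ∑ i, ‖D i‖ ^ 2) * (2 / a) := by field_simp
    rw [h2, h3]
    exact mul_le_mul_of_nonneg_right (by linarith) (by positivity)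
  -- the most frequent estimated group within every true group
  have hpop : ∀ l k, ∃ k', γ * N l
      ≤ ((Finset.univ.filter fun i => g₀ l i = k ∧ g l i = k').card : ℝ) := by
    intro l k
    by_contra! hcon
    have hG : 0 < (G l : ℝ) := by exact_mod_cast (Fin.pos k)
    have h1 := Finset.sum_lt_sum_of_nonempty (s := (Finset.univ : Finset (Fin (G l))))
      ⟨k, Finset.mem_univ k⟩ fun k' _ => hcon k'
    have h2 : ∑ k' : Fin (G l), (((Finset.univ.filter fun i => g₀ l i = k ∧ g l i = k').card) : ℝ)
        = ((Finset.univ.filter fun i => g₀ l i = k).card : ℝ) := by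
      rw [Finset.card_eq_sum_card_fiberwise (f := g l) (t := Finset.univ) (by simp)]
      push_cast
      simp_rw [Finset.filter_filter]
    rw [h2, Finset.sum_const, nsmul_eq_mul, Finset.card_univ, Fintype.card_fin] at h1
    have h3 : (G l : ℝ) * (γ * N l) ≤ cπ * N l := by
      rw [← mul_assoc, mul_comm (G l : ℝ)]
      exact mul_le_mul_of_nonneg_right (hγπ l) (Nat.cast_nonneg _)
    linarith [hprop l k]
  choose σ hσ using hpop
  set C : ∀ l, Fin (G l) → Finset (Fin (N l)) := fun l k =>
    Finset.univ.filter fun i => g₀ l i = k ∧ g l i = σ l k with hC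
  have hCmem : ∀ (h : ∀ l, Fin (G l)) i, i ∈ Fintype.piFinset (fun l => C l (h l)) →
      label g₀ i = h ∧ label g i = fun l => σ l (h l) := by
    intro h i hi
    rw [Fintype.mem_piFinset] at hi
    simp only [hC, Finset.mem_filter, Finset.mem_univ, true_and] at hi
    exact ⟨funext fun l => (hi l).1, funext fun l => (hi l).2⟩
  have hCcard : ∀ h : ∀ l, Fin (G l),
      γ ^ q * n ≤ ((Fintype.piFinset fun l => C l (h l)).card : ℝ) := by
    intro h
    rw [Fintype.card_piFinset]
    push_cast
    have : γ ^ q * n = ∏ l : Fin q, (γ * N l) := by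
      rw [Finset.prod_mul_distrib, Finset.prod_const, Finset.card_univ, Fintype.card_fin]
    rw [this]
    exact Finset.prod_le_prod (fun l _ => by positivity) fun l _ => hσ l (h l)
  have hclose : ∀ h : ∀ l, Fin (G l), ‖β (fun l => σ l (h l)) - β₀ h‖ ^ 2 ≤ E₂ := by
    intro h
    have h1 : ∑ i ∈ Fintype.piFinset fun l => C l (h l), ‖β (fun l => σ l (h l)) - β₀ h‖ ^ 2
        ≤ ∑ i, ‖D i‖ ^ 2 := by
      refine le_trans (le_of_eq (Finset.sum_congr rfl fun i hi => ?_))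
        (Finset.sum_le_sum_of_subset_of_nonneg (Finset.subset_univ _) fun _ _ _ => by positivity)
      obtain ⟨e1, e2⟩ := hCmem h i hi
      simp only [hD, e1, e2]
    rw [Finset.sum_const, nsmul_eq_mul] at h1
    have h2 := (mul_le_mul_of_nonneg_right (hCcard h)
      (by positivity : 0 ≤ ‖β (fun l => σ l (h l)) - β₀ h‖ ^ 2)).trans (h1.trans hsq)
    rw [hE₂, le_div_iff₀ (by positivity)]
    nlinarith
  -- two true groups with the same estimated group would have almost the same coefficients
  have hinj : ∀ l, Function.Injective (σ l) := by
    intro l k₁ k₂ hk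
    by_contra hne
    obtain ⟨h, hh⟩ := hgap l k₁ k₂ hne
    have e : (fun l' => σ l' (Function.update h l k₁ l'))
        = fun l' => σ l' (Function.update h l k₂ l') := by
      funext l'
      by_cases hl : l' = l
      · subst hl; simpa using hk
      · simp [Function.update_of_ne hl]
    have h1 := hclose (Function.update h l k₁)
    have h2 := hclose (Function.update h l k₂)
    rw [e] at h1
    set x := β fun l' => σ l' (Function.update h l k₂ l')
    have h3 : ‖β₀ (Function.update h l k₁) - β₀ (Function.update h l k₂)‖
        ≤ ‖x - β₀ (Function.update h l k₁)‖ + ‖x - β₀ (Function.update h l k₂)‖ := by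
      have := norm_sub_le_norm_sub_add_norm_sub (β₀ (Function.update h l k₁)) x
        (β₀ (Function.update h l k₂))
      rwa [norm_sub_rev _ x] at this
    have h4 := pow_le_pow_left₀ (norm_nonneg _) h3 2
    nlinarith [sq_nonneg (‖x - β₀ (Function.update h l k₁)‖ - ‖x - β₀ (Function.update h l k₂)‖)]
  have hbij : ∀ l, Function.Bijective (σ l) := fun l => Finite.injective_iff_bijective.1 (hinj l)
  refine ⟨fun l => Equiv.ofBijective (σ l) (hbij l), fun l i₀ => ?_⟩
  simp only [Equiv.ofBijective_apply]
  by_contra hne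
  -- a wrongly classified node `i₀`, whose estimated group corresponds to the true group `k'`
  obtain ⟨k', hk'⟩ := (hbij l).2 (g l i₀)
  set k := g₀ l i₀ with hk
  have hkk' : k' ≠ k := fun e => hne (by rw [← hk', e])
  obtain ⟨h, hh⟩ := hgap l k' k hkk'
  have hNl : (0 : ℝ) < N l := by exact_mod_cast hN l
  set W : (∀ l, Fin (N l)) → V := fun i =>
    β (Function.update (label g i) l (σ l k)) - β₀ (Function.update (label g₀ i) l k) with hW
  -- after the correction of `i₀` its slice fits as well as the slices of typical nodes
  have hWsum : ∑ i, ‖W i‖ ^ 2 ≤ n * (E₁ / γ) := by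
    have h1 : ∑ k₁ ∈ C l k, ∑ i, ‖W i‖ ^ 2 ≤ N l * ∑ i, ‖D i‖ ^ 2 := by
      rw [← sum_sum_update l fun i => ‖D i‖ ^ 2]
      refine le_trans (le_of_eq (Finset.sum_congr rfl fun k₁ hk₁ => ?_))
        (Finset.sum_le_sum_of_subset_of_nonneg (Finset.subset_univ _) fun _ _ _ =>
          Finset.sum_nonneg fun _ _ => by positivity)
      refine Finset.sum_congr rfl fun i _ => ?_
      simp only [hC, Finset.mem_filter, Finset.mem_univ, true_and] at hk₁
      simp only [hW, hD, label_update, hk₁.1, hk₁.2]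
    rw [Finset.sum_const, nsmul_eq_mul] at h1
    have h0 : 0 ≤ ∑ i, ‖W i‖ ^ 2 := Finset.sum_nonneg fun _ _ => by positivity
    have h2 := (mul_le_mul_of_nonneg_right (hσ l k) h0).trans h1
    have h3 : γ * ∑ i, ‖W i‖ ^ 2 ≤ n * E₁ := by
      have h4 : (N l : ℝ) * (γ * ∑ i, ‖W i‖ ^ 2) ≤ N l * (n * E₁) := by
        have := mul_le_mul_of_nonneg_left hsq hNl.le
        linarith
      exact le_of_mul_le_mul_left h4 hNl
    rw [← mul_div_assoc, le_div_iff₀ hγ]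
    linarith
  -- before the correction the entries of the slice in the groups `h` deviate by the gap
  have hDsum : γ ^ q * n * (c / 2 - E₂) ≤ ∑ i, ‖D (Function.update i l i₀)‖ ^ 2 := by
    have h0 : 0 ≤ c / 2 - E₂ := by
      have : 0 ≤ E₂ := by rw [hE₂]; positivity
      linarith
    set h' := Function.update h l k' with hh'
    refine (mul_le_mul_of_nonneg_right (hCcard h') h0).trans ?_
    rw [← nsmul_eq_mul, ← Finset.sum_const]
    refine le_trans (Finset.sum_le_sum fun i hi => ?_)
      (Finset.sum_le_sum_of_subset_of_nonneg (Finset.subset_univ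
        (Fintype.piFinset fun l => C l (h' l))) fun _ _ _ => by positivity)
    obtain ⟨e1, e2⟩ := hCmem h' i hi
    have e3 : D (Function.update i l i₀)
        = (β (fun l => σ l (h' l)) - β₀ h') + (β₀ h' - β₀ (Function.update h l k)) := by
      simp only [hD, label_update, e1, e2]
      rw [sub_add_sub_cancel, ← hk']
      congr 2
      · funext l'
        by_cases hl : l' = l
        · subst hl; simp [hh']
        · simp [Function.update_of_ne hl]
      · rw [hh', Function.update_idem]
    rw [e3]
    have h1 := hclose h'
    set x := β (fun l => σ l (h' l)) - β₀ h'
    set y := β₀ h' - β₀ (Function.update h l k)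
    have h2 : ‖y‖ ≤ ‖x + y‖ + ‖x‖ := by
      have := norm_sub_le (x + y) x
      rwa [add_sub_cancel_left] at this
    have h3 := pow_le_pow_left₀ (norm_nonneg _) h2 2
    nlinarith [sq_nonneg (‖x + y‖ - ‖x‖)]
  have hcmp := hmin (Function.update g l (Function.update (g l) i₀ (σ l k)))
  set g' := Function.update g l (Function.update (g l) i₀ (σ l k)) with hg'
  have hF := sum_update_eq l i₀
    (fun i => f i (D i) - f i (β (label g' i) - β₀ (label g₀ i))) (fun i hi => by
      have : label g' i = label g i := by
        funext l'
        by_cases hl : l' = l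
        · subst hl; simp [label, hg', Function.update_of_ne hi]
        · simp [label, hg', Function.update_of_ne hl]
      simp [this, hD])
  have hF0 : ∑ i, (f (Function.update i l i₀) (D (Function.update i l i₀))
      - f (Function.update i l i₀) (W i)) ≤ 0 := by
    have e : ∀ i, β (label g' (Function.update i l i₀)) - β₀ (label g₀ (Function.update i l i₀))
        = W i := fun i => by
      rw [hg', label_update_update, label_update, hW]
    simp only [e] at hF
    rw [hF, Finset.sum_sub_distrib]
    exact mul_nonpos_of_nonneg_of_nonpos hNl.le (by linarith)
  have hfin : ∑ i, ((a / 2 * ‖D (Function.update i l i₀)‖ ^ 2 - 2 * ρ ^ 2 / a)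
      - ((M + 1) * ‖W i‖ ^ 2 + ρ ^ 2)) ≤ 0 :=
    (Finset.sum_le_sum fun i _ => sub_le_sub (hlow' _ _) (hup' _ _)).trans hF0
  rw [Finset.sum_sub_distrib, Finset.sum_sub_distrib, Finset.sum_add_distrib, ← Finset.mul_sum,
    ← Finset.mul_sum, Finset.sum_const, Finset.sum_const, nsmul_eq_mul, nsmul_eq_mul, hcard] at hfin
  have h1 := mul_le_mul_of_nonneg_left hDsum (by positivity : 0 ≤ a / 2)
  have h2 := mul_le_mul_of_nonneg_left hWsum (by positivity : 0 ≤ M + 1)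
  have h3 := mul_lt_mul_of_pos_left hc₂ hn0
  linarith [mul_comm n (γ ^ q)]

end Recovery

end GTNAR

namespace GTNAR

namespace Model

universe u

variable {q : ℕ} {G : Fin q → ℕ} (S : Model.{u} G)

/-! ### The loss in terms of the deviations of the coefficients -/

/-- The linear predictor as a linear map of its coefficients. -/
noncomputable def predLin (t : ℕ) (i : S.Node) (ω : S.Ω) : S.Coef →ₗ[ℝ] ℝ where
  toFun v := S.predZ v t i ω
  map_add' v w := S.linPred_add v w _ _ i
  map_smul' c v := S.linPred_smul c v _ _ i

theorem predLin_apply (v : S.Coef) (t : ℕ) (i : S.Node) (ω : S.Ω) :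
    S.predLin t i ω v = S.predZ v t i ω := rfl

theorem predZ_add (v w : S.Coef) (t : ℕ) (i : S.Node) (ω : S.Ω) :
    S.predZ (v + w) t i ω = S.predZ v t i ω + S.predZ w t i ω := (S.predLin t i ω).map_add v w

theorem predZ_sub (v w : S.Coef) (t : ℕ) (i : S.Node) (ω : S.Ω) :
    S.predZ (v - w) t i ω = S.predZ v t i ω - S.predZ w t i ω := (S.predLin t i ω).map_sub v w

theorem predZ_smul (c : ℝ) (v : S.Coef) (t : ℕ) (i : S.Node) (ω : S.Ω) :
    S.predZ (c • v) t i ω = c * S.predZ v t i ω := (S.predLin t i ω).map_smul c v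

/-- The difference between the coefficients of the tensor entry `i` under the parameters `ξ` with
memberships `g` and its true coefficients. -/
noncomputable def deviation (ξ : Param G S.p) (g : Membership S.N G) (i : S.Node) : S.Coef :=
  S.coef ξ (label g i) - S.coef S.ξ₀ (label S.g₀ i)

theorem sum_Icc_one_eq (T : ℕ) (f : ℕ → ℝ) :
    ∑ t ∈ Finset.Icc 1 T, f t = ∑ t ∈ Finset.range T, f (t + 1) := by
  induction T with
  | zero => simp
  | succ T ih => rw [Finset.sum_Icc_succ_top (by omega), ih, Finset.sum_range_succ]

theorem ae_loss_eq {κ : ℝ} (hs : S.Stability κ) : ∀ᵐ ω ∂S.μ, ∀ ξ g, S.loss ξ g ω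
    = ∑ i, ∑ t ∈ Finset.range S.T, (S.εZ (t + 1) i ω - S.predZ (S.deviation ξ g i) t i ω) ^ 2 := by
  filter_upwards [S.equation, S.ae_predZ hs] with ω h1 h2 ξ g
  unfold loss
  refine Finset.sum_congr rfl fun i _ => ?_
  rw [sum_Icc_one_eq]
  refine Finset.sum_congr rfl fun t ht => ?_
  have ht' := Finset.mem_range.1 ht
  have hmem : t + 1 ∈ Finset.Icc 1 S.T := Finset.mem_Icc.2 ⟨by omega, ht'⟩
  have e1 : S.Y (t + 1) i ω = S.predZ (S.coef S.ξ₀ (label S.g₀ i)) t i ω + S.εZ (t + 1) i ω := by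
    have e3 : S.ε (t + 1) i ω = S.εZ (t + 1) i ω := by simp only [εZ, if_pos hmem]
    rw [h1 (t + 1) hmem i, ← h2 t ht' i, e3]
    exact congrArg (· + S.εZ (t + 1) i ω) (S.regression_eq S.ξ₀ S.g₀ _ _ i)
  have e2 : regression S.W ξ g (fun j => S.Y (t + 1 - 1) j ω) (fun l j => S.x l (t + 1) j ω) i
      = S.predZ (S.coef ξ (label g i)) t i ω := by
    rw [← h2 t ht' i]
    exact S.regression_eq ξ g _ _ i
  rw [e1, e2, deviation, predZ_sub]
  ring

/-- The outcomes for which, at every tensor entry, the empirical second moment of the regressors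
has its eigenvalues in `[a, M]` and their empirical covariance with the noise is at most `ρ`. -/
def goodEvent (a M ρ : ℝ) : Set S.Ω :=
  {ω | ∀ i (v : S.Coef),
    |∑ t ∈ Finset.range S.T, S.predZ v t i ω * S.εZ (t + 1) i ω| ≤ S.T * (ρ * ‖v‖) ∧
    S.T * (a * ‖v‖ ^ 2) ≤ ∑ t ∈ Finset.range S.T, S.predZ v t i ω ^ 2 ∧
    ∑ t ∈ Finset.range S.T, S.predZ v t i ω ^ 2 ≤ S.T * (M * ‖v‖ ^ 2)}

variable {S} in
/-- The gap between two groups is attained by the coefficients of entries in some other groups. -/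
theorem GroupGap.exists_le {c : ℝ} (h : S.GroupGap c) (hG : ∀ l, 0 < G l) (l : Fin q)
    {g₁ g₂ : Fin (G l)} (hg : g₁ ≠ g₂) : ∃ h : ∀ l, Fin (G l),
      c ≤ ‖S.coef S.ξ₀ (Function.update h l g₁) - S.coef S.ξ₀ (Function.update h l g₂)‖ ^ 2 := by
  have : Nonempty (∀ l, Fin (G l)) := ⟨fun l => ⟨0, hG l⟩⟩
  obtain ⟨h₀, hh₀⟩ := exists_eq_ciSup_of_finite (f := fun g : ∀ l, Fin (G l) =>
    |S.ξ₀.alpha (Function.update g l g₁) - S.ξ₀.alpha (Function.update g l g₂)| ^ 2)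
  refine ⟨h₀, (h l g₁ g₂ hg).trans ?_⟩
  rw [← hh₀, EuclideanSpace.norm_sq_eq, EuclideanSpace.norm_sq_eq, Fintype.sum_sum_type,
    Fintype.sum_sigma]
  simp only [Finset.univ_unique, Finset.sum_singleton, Real.norm_eq_abs, Fintype.sum_option]
  refine add_le_add ?_ (le_of_eq rfl)
  refine le_trans (le_of_eq ?_) (Finset.single_le_sum (fun l' _ => by positivity)
    (Finset.mem_univ l))
  congr 1
  · rw [sq_abs]; simp [coef]
  · refine Finset.sum_congr rfl fun k _ => ?_
    simp [coef]

theorem coef_relabel (π : ∀ l, Equiv.Perm (Fin (G l))) (ξ : Param G S.p) (h : ∀ l, Fin (G l)) :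
    S.coef (ξ.relabel π) h = S.coef ξ fun l => π l (h l) := by
  ext a
  rcases a with ⟨l, _ | k⟩ | _ <;> rfl

theorem param_ext_of_coef {ξ ξ' : Param G S.p} (hG : ∀ l, 0 < G l)
    (h : ∀ g, S.coef ξ g = S.coef ξ' g) : ξ = ξ' := by
  have h' : ∀ g a, S.coef ξ g a = S.coef ξ' g a := fun g a => by rw [h]
  set g₀ : ∀ l, Fin (G l) := fun l => ⟨0, hG l⟩
  refine Param.ext (funext fun l => funext fun k => ?_) (funext fun l => funext fun k => ?_)
    (funext fun g => h' g (.inr ()))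
  · simpa [coef] using h' (Function.update g₀ l k) (.inl ⟨l, none⟩)
  · ext b
    simpa [coef] using h' (Function.update g₀ l k) (.inl ⟨l, some b⟩)

/-- Strict convexity of the loss for the true memberships. -/
theorem oracle_unique {ω : S.Ω} {a M ρ : ℝ} (ha : 0 < a) (hT : 0 < S.T)
    (hG : ∀ l, 0 < G l) (hg₀ : ∀ l, Function.Surjective (S.g₀ l)) (hω : ω ∈ S.goodEvent a M ρ)
    (hloss : ∀ ξ g, S.loss ξ g ω = ∑ i, ∑ t ∈ Finset.range S.T,
      (S.εZ (t + 1) i ω - S.predZ (S.deviation ξ g i) t i ω) ^ 2)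
    {ξ ξ' : Param G S.p} (h : S.IsOracleEstimate ω ξ) (h' : S.IsOracleEstimate ω ξ') : ξ = ξ' := by
  set ξm : Param G S.p := ⟨fun l k => (ξ.lam l k + ξ'.lam l k) / 2,
    fun l k => (2 : ℝ)⁻¹ • (ξ.zeta l k + ξ'.zeta l k), fun k => (ξ.alpha k + ξ'.alpha k) / 2⟩
  have hm : ∀ i, S.deviation ξm S.g₀ i
      = (2 : ℝ)⁻¹ • (S.deviation ξ S.g₀ i + S.deviation ξ' S.g₀ i) := by
    intro i
    ext b
    rcases b with ⟨l, _ | k⟩ | _ <;> simp [deviation, coef, ξm] <;> ring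
  have e : ∀ i, S.deviation ξ S.g₀ i - S.deviation ξ' S.g₀ i
      = S.coef ξ (label S.g₀ i) - S.coef ξ' (label S.g₀ i) := fun i => by simp [deviation]
  have h0 : ∑ i, ∑ t ∈ Finset.range S.T,
      S.predZ (S.coef ξ (label S.g₀ i) - S.coef ξ' (label S.g₀ i)) t i ω ^ 2 ≤ 0 := by
    have h1 := h ξm
    have h2 := h' ξm
    have h3 : S.loss ξm S.g₀ ω = S.loss ξ S.g₀ ω / 2 + S.loss ξ' S.g₀ ω / 2
        - (∑ i, ∑ t ∈ Finset.range S.T,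
          S.predZ (S.coef ξ (label S.g₀ i) - S.coef ξ' (label S.g₀ i)) t i ω ^ 2) / 4 := by
      simp only [hloss, Finset.sum_div, ← Finset.sum_add_distrib, ← Finset.sum_sub_distrib]
      refine Finset.sum_congr rfl fun i _ => Finset.sum_congr rfl fun t _ => ?_
      rw [hm, ← e, predZ_smul, predZ_add, predZ_sub]
      ring
    linarith
  refine S.param_ext_of_coef hG fun k => ?_
  choose i hi using fun l => hg₀ l (k l)
  have hik : label S.g₀ i = k := funext hi
  have h1 := (Finset.single_le_sum (f := fun i => ∑ t ∈ Finset.range S.T,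
      S.predZ (S.coef ξ (label S.g₀ i) - S.coef ξ' (label S.g₀ i)) t i ω ^ 2)
    (fun _ _ => Finset.sum_nonneg fun _ _ => sq_nonneg _) (Finset.mem_univ i)).trans h0
  have h2 := (hω i (S.coef ξ (label S.g₀ i) - S.coef ξ' (label S.g₀ i))).2.1.trans h1
  rw [hik] at h2
  have hT' : (0 : ℝ) < S.T := by exact_mod_cast hT
  have h3 : ‖S.coef ξ k - S.coef ξ' k‖ ^ 2 ≤ 0 := by
    by_contra! hc
    have : 0 < (S.T : ℝ) * (a * ‖S.coef ξ k - S.coef ξ' k‖ ^ 2) := by positivity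
    linarith
  have h4 : ‖S.coef ξ k - S.coef ξ' k‖ = 0 := by
    have := sq_nonneg ‖S.coef ξ k - S.coef ξ' k‖
    exact pow_eq_zero_iff (two_ne_zero) |>.1 (le_antisymm h3 this)
  exact sub_eq_zero.1 (norm_eq_zero.1 h4)

/-- On the good event the estimate recovers the groups up to relabelling and agrees with the oracle
estimate. -/
theorem recovery_of_mem_goodEvent {ω : S.Ω} {a M ρ c γ cπ : ℝ} (ha : 0 < a) (hM : 0 < M)
    (hT : 0 < S.T) (hN : ∀ l, 0 < S.N l) (hω : ω ∈ S.goodEvent a M ρ)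
    (hloss : ∀ ξ g, S.loss ξ g ω = ∑ i, ∑ t ∈ Finset.range S.T,
      (S.εZ (t + 1) i ω - S.predZ (S.deviation ξ g i) t i ω) ^ 2)
    (hgap : S.GroupGap c) (hprop : S.GroupProportion cπ) (hcπ : 0 < cπ)
    (hγ : 0 < γ) (hγπ : ∀ l, γ * G l ≤ cπ)
    (hc₁ : 4 * (4 * ρ ^ 2 / a ^ 2 / γ ^ q) < c)
    (hc₂ : 2 * ρ ^ 2 / a + (M + 1) * (4 * ρ ^ 2 / a ^ 2 / γ) + ρ ^ 2
      < a / 2 * (γ ^ q * (c / 2 - 4 * ρ ^ 2 / a ^ 2 / γ ^ q)))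
    {ξ ξ' : Param G S.p} {g : Membership S.N G} (hest : S.IsEstimate ω ξ g)
    (hor : S.IsOracleEstimate ω ξ') :
    ∃ π : ∀ l, Equiv.Perm (Fin (G l)), (∀ l i, g l i = π l (S.g₀ l i)) ∧ ξ.relabel π = ξ' := by
  have hT' : (0 : ℝ) < S.T := by exact_mod_cast hT
  have hG : ∀ l, 0 < G l := fun l => Fin.pos (S.g₀ l ⟨0, hN l⟩)
  have hprop' : ∀ l k, cπ * S.N l ≤ ((Finset.univ.filter fun i => S.g₀ l i = k).card : ℝ) :=
    fun l k => (le_div_iff₀ (by exact_mod_cast hN l)).1 (hprop l k)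
  set f : S.Node → S.Coef → ℝ := fun i v => (S.T : ℝ)⁻¹ * (∑ t ∈ Finset.range S.T,
    S.predZ v t i ω ^ 2 - 2 * ∑ t ∈ Finset.range S.T, S.predZ v t i ω * S.εZ (t + 1) i ω) with hf
  have hlf : ∀ ξ g, S.loss ξ g ω = S.T * ∑ i, f i (S.deviation ξ g i)
      + ∑ i, ∑ t ∈ Finset.range S.T, S.εZ (t + 1) i ω ^ 2 := by
    intro ξ g
    rw [hloss, Finset.mul_sum, ← Finset.sum_add_distrib]
    refine Finset.sum_congr rfl fun i _ => ?_
    rw [hf, mul_inv_cancel_left₀ hT'.ne', Finset.mul_sum, ← Finset.sum_sub_distrib,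
      ← Finset.sum_add_distrib]
    exact Finset.sum_congr rfl fun t _ => by ring
  have hcmp : ∀ ξ' g', ∑ i, f i (S.deviation ξ g i) ≤ ∑ i, f i (S.deviation ξ' g' i) := by
    intro ξ' g'
    have h1 := hest ξ' g'
    rw [hlf, hlf] at h1
    exact le_of_mul_le_mul_left (by linarith) hT'
  have hlow : ∀ i v, a * ‖v‖ ^ 2 - 2 * ρ * ‖v‖ ≤ f i v := fun i v => by
    obtain ⟨h1, h2, _⟩ := hω i v
    rw [hf, ← mul_le_mul_iff_right₀ hT', mul_inv_cancel_left₀ hT'.ne']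
    have := (abs_le.1 h1).2
    linarith
  have hup : ∀ i v, f i v ≤ M * ‖v‖ ^ 2 + 2 * ρ * ‖v‖ := fun i v => by
    obtain ⟨h1, _, h3⟩ := hω i v
    rw [hf, ← mul_le_mul_iff_right₀ hT', mul_inv_cancel_left₀ hT'.ne']
    have := (abs_le.1 h1).1
    linarith
  have hmin₀ : ∑ i, f i (S.deviation ξ g i) ≤ 0 := by
    refine (hcmp S.ξ₀ S.g₀).trans (le_of_eq (Finset.sum_eq_zero fun i _ => ?_))
    have h0 : ∀ t, S.predZ (0 : S.Coef) t i ω = 0 := fun t => (S.predLin t i ω).map_zero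
    simp [hf, deviation, h0]
  obtain ⟨π, hπ⟩ := exists_perm_of_minimizer (β := S.coef ξ) (β₀ := S.coef S.ξ₀) (f := f)
    (g := g) (g₀ := S.g₀) ha hM hγ hlow hup hN hmin₀ (fun g' => hcmp ξ g')
    (fun l g₁ g₂ hne => hgap.exists_le hG l hne) hprop' hγπ hc₁ hc₂
  refine ⟨π, hπ, S.oracle_unique ha hT hG (fun l k => ?_) hω hloss (fun ξ'' => ?_) hor⟩
  · have h1 : (0 : ℝ) < ((Finset.univ.filter fun i => S.g₀ l i = k).card : ℝ) :=
      lt_of_lt_of_le (mul_pos hcπ (by exact_mod_cast hN l)) (hprop' l k)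
    obtain ⟨i, hi⟩ := Finset.card_pos.1 (by exact_mod_cast h1)
    exact ⟨i, (Finset.mem_filter.1 hi).2⟩
  · have e : S.loss (ξ.relabel π) S.g₀ ω = S.loss ξ g ω := by
      rw [hloss, hloss]
      refine Finset.sum_congr rfl fun i _ => ?_
      rw [deviation, deviation, coef_relabel]
      have : (fun l => π l (label S.g₀ i l)) = label g i := funext fun l => (hπ l (i l)).symm
      rw [this]
    rw [e]
    exact hest ξ'' S.g₀

end Model

/-! ### Discretization of linear and bilinear forms -/

/-- The unit ball of a space of dimension `d` has a `1 / 2`-net of at most `5 ^ d` points. -/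
theorem exists_net (E : Type*) [NormedAddCommGroup E] [NormedSpace ℝ E] [FiniteDimensional ℝ E] :
    ∃ s : Finset E, s.card ≤ 5 ^ Module.finrank ℝ E ∧ (∀ c ∈ s, ‖c‖ ≤ 1) ∧
      ∀ v : E, ‖v‖ ≤ 1 → ∃ c ∈ s, ‖v - c‖ ≤ 1 / 2 := by
  classical
  -- a maximal separated set, found by adding points as long as this is possible
  by_contra! hcon
  have key : ∀ n : ℕ, ∃ s : Finset E, s.card = n ∧ (∀ c ∈ s, ‖c‖ ≤ 2) ∧
      ∀ c ∈ s, ∀ d ∈ s, c ≠ d → 1 ≤ ‖c - d‖ := by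
    intro n
    induction n with
    | zero => exact ⟨∅, by simp⟩
    | succ n ih =>
      obtain ⟨s, hsn, hs2, hs⟩ := ih
      obtain ⟨v, hv, hvs⟩ := hcon (s.image fun c => (2 : ℝ)⁻¹ • c)
        (Finset.card_image_le.trans (Besicovitch.card_le_of_separated s hs2 hs)) (fun c hc => by
          obtain ⟨d, hd, rfl⟩ := Finset.mem_image.1 hc
          rw [norm_smul]
          have := hs2 d hd
          norm_num
          linarith)
      have hfar : ∀ c ∈ s, 1 ≤ ‖(2 : ℝ) • v - c‖ := by
        intro c hc
        have h1 := hvs _ (Finset.mem_image_of_mem _ hc)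
        have e : (2 : ℝ) • v - c = (2 : ℝ) • (v - (2 : ℝ)⁻¹ • c) := by
          rw [smul_sub, smul_inv_smul₀ two_ne_zero]
        rw [e, norm_smul]
        norm_num
        linarith
      have hnot : (2 : ℝ) • v ∉ s := fun hmem => by
        have := hfar _ hmem
        simp at this
        linarith
      refine ⟨insert ((2 : ℝ) • v) s, by rw [Finset.card_insert_of_notMem hnot, hsn], ?_, ?_⟩
      · intro c hc
        rcases Finset.mem_insert.1 hc with rfl | hc
        · rw [norm_smul]; norm_num; linarith
        · exact hs2 c hc
      · intro c hc d hd hcd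
        rcases Finset.mem_insert.1 hc with rfl | hc <;> rcases Finset.mem_insert.1 hd with rfl | hd
        · exact absurd rfl hcd
        · exact hfar d hd
        · rw [norm_sub_rev]; exact hfar c hc
        · exact hs c hc d hd hcd
  obtain ⟨s, hsn, hs2, hs⟩ := key (5 ^ Module.finrank ℝ E + 1)
  have := Besicovitch.card_le_of_separated s hs2 hs
  omega

section Net

variable {E : Type*} [NormedAddCommGroup E] [NormedSpace ℝ E] [FiniteDimensional ℝ E]

theorem abs_le_of_net {s : Finset E} (hs : ∀ v : E, ‖v‖ ≤ 1 → ∃ c ∈ s, ‖v - c‖ ≤ 1 / 2)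
    (f : E →ₗ[ℝ] ℝ) {δ : ℝ} (hf : ∀ c ∈ s, |f c| ≤ δ) (v : E) : |f v| ≤ 2 * δ * ‖v‖ := by
  set F : E →L[ℝ] ℝ := LinearMap.toContinuousLinearMap f
  have hδ : 0 ≤ δ := by
    obtain ⟨c, hc, _⟩ := hs 0 (by simp)
    exact (abs_nonneg _).trans (hf c hc)
  have h1 : ‖F‖ ≤ δ + ‖F‖ * (1 / 2) := by
    refine ContinuousLinearMap.opNorm_le_of_unit_norm (by positivity) fun x hx => ?_
    obtain ⟨c, hc, hxc⟩ := hs x hx.le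
    have h2 : F x = f c + F (x - c) := by simp [F]
    rw [h2]
    refine (norm_add_le _ _).trans (add_le_add (hf c hc) ?_)
    exact (F.le_opNorm _).trans (mul_le_mul_of_nonneg_left hxc (norm_nonneg _))
  exact (F.le_opNorm v).trans (mul_le_mul_of_nonneg_right (by linarith) (norm_nonneg _))

theorem abs_bilin_le_of_net {s : Finset E} (hs : ∀ v : E, ‖v‖ ≤ 1 → ∃ c ∈ s, ‖v - c‖ ≤ 1 / 2)
    (B : E →ₗ[ℝ] E →ₗ[ℝ] ℝ) {δ : ℝ} (hB : ∀ c ∈ s, ∀ d ∈ s, |B c d| ≤ δ) (v w : E) :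
    |B v w| ≤ 4 * δ * ‖v‖ * ‖w‖ := by
  have h := abs_le_of_net hs (B.flip w) (δ := 2 * δ * ‖w‖)
    (fun c hc => abs_le_of_net hs (B c) (hB c hc) w) v
  rw [LinearMap.flip_apply] at h
  linarith

end Net

end GTNAR

namespace GTNAR

namespace Model

universe u

variable {q : ℕ} {G : Fin q → ℕ} (S : Model.{u} G)

/-! ### The probability of the good event -/

theorem measurable_predZ (v : S.Coef) (t : ℕ) (i : S.Node) : Measurable (S.predZ v t i) :=
  (S.measurable_past_predZ v t i).mono (S.past_le t) le_rfl

theorem predZ_eq_norm_mul (v : S.Coef) (t : ℕ) (i : S.Node) (ω : S.Ω) :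
    S.predZ v t i ω = ‖v‖ * S.predZ (‖v‖⁻¹ • v) t i ω := by
  rw [predZ_smul, ← mul_assoc]
  by_cases hv : v = 0
  · subst hv
    have h0 : S.predZ (0 : S.Coef) t i ω = 0 := (S.predLin t i ω).map_zero
    simp [h0]
  · rw [mul_inv_cancel₀ (norm_ne_zero_iff.2 hv), one_mul]

theorem norm_inv_smul_le {E : Type*} [NormedAddCommGroup E] [NormedSpace ℝ E] (v : E) :
    ‖‖v‖⁻¹ • v‖ ≤ 1 := by
  rw [norm_smul, norm_inv, norm_norm]
  exact inv_mul_le_one_of_le₀ le_rfl (norm_nonneg _)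

section Bounds

variable {S} {C τ : ℝ}

theorem memLp_predZ (hC : 0 < C)
    (hG : ∀ i (v : S.Coef), ‖v‖ ≤ 1 → ∀ t, SubG S.μ C (S.predZ v t i))
    (v : S.Coef) (t : ℕ) (i : S.Node) : MemLp (S.predZ v t i) 2 S.μ := by
  rw [funext (S.predZ_eq_norm_mul v t i)]
  exact ((hG i _ (norm_inv_smul_le v) t).memLp_two hC).const_mul _

theorem integrable_predZ_mul (hC : 0 < C)
    (hG : ∀ i (v : S.Coef), ‖v‖ ≤ 1 → ∀ t, SubG S.μ C (S.predZ v t i))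
    (v w : S.Coef) (t : ℕ) (i : S.Node) :
    Integrable (fun ω => S.predZ v t i ω * S.predZ w t i ω) S.μ :=
  (memLp_predZ hC hG v t i).integrable_mul (memLp_predZ hC hG w t i)

theorem integrable_predZ_sq (hC : 0 < C)
    (hG : ∀ i (v : S.Coef), ‖v‖ ≤ 1 → ∀ t, SubG S.μ C (S.predZ v t i))
    (v : S.Coef) (t : ℕ) (i : S.Node) : Integrable (fun ω => S.predZ v t i ω ^ 2) S.μ :=
  (memLp_predZ hC hG v t i).integrable_sq

theorem integral_sum_predZ_sq_le (hC : 0 < C)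
    (hG : ∀ i (v : S.Coef), ‖v‖ ≤ 1 → ∀ t, SubG S.μ C (S.predZ v t i)) (v : S.Coef) (i : S.Node) :
    ∫ ω, ∑ t ∈ Finset.range S.T, S.predZ v t i ω ^ 2 ∂S.μ ≤ S.T * (C ^ 2 * ‖v‖ ^ 2) := by
  rw [integral_finsetSum _ fun t _ => integrable_predZ_sq hC hG v t i]
  refine (Finset.sum_le_card_nsmul _ _ (C ^ 2 * ‖v‖ ^ 2) fun t _ => ?_).trans
    (le_of_eq (by rw [Finset.card_range, nsmul_eq_mul]))
  simp_rw [S.predZ_eq_norm_mul v t i, mul_pow]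
  rw [integral_const_mul, mul_comm (C ^ 2)]
  exact mul_le_mul_of_nonneg_left ((hG i _ (norm_inv_smul_le v) t).integral_sq_le hC)
    (by positivity)

theorem integral_predZ_sq {κ : ℝ} (hs : S.Stability κ) (hC : 0 < C)
    (hG : ∀ i (v : S.Coef), ‖v‖ ≤ 1 → ∀ t, SubG S.μ C (S.predZ v t i)) (v : S.Coef) {t : ℕ}
    (ht : t < S.T) (i : S.Node) : ∫ ω, S.predZ v t i ω ^ 2 ∂S.μ
      = v.ofLp ⬝ᵥ (S.secondMoment (t + 1) i).mulVec v.ofLp := by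
  have hae := S.ae_predZ hs
  have hreg : ∀ a, S.predZ (EuclideanSpace.single a 1) t i =ᵐ[S.μ] fun ω =>
      S.regressor (t + 1) i ω a := fun a => by
    filter_upwards [hae] with ω h
    rw [← h t ht, linPred_eq_sum_regressor]
    simp
  have hint : ∀ a b, Integrable (fun ω =>
      S.regressor (t + 1) i ω a * S.regressor (t + 1) i ω b) S.μ := fun a b => by
    refine (integrable_predZ_mul hC hG (EuclideanSpace.single a 1) (EuclideanSpace.single b 1)
      t i).congr ?_
    filter_upwards [hreg a, hreg b] with ω h1 h2
    rw [h1, h2]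
  have e : ∫ ω, S.predZ v t i ω ^ 2 ∂S.μ = ∫ ω, ∑ a, ∑ b, v a * (v b *
      (S.regressor (t + 1) i ω a * S.regressor (t + 1) i ω b)) ∂S.μ := by
    refine integral_congr_ae ?_
    filter_upwards [hae] with ω h
    rw [← h t ht, linPred_eq_sum_regressor, sq, Finset.sum_mul_sum]
    exact Finset.sum_congr rfl fun a _ => Finset.sum_congr rfl fun b _ => by ring
  rw [e, integral_finsetSum _ fun a _ => integrable_finsetSum _ fun b _ =>
    ((hint a b).const_mul _).const_mul _]
  simp only [dotProduct, Matrix.mulVec, Finset.mul_sum]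
  refine Finset.sum_congr rfl fun a _ => ?_
  rw [integral_finsetSum _ fun b _ => ((hint a b).const_mul _).const_mul _]
  refine Finset.sum_congr rfl fun b _ => ?_
  rw [integral_const_mul, integral_const_mul, secondMoment, mul_comm (v b)]

theorem le_integral_sum_predZ_sq {κ : ℝ} (hs : S.Stability κ) (hC : 0 < C)
    (hG : ∀ i (v : S.Coef), ‖v‖ ≤ 1 → ∀ t, SubG S.μ C (S.predZ v t i)) (hτ : S.Convexity τ)
    (hT : 0 < S.T) (v : S.Coef) (i : S.Node) :
    S.T * (τ * ‖v‖ ^ 2) ≤ ∫ ω, ∑ t ∈ Finset.range S.T, S.predZ v t i ω ^ 2 ∂S.μ := by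
  have hT' : (0 : ℝ) < S.T := by exact_mod_cast hT
  rw [integral_finsetSum _ fun t _ => integrable_predZ_sq hC hG v t i,
    Finset.sum_congr rfl fun t ht => integral_predZ_sq hs hC hG v (Finset.mem_range.1 ht) i]
  have h := hτ i v.ofLp
  rw [Matrix.smul_mulVec, dotProduct_smul, Matrix.sum_mulVec, dotProduct_sum, sum_Icc_one_eq,
    smul_eq_mul] at h
  have h1 := mul_le_mul_of_nonneg_left h hT'.le
  rw [mul_inv_cancel_left₀ hT'.ne'] at h1
  refine le_trans (le_of_eq ?_) h1
  rw [EuclideanSpace.norm_sq_eq]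
  simp [dotProduct, sq]

/-- The noise is centred and independent of the past, which determines the predictor. -/
theorem integral_sum_predZ_mul_noise {σ : ℝ≥0} (hσ : 0 < σ) (hn : S.SubGaussianNoise σ)
    (hC : 0 < C) (hG : ∀ i (v : S.Coef), ‖v‖ ≤ 1 → ∀ t, SubG S.μ C (S.predZ v t i))
    (v : S.Coef) (i : S.Node) :
    ∫ ω, ∑ t ∈ Finset.range S.T, S.predZ v t i ω * S.εZ (t + 1) i ω ∂S.μ = 0 := by
  have hε : ∀ t, MemLp (S.εZ t i) 2 S.μ := fun t =>
    ((S.innovations hσ hn).subG t i).memLp_two (by positivity)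
  have hi : ∀ t, Integrable (fun ω => S.predZ v t i ω * S.εZ (t + 1) i ω) S.μ := fun t =>
    (memLp_predZ hC hG v t i).integrable_mul (hε (t + 1))
  rw [integral_finsetSum _ fun t _ => hi t]
  refine Finset.sum_eq_zero fun t ht => ?_
  have hmem : t + 1 ∈ Finset.Icc 1 S.T :=
    Finset.mem_Icc.2 ⟨by omega, Finset.mem_range.1 ht⟩
  have hind : IndepFun (S.predZ v t i) (S.εZ (t + 1) i) S.μ := by
    rw [IndepFun_iff_Indep]
    refine indep_of_indep_of_le_left (indep_of_indep_of_le_right (S.indep_past hn t).symm ?_)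
      (S.measurable_past_predZ v t i).comap_le
    exact Measurable.comap_le ((measurable_pi_apply i).comp
      (comap_measurable (m := MeasurableSpace.pi) (fun ω i => S.εZ (t + 1) i ω)))
  have h0 : ∫ ω, S.εZ (t + 1) i ω ∂S.μ = 0 := by
    have := hn.mean (⟨t + 1, hmem⟩, i)
    simpa only [εZ, if_pos hmem] using this
  have := hind.integral_fun_mul_eq_mul_integral
    (S.measurable_predZ v t i).aestronglyMeasurable (S.measurable_εZ (t + 1) i).aestronglyMeasurable
  rw [this, h0, mul_zero]

/-- Concentration of mixed second moments, by polarization. -/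
theorem subExp_sum_predZ_mul (hC : 0 < C) (hT : 0 < S.T)
    (hQ : ∀ i (v : S.Coef), ‖v‖ ≤ 1 →
      SubExp S.μ (C * √S.T) (fun ω => ∑ t ∈ Finset.range S.T, S.predZ v t i ω ^ 2))
    (i : S.Node) {v w : S.Coef} (hv : ‖v‖ ≤ 1) (hw : ‖w‖ ≤ 1) :
    SubExp S.μ (2 * C * √S.T)
      (fun ω => ∑ t ∈ Finset.range S.T, S.predZ v t i ω * S.predZ w t i ω) := by
  have hT' : (0 : ℝ) < S.T := by exact_mod_cast hT
  have hL : 0 < C * √S.T := by positivity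
  have h1 : ‖(2 : ℝ)⁻¹ • (v + w)‖ ≤ 1 := by
    rw [norm_smul]
    have := norm_add_le v w
    norm_num
    linarith
  have h2 : ‖(2 : ℝ)⁻¹ • (v - w)‖ ≤ 1 := by
    rw [norm_smul]
    have := norm_sub_le v w
    norm_num
    linarith
  have h := (hQ i _ h1).add ((hQ i _ h2).const_mul hL one_pos (a := -1) (by simp)) hL
    (by positivity)
  convert h using 1
  · ring
  · funext ω
    rw [neg_one_mul, ← sub_eq_add_neg, ← Finset.sum_sub_distrib]
    refine Finset.sum_congr rfl fun t _ => ?_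
    rw [predZ_smul, predZ_smul, predZ_add, predZ_sub]
    ring

/-- The error of the empirical second moments as a bilinear form. -/
noncomputable def momentError (hC : 0 < C)
    (hG : ∀ i (v : S.Coef), ‖v‖ ≤ 1 → ∀ t, SubG S.μ C (S.predZ v t i)) (i : S.Node) (ω : S.Ω) :
    S.Coef →ₗ[ℝ] S.Coef →ₗ[ℝ] ℝ :=
  have hi : ∀ v w, Integrable (fun ω => ∑ t ∈ Finset.range S.T,
      S.predZ v t i ω * S.predZ w t i ω) S.μ := fun v w =>
    integrable_finsetSum _ fun t _ => integrable_predZ_mul hC hG v w t i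
  LinearMap.mk₂ ℝ (fun v w => ∑ t ∈ Finset.range S.T, S.predZ v t i ω * S.predZ w t i ω
      - ∫ ω, ∑ t ∈ Finset.range S.T, S.predZ v t i ω * S.predZ w t i ω ∂S.μ)
    (fun v v' w => by
      simp only [predZ_add, add_mul, Finset.sum_add_distrib]
      rw [integral_add (hi v w) (hi v' w)]
      ring)
    (fun c v w => by
      simp only [predZ_smul, mul_assoc, ← Finset.mul_sum, integral_const_mul, smul_eq_mul]
      ring)
    (fun v w w' => by
      simp only [predZ_add, mul_add, Finset.sum_add_distrib]
      rw [integral_add (hi v w) (hi v w')]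
      ring)
    (fun c v w => by
      simp only [predZ_smul, mul_left_comm _ c, ← Finset.mul_sum, integral_const_mul, smul_eq_mul]
      ring)

theorem finrank_coef : Module.finrank ℝ S.Coef = S.m := by
  simp [finrank_euclideanSpace, m]

/-- Union bound over the tensor entries and a net of coefficient vectors. -/
theorem measure_compl_goodEvent_le {σ : ℝ≥0} {κ ρ : ℝ} (hσ : 0 < σ) (hn : S.SubGaussianNoise σ)
    (hs : S.Stability κ) (hτ : S.Convexity τ) (hT : 0 < S.T) (hC : 0 < C)
    (hconc : ∀ i (v : S.Coef), ‖v‖ ≤ 1 → (∀ t, SubG S.μ C (S.predZ v t i)) ∧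
      SubExp S.μ (C * √S.T) (fun ω => ∑ t ∈ Finset.range S.T, S.predZ v t i ω ^ 2) ∧
      SubExp S.μ (C * √S.T)
        (fun ω => ∑ t ∈ Finset.range S.T, S.predZ v t i ω * S.εZ (t + 1) i ω)) :
    S.μ (S.goodEvent (τ / 2) (C ^ 2 + τ / 2) ρ)ᶜ ≤ Fintype.card S.Node *
      ((5 ^ S.m : ℕ) * ENNReal.ofReal (6 * Real.exp (-(√S.T * (ρ / (2 * C)))))
        + (5 ^ S.m : ℕ) * ((5 ^ S.m : ℕ) *
          ENNReal.ofReal (6 * Real.exp (-(√S.T * (τ / (16 * C))))))) := by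
  have hG : ∀ i (v : S.Coef), ‖v‖ ≤ 1 → ∀ t, SubG S.μ C (S.predZ v t i) := fun i v hv =>
    (hconc i v hv).1
  have hT' : (0 : ℝ) < S.T := by exact_mod_cast hT
  have hsq : √(S.T : ℝ) * √S.T = S.T := Real.mul_self_sqrt hT'.le
  have hL : 0 < C * √S.T := by positivity
  obtain ⟨s, hcard, hs1, hnet⟩ := exists_net S.Coef
  rw [finrank_coef] at hcard
  have hcard' : (s.card : ℝ≥0∞) ≤ (5 ^ S.m : ℕ) := by exact_mod_cast hcard
  set A : S.Node → S.Coef → Set S.Ω := fun i c => {ω | S.T * (ρ / 2)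
    ≤ |∑ t ∈ Finset.range S.T, S.predZ c t i ω * S.εZ (t + 1) i ω|} with hA
  set B : S.Node → S.Coef → S.Coef → Set S.Ω := fun i c d => {ω | S.T * (τ / 8)
    ≤ |∑ t ∈ Finset.range S.T, S.predZ c t i ω * S.predZ d t i ω
      - ∫ ω, ∑ t ∈ Finset.range S.T, S.predZ c t i ω * S.predZ d t i ω ∂S.μ|} with hB
  have hsub : (S.goodEvent (τ / 2) (C ^ 2 + τ / 2) ρ)ᶜ
      ⊆ ⋃ i, ((⋃ c ∈ s, A i c) ∪ ⋃ c ∈ s, ⋃ d ∈ s, B i c d) := by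
    intro ω hω
    by_contra hcon
    refine hω fun i v => ?_
    simp only [Set.mem_iUnion, Set.mem_union, not_exists, not_or, hA, hB, Set.mem_ofPred_eq,
      not_le] at hcon
    have h1 := abs_le_of_net hnet (∑ t ∈ Finset.range S.T, S.εZ (t + 1) i ω • S.predLin t i ω)
      (δ := S.T * (ρ / 2)) (fun c hc => by
        have := ((hcon i).1 c hc).le
        simpa [predLin_apply, mul_comm] using this) v
    have h2 := abs_bilin_le_of_net hnet (momentError hC hG i ω) (δ := S.T * (τ / 8))
      (fun c hc d hd => ((hcon i).2 c hc d hd).le) v v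
    have h3 : momentError hC hG i ω v v = ∑ t ∈ Finset.range S.T, S.predZ v t i ω ^ 2
        - ∫ ω, ∑ t ∈ Finset.range S.T, S.predZ v t i ω ^ 2 ∂S.μ := by
      simp only [momentError, LinearMap.mk₂_apply, sq]
    rw [h3] at h2
    have h4 := integral_sum_predZ_sq_le hC hG v i
    have h5 := le_integral_sum_predZ_sq hs hC hG hτ hT v i
    have h6 := abs_le.1 h2
    refine ⟨?_, ?_, ?_⟩
    · refine le_trans (le_of_eq ?_) (h1.trans (le_of_eq (by ring)))
      simp [predLin_apply, mul_comm]
    · nlinarith [h6.1]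
    · nlinarith [h6.2]
  have hμA : ∀ i, ∀ c ∈ s, S.μ (A i c)
      ≤ ENNReal.ofReal (6 * Real.exp (-(√S.T * (ρ / (2 * C))))) := fun i c hc => by
    have h := ((hconc i c (hs1 c hc)).2.2).measure_le hL (S.T * (ρ / 2))
    rw [integral_sum_predZ_mul_noise hσ hn hC hG] at h
    simp only [sub_zero] at h
    have e : (S.T : ℝ) * (ρ / 2) / (C * √S.T) = √S.T * (ρ / (2 * C)) := by
      rw [div_eq_iff hL.ne']
      calc (S.T : ℝ) * (ρ / 2) = √S.T * √S.T * (ρ / 2) := by rw [hsq]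
        _ = _ := by field_simp
    rwa [e] at h
  have hμB : ∀ i, ∀ c ∈ s, ∀ d ∈ s, S.μ (B i c d)
      ≤ ENNReal.ofReal (6 * Real.exp (-(√S.T * (τ / (16 * C))))) := fun i c hc d hd => by
    have h := (subExp_sum_predZ_mul hC hT (fun i v hv => (hconc i v hv).2.1) i (hs1 c hc)
      (hs1 d hd)).measure_le (by positivity) (S.T * (τ / 8))
    have e : (S.T : ℝ) * (τ / 8) / (2 * C * √S.T) = √S.T * (τ / (16 * C)) := by
      rw [div_eq_iff (by positivity)]
      calc (S.T : ℝ) * (τ / 8) = √S.T * √S.T * (τ / 8) := by rw [hsq]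
        _ = _ := by field_simp; ring
    rwa [e] at h
  refine (measure_mono hsub).trans ((measure_iUnion_fintype_le _ _).trans ?_)
  rw [← Finset.card_univ, ← nsmul_eq_mul (Finset.univ : Finset S.Node).card]
  refine Finset.sum_le_card_nsmul _ _ _ fun i _ => (measure_union_le _ _).trans (add_le_add ?_ ?_)
  · refine (measure_biUnion_finset_le _ _).trans ((Finset.sum_le_card_nsmul _ _ _ (hμA i)).trans ?_)
    rw [nsmul_eq_mul]
    gcongr
  · refine (measure_biUnion_finset_le _ _).trans ((Finset.sum_le_card_nsmul _ _
      ((5 ^ S.m : ℕ) * ENNReal.ofReal (6 * Real.exp (-(√S.T * (τ / (16 * C))))))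
      fun c hc => ?_).trans ?_)
    · refine (measure_biUnion_finset_le _ _).trans
        ((Finset.sum_le_card_nsmul _ _ _ (hμB i c hc)).trans ?_)
      rw [nsmul_eq_mul]
      gcongr
    · rw [nsmul_eq_mul]
      gcongr

end Bounds

end Model

end GTNAR

namespace GTNAR

/-! ### Choice of the constants and passage to the limit -/

/-- A linear error bound `ρ = r c`, with `r` small, meets the requirements of the recovery of groups
with gap `c`, since then `ρ ^ 2` is small compared with `c`. -/
theorem exists_errorFactor (q : ℕ) {a M γ C : ℝ} (ha : 0 < a) (hM : 0 < M) (hγ : 0 < γ)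
    (hC : 0 < C) :
    ∃ r : ℝ, 0 < r ∧ ∀ c, 0 < c → c ≤ C →
      4 * (4 * (r * c) ^ 2 / a ^ 2 / γ ^ q) < c ∧
      2 * (r * c) ^ 2 / a + (M + 1) * (4 * (r * c) ^ 2 / a ^ 2 / γ) + (r * c) ^ 2
        < a / 2 * (γ ^ q * (c / 2 - 4 * (r * c) ^ 2 / a ^ 2 / γ ^ q)) := by
  obtain ⟨k₁, hk₁⟩ : ∃ x, x = 16 / a ^ 2 / γ ^ q := ⟨_, rfl⟩
  obtain ⟨k₂, hk₂⟩ : ∃ x, x = 2 / a + (M + 1) * (4 / a ^ 2 / γ) + 1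
    + a / 2 * (γ ^ q * (4 / a ^ 2 / γ ^ q)) := ⟨_, rfl⟩
  obtain ⟨k₃, hk₃⟩ : ∃ x, x = a / 2 * γ ^ q / 2 := ⟨_, rfl⟩
  have h₁ : 0 < k₁ := by rw [hk₁]; positivity
  have h₂ : 0 < k₂ := by rw [hk₂]; positivity
  have h₃ : 0 < k₃ := by rw [hk₃]; positivity
  set D := 1 + C * (k₁ + k₂ / k₃) with hD
  have hD1 : 1 ≤ D := by
    have : 0 ≤ C * (k₁ + k₂ / k₃) := by positivity
    linarith
  have hD0 : 0 < D := by linarith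
  refine ⟨D⁻¹, by positivity, fun c hc hcC => ?_⟩
  have hsq : (D⁻¹ * c) ^ 2 ≤ D⁻¹ * (C * c) := by
    have h1 : (D⁻¹) ^ 2 ≤ D⁻¹ := by
      rw [sq]; exact mul_le_of_le_one_left (by positivity) (inv_le_one_of_one_le₀ hD1)
    have h2 : c ^ 2 ≤ C * c := by rw [sq]; exact mul_le_mul_of_nonneg_right hcC hc.le
    rw [mul_pow]
    exact mul_le_mul h1 h2 (by positivity) (by positivity)
  -- `k₁` and `k₂ / k₃` are the factors of `ρ ^ 2` which have to be compared with `c`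
  have hlt : D⁻¹ * (C * (k₁ + k₂ / k₃)) < 1 := by
    rw [inv_mul_lt_one₀ hD0]; linarith
  have e : k₂ / k₃ * k₃ = k₂ := div_mul_cancel₀ _ h₃.ne'
  constructor
  · have h : (D⁻¹ * c) ^ 2 * k₁ < c := by
      have h4 : D⁻¹ * (C * k₁) < 1 := lt_of_le_of_lt (by gcongr; linarith [div_pos h₂ h₃]) hlt
      have := mul_le_mul_of_nonneg_right hsq h₁.le
      nlinarith
    refine lt_of_eq_of_lt ?_ h
    rw [hk₁]; ring
  · have h : (D⁻¹ * c) ^ 2 * k₂ < k₃ * c := by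
      have h4 : D⁻¹ * (C * (k₂ / k₃)) < 1 := lt_of_le_of_lt (by gcongr; linarith) hlt
      have h5 := mul_le_mul_of_nonneg_right hsq h₂.le
      have h6 := mul_lt_mul_of_pos_right h4 (mul_pos h₃ hc)
      have h7 : D⁻¹ * (C * c) * k₂ = D⁻¹ * (C * (k₂ / k₃)) * (k₃ * c) := by
        rw [← e]; field_simp
      linarith
    have e1 : 2 * (D⁻¹ * c) ^ 2 / a + (M + 1) * (4 * (D⁻¹ * c) ^ 2 / a ^ 2 / γ) + (D⁻¹ * c) ^ 2
        = (D⁻¹ * c) ^ 2 * k₂ - (D⁻¹ * c) ^ 2 * (a / 2 * (γ ^ q * (4 / a ^ 2 / γ ^ q))) := by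
      rw [hk₂]; ring
    have e2 : a / 2 * (γ ^ q * (c / 2 - 4 * (D⁻¹ * c) ^ 2 / a ^ 2 / γ ^ q))
        = k₃ * c - (D⁻¹ * c) ^ 2 * (a / 2 * (γ ^ q * (4 / a ^ 2 / γ ^ q))) := by
      rw [hk₃]; ring
    linarith

/-- The union bound over `P` tensor entries and nets of `5 ^ m` points is dominated by the
exponential tails. -/
theorem union_bound_le {P m : ℕ} {L x y R δ : ℝ} (hP : (P : ℝ) = Real.exp L) (hL : 0 ≤ L)
    (hm : 1 ≤ m)
    (hR : 4 ≤ δ * R) (hx : δ * R * (L + m) ≤ x) (hy : δ * R * (L + m) ≤ y) :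
    (P : ℝ≥0∞) * ((5 ^ m : ℕ) * ENNReal.ofReal (6 * Real.exp (-x))
        + (5 ^ m : ℕ) * ((5 ^ m : ℕ) * ENNReal.ofReal (6 * Real.exp (-y))))
      ≤ ENNReal.ofReal (12 * Real.exp (-(δ * R - 4))) := by
  have hm' : (1 : ℝ) ≤ m := by exact_mod_cast hm
  rw [← ENNReal.ofReal_natCast, ← ENNReal.ofReal_natCast (5 ^ m),
    ← ENNReal.ofReal_mul (by positivity), ← ENNReal.ofReal_mul (by positivity),
    ← ENNReal.ofReal_mul (by positivity), ← ENNReal.ofReal_add (by positivity) (by positivity),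
    ← ENNReal.ofReal_mul (by positivity)]
  refine ENNReal.ofReal_le_ofReal ?_
  set z := δ * R * (L + m)
  have h5 : (5 : ℝ) ≤ Real.exp 2 := by
    have := Real.exp_one_gt_d9
    have e : Real.exp 2 = Real.exp 1 * Real.exp 1 := by rw [← Real.exp_add]; norm_num
    rw [e]; nlinarith
  have hF : ((5 ^ m : ℕ) : ℝ) ≤ Real.exp (2 * m) := by
    push_cast
    calc (5 : ℝ) ^ m ≤ Real.exp 2 ^ m := pow_le_pow_left₀ (by norm_num) h5 m
      _ = Real.exp (2 * m) := by rw [← Real.exp_nat_mul, mul_comm]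
  have hF1 : (1 : ℝ) ≤ Real.exp (2 * m) := Real.one_le_exp (by positivity)
  calc (P : ℝ) * ((5 ^ m : ℕ) * (6 * Real.exp (-x)) + (5 ^ m : ℕ) * ((5 ^ m : ℕ)
        * (6 * Real.exp (-y))))
      ≤ Real.exp L * (Real.exp (2 * m) * (6 * Real.exp (-z)) + Real.exp (2 * m)
        * (Real.exp (2 * m) * (6 * Real.exp (-z)))) := by
        rw [hP]; gcongr
    _ ≤ Real.exp L * (Real.exp (2 * m) * (Real.exp (2 * m) * (6 * Real.exp (-z)))
        + Real.exp (2 * m) * (Real.exp (2 * m) * (6 * Real.exp (-z)))) := by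
        have := le_mul_of_one_le_left (by positivity : 0 ≤ 6 * Real.exp (-z)) hF1
        gcongr Real.exp L * (Real.exp (2 * m) * ?_ + _)
    _ = 12 * Real.exp (L + 2 * m + 2 * m - z) := by
        rw [sub_eq_add_neg, Real.exp_add, Real.exp_add, Real.exp_add]; ring
    _ ≤ 12 * Real.exp (-(δ * R - 4)) := by
        gcongr
        simp only [z]
        nlinarith [mul_nonneg (by linarith : (0:ℝ) ≤ δ * R - 4) (by linarith : 0 ≤ L + m - 1)]

end GTNAR

theorem corollary1 {q : ℕ} (hq : 0 < q) (G : Fin q → ℕ) (S : ℕ → GTNAR.Model G)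
    (hN : ∀ l, Tendsto (fun n => (S n).N l) atTop atTop)
    (hT : Tendsto (fun n => (S n).T) atTop atTop)
    (B C τ K κ cπ : ℝ) (σ : ℝ≥0) (cgap : ℕ → ℝ)
    (hτ : 0 < τ) (hσ : 0 < σ) (hK : 0 < K) (hκ : κ < 1) (hcπ : 0 < cπ) (hcgap : ∀ n, 0 < cgap n ∧ cgap n ≤ C)
    (hparam : ∀ n, (S n).BoundedParam B)
    (hconvex : ∀ᶠ n in atTop, (S n).Convexity τ)
    (hnoise : ∀ n, (S n).SubGaussianNoise σ)
    (hcov : ∀ n, (S n).ConcentratedCovariates K)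
    (hstab : ∀ n, (S n).Stability κ)
    (hgap : ∀ n, (S n).GroupGap (cgap n))
    (hprop : ∀ᶠ n in atTop, (S n).GroupProportion cπ)
    (hrate : Tendsto
      (fun n => √((S n).T : ℝ) * cgap n / ((∑ l, Real.log ((S n).N l : ℝ)) + ((S n).m : ℝ)))
      atTop atTop)
    (ξhat : ∀ n, (S n).Ω → GTNAR.Param G (S n).p)
    (ghat : ∀ n, (S n).Ω → GTNAR.Membership (S n).N G)
    (hest : ∀ n, ∀ᵐ ω ∂(S n).μ, (S n).IsEstimate ω (ξhat n ω) (ghat n ω))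
    (ξor : ∀ n, (S n).Ω → GTNAR.Param G (S n).p)
    (hor : ∀ n, ∀ᵐ ω ∂(S n).μ, (S n).IsOracleEstimate ω (ξor n ω)) :
    GTNAR.WithProbTendsToOne (fun n => (S n).μ)
      (fun n => {ω | ∃ π : ∀ l, Equiv.Perm (Fin (G l)),
        ∀ l i, ghat n ω l i = π l ((S n).g₀ l i)}) ∧
    GTNAR.WithProbTendsToOne (fun n => (S n).μ)
      (fun n => {ω | ∃ π : ∀ l, Equiv.Perm (Fin (G l)),
        (∀ l i, ghat n ω l i = π l ((S n).g₀ l i)) ∧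
        GTNAR.Param.relabel π (ξhat n ω) = ξor n ω}) := by
  suffices h : GTNAR.WithProbTendsToOne (fun n => (S n).μ)
      (fun n => {ω | ∃ π : ∀ l, Equiv.Perm (Fin (G l)),
        (∀ l i, ghat n ω l i = π l ((S n).g₀ l i)) ∧
        GTNAR.Param.relabel π (ξhat n ω) = ξor n ω}) by
    refine ⟨?_, h⟩
    refine tendsto_of_tendsto_of_tendsto_of_le_of_le tendsto_const_nhds h
      (fun n => zero_le) fun n => measure_mono ?_
    exact Set.compl_subset_compl.2 fun ω ⟨π, hπ, _⟩ => ⟨π, hπ⟩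
  have hC : 0 < C := (hcgap 0).1.trans_le (hcgap 0).2
  obtain ⟨C₀, hC₀, hconc⟩ := GTNAR.Model.exists_concentration q B K κ σ hσ hK hκ
  obtain ⟨γ, hγ, hγπ⟩ : ∃ γ : ℝ, 0 < γ ∧ ∀ l, γ * G l ≤ cπ := by
    have h0 : (0 : ℝ) < ∑ l, (G l : ℝ) + 1 := by positivity
    refine ⟨cπ / (∑ l, (G l : ℝ) + 1), by positivity, fun l => ?_⟩
    rw [div_mul_eq_mul_div, div_le_iff₀ h0]
    gcongr
    have := Finset.single_le_sum (f := fun l => (G l : ℝ)) (fun _ _ => Nat.cast_nonneg _)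
      (Finset.mem_univ l)
    linarith
  have ha : 0 < τ / 2 := by positivity
  have hM : 0 < C₀ ^ 2 + τ / 2 := by positivity
  obtain ⟨r, hr, hrc⟩ := GTNAR.exists_errorFactor q ha hM hγ hC
  set δ : ℝ := min (r / (2 * C₀)) (τ / (16 * C₀ * C)) with hδ
  have hδ0 : 0 < δ := lt_min (by positivity) (by positivity)
  set R : ℕ → ℝ := fun n =>
    √((S n).T : ℝ) * cgap n / ((∑ l, Real.log ((S n).N l : ℝ)) + ((S n).m : ℝ)) with hR
  have hδR : Tendsto (fun n => δ * R n) atTop atTop := hrate.const_mul_atTop hδ0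
  have hlim : Tendsto (fun n => ENNReal.ofReal (12 * Real.exp (-(δ * R n - 4)))) atTop (𝓝 0) := by
    rw [← ENNReal.ofReal_zero]
    refine ENNReal.tendsto_ofReal ?_
    rw [← mul_zero (12 : ℝ)]
    exact (Real.tendsto_exp_neg_atTop_nhds_zero.comp
      (tendsto_atTop_add_const_right _ (-4) hδR)).const_mul 12
  refine tendsto_of_tendsto_of_tendsto_of_le_of_le' tendsto_const_nhds hlim
    (Eventually.of_forall fun n => zero_le) ?_
  filter_upwards [hconvex, hprop, hT.eventually_gt_atTop 0,
    eventually_all.2 fun l => (hN l).eventually_gt_atTop 0, hδR.eventually_ge_atTop 4]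
    with n hcv hpr hTn hNn hRn
  obtain ⟨hc0, hcC⟩ := hcgap n
  obtain ⟨hc₁, hc₂⟩ := hrc (cgap n) hc0 hcC
  have hlogs : 0 ≤ ∑ l, Real.log ((S n).N l : ℝ) :=
    Finset.sum_nonneg fun l _ => Real.log_natCast_nonneg _
  have hm : 1 ≤ (S n).m := Nat.le_add_left 1 _
  have hm' : (1 : ℝ) ≤ (S n).m := by exact_mod_cast hm
  have hRD : R n * ((∑ l, Real.log ((S n).N l : ℝ)) + ((S n).m : ℝ)) = √((S n).T : ℝ) * cgap n :=
    div_mul_cancel₀ _ (by linarith)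
  calc (S n).μ _ ≤ (S n).μ ((S n).goodEvent (τ / 2) (C₀ ^ 2 + τ / 2) (r * cgap n))ᶜ := by
        refine measure_mono_ae ?_
        filter_upwards [hest n, hor n, (S n).ae_loss_eq (hstab n)] with ω h1 h2 h3 hE hω
        exact hE ((S n).recovery_of_mem_goodEvent ha hM hTn hNn hω h3 (hgap n) hpr hcπ hγ hγπ
          hc₁ hc₂ h1 h2)
    _ ≤ _ := GTNAR.Model.measure_compl_goodEvent_le hσ (hnoise n) (hstab n) hcv hTn hC₀
        (hconc (S n) (hparam n) (hnoise n) (hcov n) (hstab n) hTn)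
    _ ≤ ENNReal.ofReal (12 * Real.exp (-(δ * R n - 4))) := by
        refine GTNAR.union_bound_le (L := ∑ l, Real.log ((S n).N l : ℝ)) ?_ hlogs hm hRn ?_ ?_
        · rw [Real.exp_sum, Fintype.card_pi]
          push_cast
          refine Finset.prod_congr rfl fun l _ => ?_
          rw [Real.exp_log (by exact_mod_cast hNn l), Fintype.card_fin]
        · rw [mul_assoc, hRD]
          calc δ * (√((S n).T : ℝ) * cgap n) ≤ r / (2 * C₀) * (√((S n).T : ℝ) * cgap n) := by
                gcongr; exact min_le_left _ _
            _ = _ := by ring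
        · rw [mul_assoc, hRD]
          calc δ * (√((S n).T : ℝ) * cgap n)
              ≤ τ / (16 * C₀ * C) * (√((S n).T : ℝ) * C) := by
                gcongr; exact min_le_right _ _
            _ = _ := by field_simp
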